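/- **The language.** Fix infinite sets of actor classes $C$, method names $m$, field names $f$ and variables $x$. Expressions and processes are $$E ::= f \mid x \mid \mathtt{new}\,C(\tilde E),\qquad P ::= 0 \mid (f\leftarrow E).P \mid \mathtt{let}\ x=E\ \mathtt{in}\ P \mid x!m(\tilde E).P \mid [E=E']P;Q \mid P+Q,$$ where $\mathtt{let}$ binds $x$ in $P$ and processes are taken up to $\alpha$-conversion. A *program* consists of a main process, a tuple $\mathrm{fields}(C)$ of distinct field names for each class $C$ (empty for all but finitely many classes), and finitely many method definitions $C.m(\tilde x)=P$ with distinct parameters, at most one for each pair $(C,m)$, where $P$ may use the special variable $\mathit{this}$. Every $\mathtt{new}\,C(\tilde E)$ in the program has $|\tilde E|=|\mathrm{fields}(C)|$, and the fields occurring in a method body of $C$ belong to $\mathrm{fields}(C)$. The program belongs to $\mathtt{Actor^{ro}_{ba}}$ if $\mathtt{new}$ occurs in the main process only and no field update $(f\leftarrow E)$ occurs. **Semantics.** Each class has infinitely many, totally ordered actor names, and there is a further actor name $\aleph$ (the root) of a class without fields and methods. *Values* are variables and actor names; at run time actor names may stand for variables. A *configuration* is a finite set of terms $A\triangleright(P,\varphi,q)$,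 at most one for each actor name $A$, where $P$ is a process, $\varphi$ maps the fields of the class of $A$ to values, and $q$ is a queue of messages $m(\tilde U)$ with $\tilde U$ values. In state $\varphi$, a value evaluates to itself, $f$ to $\varphi(f)$, and $\mathtt{new}\,C(\tilde E)$ to the first unused name $B$ of class $C$, adding $B\triangleright(0,[\mathrm{fields}(C)\mapsto\tilde U],\varepsilon)$ to the configuration, where $\tilde U$ are the values of $\tilde E$. A step $S\to S'$ picks a term $A\triangleright(P,\varphi,q)$ of $S$ and rewrites it as follows, keeping the other terms and adding the actors created by evaluation: * if $P=(f\leftarrow E).P'$: continue as $P'$ with $\varphi(f)$ set to the value of $E$; * if $P=\mathtt{let}\ x=E\ \mathtt{in}\ P'$: continue as $P'\{U/x\}$, with $U$ the value of $E$; * if $P=B!m(\tilde E).P'$ and $B$ (possibly $A$ itself) is an actor of $S$: continue as $P'$ and append $m(\tilde U)$ to the queue of $B$, with $\tilde U$ the values of $\tilde E$; * if $P=[E=E']P';Q$: continue as $P'$ if $E,E'$ have equal values, and as $Q$ if they have different values; * if $P=P'+Q$: continue as $P'$ or as $Q$; * if $P=0$, $q=m(\tilde U)\cdot q'$, $A$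 is of class $C$, $C.m(\tilde x)=R$ is a definition and $|\tilde U|=|\tilde x|$: the queue becomes $q'$ and the process becomes $R$ with $\mathit{this}$ replaced by $A$, $\tilde x$ by $\tilde U$, and the other free variables of $R$ by the least distinct variables that occur neither in $S$ nor free in the main process. The initial configuration is $\aleph\triangleright(\text{main process},\varnothing,\varepsilon)$. **States.** Let $F$ be the set of free variables of the main process. For a program of $\mathtt{Actor^{ro}_{ba}}$ let $\mathcal S$ be the set of configurations such that: the root is present with empty state and queue, and the free variables of its process are in $F$; every other actor has a state with values that are actor names or variables in $F$, and a process without $\mathtt{new}$; no process contains a field update or $\mathit{this}$; the actor names that occur are names of actors of the configuration other than $\aleph$. The set $\mathcal S$ contains the initial configuration and is closed under $\to$, so it contains all reachable configurations. **Ordering.** Renamings are maps $\rho$ from variables not in $F$ to values. Write $\rho\stackrel{\bullet}{=}\rho'$ if for all $x,y\notin F$: $\rho(x)=\rho(y)$ iff $\rho'(x)=\rho'(y)$; and $\rho(x)=\rho'(x)$ whenever $\rho(x)$ or $\rho'(x)$ is an actor name or in $F$. Let $\simeq$ be the least relation with $P\rho\simeq P\rho'$ and $m(\rho(x_1),\dots,\rho(x_k))\simeq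 m(\rho'(x_1),\dots,\rho'(x_k))$ whenever $\rho\stackrel{\bullet}{=}\rho'$ (with $x_i\notin F$). For queues, $q\le q'$ if $q$ is related letter by letter by $\simeq$ to a (not necessarily contiguous) subsequence of $q'$. For configurations, $S\preceq S'$ if $S$ and $S'$ have the same actors and, for each actor, its terms $A\triangleright(P,\varphi,q)$ in $S$ and $A\triangleright(P',\varphi',q')$ in $S'$ satisfy $P\simeq P'$, $\varphi=\varphi'$ and $q\le q'$. **Theorem.** In programs of $\mathtt{Actor^{ro}_{ba}}$ the control-state reachability problem is decidable: there is an algorithm that, given a program of $\mathtt{Actor^{ro}_{ba}}$ and configurations $S,T\in\mathcal S$ of it, decides whether there is $T'\succeq T$ with $S\to^* T'$. -/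

import Mathlib

/-!  The actor language, its operational semantics, and control-state reachability.

The names of the language (actor classes, method names, field names, variables) are natural numbers;
the four sorts are kept apart by the places in which they occur. Bound variables are de Bruijn
indices, so that processes that are equal up to alpha-conversion are equal. -/

namespace ActorLang

/-- Actor names: the root, which belongs to a class of its own without fields and methods, and
infinitely many names `mk C i` for every actor class `C`, ordered by `i`. -/
inductive Actor where
  | root : Actor
  | mk (cls idx : ℕ) : Actor
  deriving DecidableEq

/-- Values: variables and actor names. -/
inductive Value where
  | var (x : ℕ) : Value
  | act (A : Actor) : Value
  deriving DecidableEq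

/-- What may stand where the grammar has a variable: an index bound by a `let`, the special variable
`this`, or a value (an actor name occurs at run time only). -/
inductive Ref where
  | bvar (i : ℕ) : Ref
  | this : Ref
  | val (v : Value) : Ref
  deriving DecidableEq

/-- Expressions `f`, `x`, `new C(E₁, …, Eₙ)`. -/
inductive Exp where
  | fld (f : ℕ) : Exp
  | ref (r : Ref) : Exp
  | new (C : ℕ) (es : List Exp) : Exp

/-- Processes `0`, `(f ← E).P`, `let x = E in P` (index `0` of `P` is bound), `x!m(E₁, …, Eₙ).P`,
`[E = E'] P ; Q`, `P + Q`. -/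
inductive Proc where
  | nil : Proc
  | upd (f : ℕ) (e : Exp) (P : Proc) : Proc
  | letin (e : Exp) (P : Proc) : Proc
  | send (r : Ref) (m : ℕ) (es : List Exp) (P : Proc) : Proc
  | ite (e e' : Exp) (P Q : Proc) : Proc
  | plus (P Q : Proc) : Proc

/-! ### Occurrences -/

mutual
/-- The variables, indices and actor names occurring in an expression. -/
def Exp.refs : Exp → List Ref
  | .fld _ => []
  | .ref r => [r]
  | .new _ es => Exp.refsList es
/-- The same for a tuple of expressions. -/
def Exp.refsList : List Exp → List Ref
  | [] => []
  | e :: es => e.refs ++ Exp.refsList es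
end

mutual
/-- The field names occurring in an expression. -/
def Exp.flds : Exp → List ℕ
  | .fld f => [f]
  | .ref _ => []
  | .new _ es => Exp.fldsList es
/-- The same for a tuple of expressions. -/
def Exp.fldsList : List Exp → List ℕ
  | [] => []
  | e :: es => e.flds ++ Exp.fldsList es
end

mutual
/-- The subexpressions `new C(E₁, …, Eₙ)` of an expression, each recorded as the pair `(C, n)`. -/
def Exp.news : Exp → List (ℕ × ℕ)
  | .fld _ => []
  | .ref _ => []
  | .new C es => (C, es.length) :: Exp.newsList es
/-- The same for a tuple of expressions. -/
def Exp.newsList : List Exp → List (ℕ × ℕ)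
  | [] => []
  | e :: es => e.news ++ Exp.newsList es
end

/-- The variables, indices and actor names occurring in a process. -/
def Proc.refs : Proc → List Ref
  | .nil => []
  | .upd _ e P => e.refs ++ P.refs
  | .letin e P => e.refs ++ P.refs
  | .send r _ es P => r :: (Exp.refsList es ++ P.refs)
  | .ite e e' P Q => e.refs ++ e'.refs ++ P.refs ++ Q.refs
  | .plus P Q => P.refs ++ Q.refs

/-- The field names occurring in a process. -/
def Proc.flds : Proc → List ℕ
  | .nil => []
  | .upd f e P => f :: (e.flds ++ P.flds)
  | .letin e P => e.flds ++ P.flds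
  | .send _ _ es P => Exp.fldsList es ++ P.flds
  | .ite e e' P Q => e.flds ++ e'.flds ++ P.flds ++ Q.flds
  | .plus P Q => P.flds ++ Q.flds

/-- The expressions `new C(E₁, …, Eₙ)` occurring in a process, each recorded as `(C, n)`. -/
def Proc.news : Proc → List (ℕ × ℕ)
  | .nil => []
  | .upd _ e P => e.news ++ P.news
  | .letin e P => e.news ++ P.news
  | .send _ _ es P => Exp.newsList es ++ P.news
  | .ite e e' P Q => e.news ++ e'.news ++ P.news ++ Q.news
  | .plus P Q => P.news ++ Q.news

/-- The process contains no field update. -/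
def Proc.UpdFree : Proc → Prop
  | .nil => True
  | .upd _ _ _ => False
  | .letin _ P => P.UpdFree
  | .send _ _ _ P => P.UpdFree
  | .ite _ _ P Q => P.UpdFree ∧ Q.UpdFree
  | .plus P Q => P.UpdFree ∧ Q.UpdFree

/-- All indices in the list are smaller than `k`. -/
def RefsBelow (k : ℕ) (l : List Ref) : Prop := ∀ i, Ref.bvar i ∈ l → i < k

/-- Under `k` enclosing binders every index of the process is bound. -/
def Proc.ClosedAt : ℕ → Proc → Prop
  | _, .nil => True
  | k, .upd _ e P => RefsBelow k e.refs ∧ P.ClosedAt k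
  | k, .letin e P => RefsBelow k e.refs ∧ P.ClosedAt (k + 1)
  | k, .send r _ es P => RefsBelow k (r :: Exp.refsList es) ∧ P.ClosedAt k
  | k, .ite e e' P Q => RefsBelow k (e.refs ++ e'.refs) ∧ P.ClosedAt k ∧ Q.ClosedAt k
  | k, .plus P Q => P.ClosedAt k ∧ Q.ClosedAt k

/-- The variables among a list of values. -/
def varsOf (l : List Value) : List ℕ :=
  l.filterMap fun v => match v with | .var x => some x | .act _ => none

/-- The actor names among a list of values. -/
def actsOf (l : List Value) : List Actor :=
  l.filterMap fun v => match v with | .var _ => none | .act A => some A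

/-- The values (free variables and actor names) occurring in a process. -/
def Proc.values (P : Proc) : List Value :=
  P.refs.filterMap fun r => match r with | .val v => some v | _ => none

/-- The free variables of a process. -/
def Proc.vars (P : Proc) : List ℕ := varsOf P.values

/-! ### Substitution -/

mutual
/-- Replace every atom of an expression. -/
def Exp.mapRef (g : Ref → Ref) : Exp → Exp
  | .fld f => .fld f
  | .ref r => .ref (g r)
  | .new C es => .new C (Exp.mapRefList g es)
/-- The same for a tuple of expressions. -/
def Exp.mapRefList (g : Ref → Ref) : List Exp → List Exp
  | [] => []
  | e :: es => e.mapRef g :: Exp.mapRefList g es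
end

/-- Replace every atom of a process; `g k` acts under `k` binders. -/
def Proc.mapRef (g : ℕ → Ref → Ref) : ℕ → Proc → Proc
  | _, .nil => .nil
  | k, .upd f e P => .upd f (e.mapRef (g k)) (P.mapRef g k)
  | k, .letin e P => .letin (e.mapRef (g k)) (P.mapRef g (k + 1))
  | k, .send r m es P => .send (g k r) m (Exp.mapRefList (g k) es) (P.mapRef g k)
  | k, .ite e e' P Q => .ite (e.mapRef (g k)) (e'.mapRef (g k)) (P.mapRef g k) (Q.mapRef g k)
  | k, .plus P Q => .plus (P.mapRef g k) (Q.mapRef g k)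

/-- `P{U/x}`, where `P` is the body of a `let` that binds `x`. -/
def Proc.openWith (P : Proc) (U : Value) : Proc :=
  P.mapRef (fun k r => if r = .bvar k then .val U else r) 0

/-- Simultaneous substitution of `A` for `this` and of `σ x` for every free variable `x`. -/
def Proc.instantiate (P : Proc) (A : Actor) (σ : ℕ → Value) : Proc :=
  P.mapRef (fun _ r => match r with
    | .this => .val (.act A)
    | .val (.var x) => .val (σ x)
    | r => r) 0

/-! ### Programs -/

/-- A definition `C.m(x₁, …, xₙ) = P`. -/
structure MethodDef where
  cls : ℕ
  name : ℕ
  params : List ℕ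
  body : Proc

/-- A program: a main process, the tuples of field names of the actor classes (a class that is not
listed has no fields), and a finite collection of method definitions. -/
structure Program where
  main : Proc
  fieldTable : List (ℕ × List ℕ)
  methods : List MethodDef

/-- The tuple of field names of an actor class. -/
def Program.fields (p : Program) (C : ℕ) : List ℕ := (p.fieldTable.lookup C).getD []

/-- `p` is a program of the language: its processes are built by the grammar (all indices bound,
no actor names, `this` in method bodies only), formal parameters are distinct, the field names of a
class are distinct, and `p` is unambiguous and correct. -/
structure Program.WellFormed (p : Program) : Prop where
  main_closed : p.main.ClosedAt 0
  main_static : actsOf p.main.values = []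
  main_this : Ref.this ∉ p.main.refs
  body_closed : ∀ d ∈ p.methods, d.body.ClosedAt 0
  body_static : ∀ d ∈ p.methods, actsOf d.body.values = []
  params_nodup : ∀ d ∈ p.methods, d.params.Nodup
  fields_nodup : ∀ C, (p.fields C).Nodup
  unambiguous : (p.methods.map fun d => (d.cls, d.name)).Nodup
  main_news : ∀ C n, (C, n) ∈ p.main.news → n = (p.fields C).length
  body_news : ∀ d ∈ p.methods, ∀ C n, (C, n) ∈ d.body.news → n = (p.fields C).length
  body_flds : ∀ d ∈ p.methods, ∀ f ∈ d.body.flds, f ∈ p.fields d.cls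

/-- Bounded actors: `new` occurs in the main process only. -/
def Program.BoundedActors (p : Program) : Prop := ∀ d ∈ p.methods, d.body.news = []

/-- Read-only fields: there is no field update. -/
def Program.ReadOnly (p : Program) : Prop :=
  p.main.UpdFree ∧ ∀ d ∈ p.methods, d.body.UpdFree

/-! ### Configurations -/

/-- The state of an actor, a finite map from field names to values. -/
abbrev State := List (ℕ × Value)

/-- A message `m(U₁, …, Uₙ)`. -/
abbrev Msg := ℕ × List Value

/-- What an actor carries in a configuration: its process, its state and its queue. -/
structure Cell where
  proc : Proc
  state : State
  queue : List Msg

/-- A configuration, as a list of terms `A ▷ (P, φ, q)`; the order is immaterial. -/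
abbrev Config := List (Actor × Cell)

/-- The values occurring in a cell. -/
def Cell.values (c : Cell) : List Value :=
  c.proc.values ++ c.state.map Prod.snd ++ c.queue.flatMap Prod.snd

/-- The names of the actors of a configuration. -/
def Config.dom (S : Config) : List Actor := S.map Prod.fst

/-- The values occurring in a configuration. -/
def Config.values (S : Config) : List Value := S.flatMap fun t => t.2.values

/-- Replace what `A` carries. -/
def Config.set (S : Config) (A : Actor) (c : Cell) : Config :=
  S.map fun t => if t.1 = A then (A, c) else t

/-- Append a message to the queue of `A`. -/
def Config.push (S : Config) (A : Actor) (msg : Msg) : Config :=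
  S.map fun t => if t.1 = A then (A, ⟨t.2.proc, t.2.state, t.2.queue ++ [msg]⟩) else t

/-- The initial configuration of a program. -/
def Program.init (p : Program) : Config := [(Actor.root, ⟨p.main, [], []⟩)]

/-! ### Fresh names -/

/-- The least `n` natural numbers that are not in the list `used`. -/
def leastUnused (n : ℕ) (used : List ℕ) : List ℕ :=
  ((List.range (used.length + n)).filter fun i => decide (i ∉ used)).take n

/-- The first name of class `C` that is not in the list `used`. -/
def freshActor (C : ℕ) (used : List Actor) : Actor :=
  .mk C ((leastUnused 1 (used.filterMap fun A => match A with
    | .root => none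
    | .mk D i => if D = C then some i else none)).headD 0)

/-- The least `n` variables that occur neither in `S` nor free in the main process. -/
def freshVars (p : Program) (S : Config) (n : ℕ) : List ℕ :=
  leastUnused n (p.main.vars ++ varsOf S.values)

/-! ### Operational semantics -/

mutual
/-- `E.eval p φ used = some (U, N)`: in the state `φ`, with the actor names `used` being in use, `E`
evaluates to `U` and creates the actors in `N`. It is `none` if `E` has no value. -/
def Exp.eval (p : Program) (φ : State) (used : List Actor) : Exp → Option (Value × Config)
  | .fld f => (φ.lookup f).map fun U => (U, [])
  | .ref (.val U) => some (U, [])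
  | .ref _ => none
  | .new C es =>
    match Exp.evalList p φ used es with
    | none => none
    | some (Us, N) =>
      if Us.length = (p.fields C).length then
        let A := freshActor C (used ++ Config.dom N)
        some (.act A, (A, ⟨.nil, (p.fields C).zip Us, []⟩) :: N)
      else none
/-- Evaluation of a tuple of expressions. -/
def Exp.evalList (p : Program) (φ : State) (used : List Actor) :
    List Exp → Option (List Value × Config)
  | [] => some ([], [])
  | e :: es =>
    match e.eval p φ used with
    | none => none
    | some (U, N) =>
      match Exp.evalList p φ (used ++ Config.dom N) es with
      | none => none
      | some (Us, N') => some (U :: Us, N ++ N')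
end

/-- The body of a method, instantiated for the actor `A`, the arguments `Us` and the configuration
`S`: the formal parameters are replaced by `Us`, the other free variables by fresh ones, and
`this` by `A`. -/
def MethodDef.start (p : Program) (S : Config) (d : MethodDef) (A : Actor) (Us : List Value) :
    Proc :=
  let ys := (d.body.vars.filter fun x => decide (x ∉ d.params)).dedup
  let ys' := freshVars p S ys.length
  d.body.instantiate A fun x =>
    ((d.params.zip Us ++ ys.zip (ys'.map Value.var)).lookup x).getD (.var x)

/-- The transition relation. Fresh names are chosen with respect to the whole configuration, so that
the context rule is built into the other rules; `invk` covers both an invocation of another actor and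
an invocation by an actor of its own methods. -/
inductive Step (p : Program) : Config → Config → Prop
  | upd {S : Config} {A : Actor} {f : ℕ} {e : Exp} {P : Proc} {φ : State} {q : List Msg}
      {U : Value} {N : Config}
      (hA : S.lookup A = some ⟨.upd f e P, φ, q⟩) (hf : f ∈ φ.map Prod.fst)
      (he : e.eval p φ (Config.dom S) = some (U, N)) :
      Step p S
        (Config.set S A ⟨P, φ.map (fun b => if b.1 = f then (f, U) else b), q⟩ ++ N)
  | letin {S : Config} {A : Actor} {e : Exp} {P : Proc} {φ : State} {q : List Msg}
      {U : Value} {N : Config}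
      (hA : S.lookup A = some ⟨.letin e P, φ, q⟩)
      (he : e.eval p φ (Config.dom S) = some (U, N)) :
      Step p S (Config.set S A ⟨P.openWith U, φ, q⟩ ++ N)
  | invk {S : Config} {A B : Actor} {m : ℕ} {es : List Exp} {P : Proc} {φ : State} {q : List Msg}
      {Us : List Value} {N : Config}
      (hA : S.lookup A = some ⟨.send (.val (.act B)) m es P, φ, q⟩) (hB : B ∈ Config.dom S)
      (he : Exp.evalList p φ (Config.dom S) es = some (Us, N)) :
      Step p S (Config.push (Config.set S A ⟨P, φ, q⟩) B (m, Us) ++ N)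
  | inst {S : Config} {C i : ℕ} {φ : State} {q : List Msg} {d : MethodDef} {Us : List Value}
      (hA : S.lookup (.mk C i) = some ⟨.nil, φ, (d.name, Us) :: q⟩)
      (hd : d ∈ p.methods) (hC : d.cls = C) (hlen : Us.length = d.params.length) :
      Step p S (Config.set S (.mk C i) ⟨d.start p S (.mk C i) Us, φ, q⟩)
  | eqTrue {S : Config} {A : Actor} {e e' : Exp} {P Q : Proc} {φ : State} {q : List Msg}
      {U : Value} {N : Config}
      (hA : S.lookup A = some ⟨.ite e e' P Q, φ, q⟩)
      (he : Exp.evalList p φ (Config.dom S) [e, e'] = some ([U, U], N)) :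
      Step p S (Config.set S A ⟨P, φ, q⟩ ++ N)
  | eqFalse {S : Config} {A : Actor} {e e' : Exp} {P Q : Proc} {φ : State} {q : List Msg}
      {U V : Value} {N : Config}
      (hA : S.lookup A = some ⟨.ite e e' P Q, φ, q⟩)
      (he : Exp.evalList p φ (Config.dom S) [e, e'] = some ([U, V], N)) (hne : U ≠ V) :
      Step p S (Config.set S A ⟨Q, φ, q⟩ ++ N)
  | plusLeft {S : Config} {A : Actor} {P Q : Proc} {φ : State} {q : List Msg}
      (hA : S.lookup A = some ⟨.plus P Q, φ, q⟩) :
      Step p S (Config.set S A ⟨P, φ, q⟩)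
  | plusRight {S : Config} {A : Actor} {P Q : Proc} {φ : State} {q : List Msg}
      (hA : S.lookup A = some ⟨.plus P Q, φ, q⟩) :
      Step p S (Config.set S A ⟨Q, φ, q⟩)

/-- The states of the transition system of a program with bounded actors and read-only fields.
Actor names do not repeat; the root is present, has no state and an empty queue, and its process
has no free variables but those of the main process; every other actor has a state over the fields of
its class whose variables are free in the main process, and its process contains no `new`; no process
contains an update; the actor names that occur in the configuration are names of actors of the
configuration other than the root. The initial configuration is such, and so are its successors. -/
structure Program.IsConfig (p : Program) (S : Config) : Prop where
  nodup : (Config.dom S).Nodup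
  root : ∃ P : Proc, (Actor.root, (⟨P, [], []⟩ : Cell)) ∈ S ∧ ∀ x ∈ P.vars, x ∈ p.main.vars
  closed : ∀ A c, (A, c) ∈ S → c.proc.ClosedAt 0 ∧ Ref.this ∉ c.proc.refs
  updFree : ∀ A c, (A, c) ∈ S → c.proc.UpdFree
  newFree : ∀ C i c, (Actor.mk C i, c) ∈ S → c.proc.news = []
  state : ∀ C i c, (Actor.mk C i, c) ∈ S → c.state.map Prod.fst = p.fields C ∧
    ∀ f x, (f, Value.var x) ∈ c.state → x ∈ p.main.vars
  names : ∀ A ∈ actsOf (Config.values S), A ∈ Config.dom S ∧ A ≠ Actor.root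

/-! ### The ordering and control-state reachability -/

/-- `U` is an actor name or a variable in `F`. -/
def Value.Rigid (F : List ℕ) : Value → Prop
  | .var x => x ∈ F
  | .act _ => True

/-- The relation on renamings, which are functions from the variables not in `F` to values:
`ρ` and `ρ'` identify the same variables, and agree where one of them returns an actor name or a
variable in `F`. -/
def RenEq (F : List ℕ) (ρ ρ' : ℕ → Value) : Prop :=
  ∀ x, x ∉ F → (∀ y, y ∉ F → (ρ x = ρ y ↔ ρ' x = ρ' y)) ∧
    ((ρ x).Rigid F ∨ (ρ' x).Rigid F → ρ x = ρ' x)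

/-- `Pρ`, for a renaming `ρ` of the variables not in `F`. -/
def Proc.rename (F : List ℕ) (ρ : ℕ → Value) (P : Proc) : Proc :=
  P.mapRef (fun _ r => match r with
    | .val (.var x) => if x ∈ F then .val (.var x) else .val (ρ x)
    | r => r) 0

/-- `Pρ ≃ Pρ'` whenever `ρ` and `ρ'` are related. -/
inductive ProcSim (F : List ℕ) : Proc → Proc → Prop
  | mk (P : Proc) (ρ ρ' : ℕ → Value) (h : RenEq F ρ ρ') :
      ProcSim F (P.rename F ρ) (P.rename F ρ')

/-- `m(ρ(x₁), …, ρ(xₖ)) ≃ m(ρ'(x₁), …, ρ'(xₖ))` whenever `ρ` and `ρ'` are related. -/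
inductive MsgSim (F : List ℕ) : Msg → Msg → Prop
  | mk (m : ℕ) (xs : List ℕ) (hxs : ∀ x ∈ xs, x ∉ F) (ρ ρ' : ℕ → Value) (h : RenEq F ρ ρ') :
      MsgSim F (m, xs.map ρ) (m, xs.map ρ')

/-- The ordering on what an actor carries: similar processes, equal states, and the first queue
embedded into the second one, up to similarity of messages. -/
def CellLE (F : List ℕ) (c c' : Cell) : Prop :=
  ProcSim F c.proc c'.proc ∧ c.state = c'.state ∧
    List.SublistForall₂ (MsgSim F) c.queue c'.queue

/-- The ordering on configurations of `p`: the same actors, and `CellLE` at each of them. -/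
def ConfigLE (p : Program) (S S' : Config) : Prop :=
  ∀ A : Actor, Option.Rel (CellLE p.main.vars) (S.lookup A) (S'.lookup A)

/-- The question of the control-state reachability problem: some `T'` above `T` is reachable
from `S`. -/
def ControlStateReachable (p : Program) (S T : Config) : Prop :=
  ∃ T' : Config, Relation.ReflTransGen (Step p) S T' ∧ ConfigLE p T T'

/-! ### Instances of the problem as natural numbers -/

def Actor.code : Actor → ℕ
  | .root => 0
  | .mk C i => Nat.pair C i + 1

def Value.code : Value → ℕ
  | .var x => Nat.pair 0 x
  | .act A => Nat.pair 1 A.code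

def Ref.code : Ref → ℕ
  | .bvar i => Nat.pair 0 i
  | .this => Nat.pair 1 0
  | .val v => Nat.pair 2 v.code

mutual
def Exp.code : Exp → ℕ
  | .fld f => Nat.pair 0 f
  | .ref r => Nat.pair 1 r.code
  | .new C es => Nat.pair 2 (Nat.pair C (Exp.codeList es))
def Exp.codeList : List Exp → ℕ
  | [] => 0
  | e :: es => Nat.pair e.code (Exp.codeList es) + 1
end

def Proc.code : Proc → ℕ
  | .nil => Nat.pair 0 0
  | .upd f e P => Nat.pair 1 (Nat.pair f (Nat.pair e.code P.code))
  | .letin e P => Nat.pair 2 (Nat.pair e.code P.code)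
  | .send r m es P =>
    Nat.pair 3 (Nat.pair r.code (Nat.pair m (Nat.pair (Exp.codeList es) P.code)))
  | .ite e e' P Q => Nat.pair 4 (Nat.pair e.code (Nat.pair e'.code (Nat.pair P.code Q.code)))
  | .plus P Q => Nat.pair 5 (Nat.pair P.code Q.code)

def MethodDef.code (d : MethodDef) : ℕ :=
  Encodable.encode (d.cls, d.name, d.params, d.body.code)

def Program.code (p : Program) : ℕ :=
  Encodable.encode (p.main.code, p.fieldTable, p.methods.map MethodDef.code)

def Cell.code (c : Cell) : ℕ :=
  Encodable.encode (c.proc.code, c.state.map fun b => (b.1, b.2.code),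
    c.queue.map fun msg => (msg.1, msg.2.map Value.code))

def Config.code (S : Config) : ℕ :=
  Encodable.encode (S.map fun t => (t.1.code, t.2.code))

/-- The number of the instance `(p, S, T)` of the control-state reachability problem. -/
def instanceCode (p : Program) (S T : Config) : ℕ :=
  Encodable.encode (p.code, Config.code S, Config.code T)

end ActorLang

-- The problem is reduced to coverability in a finite network of queue processes, and coverability
-- there is decided by two semi-decision procedures.
--
-- Reduction. Actors never disappear and fields never change, and `ConfigLE` asks for the same
-- actors with the same states; hence only runs whose actors all occur in the target `T`, with the
-- states they have there, are of interest. Fields hold only actor names and free variables of the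
-- main process. Every other variable matters only within one running process or one message,
-- through its equalities with its neighbours, since method bodies get fresh variables and no field
-- can store a received one. So a process is represented by the code of a program fragment with an
-- environment of abstract values, and a message by its canonical form up to renaming; both range
-- over finite sets. This gives a `Net` with one component per actor of `T`. `Rel.forward`,
-- `Rel.backward` and `final_iff` show that it simulates the program faithfully (`reach_net_iff`).
--
-- Coverability. Finite processes with perfect queues are Turing powerful in general. Here, however,
-- a component returns to one and the same idle state before each letter. Once it has consumed a
-- letter and is idle again, it can repeat the branch executed then, and this emits only letters
-- that their receivers have already received. A letter inserted behind an earlier occurrence of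
-- itself is therefore harmless: it can be flushed (`Net.exists_flush`), and what the flush leaves
-- at the ends of the queues is again repeated letters. Recording the sets of consumed letters,
-- reachability of the target is thus upward closed for the insertion of repeated letters
-- (`Net.Reach.mono`). This order is refined by a well-quasi-order on words over a finite alphabet,
-- by Higman's lemma for words whose repeated letters are marked (`Net.wordLE_pwo`).
--
-- Decision. Reachability is semi-decided by enumerating runs. Non-reachability is certified by a
-- finite quotient of the words, with the actions of the letters, and a set of abstract
-- configurations that contains the initial one, is closed under steps and avoids the target
-- (`Net.CertOK.not_reach`). A certificate exists whenever the target is unreachable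
-- (`Net.exists_certOK`): words are identified when they lead to the target in the same contexts.
-- These sets of contexts are upward closed and grow with the word, and a monotone map from a
-- well-quasi-order to the upward closed sets of a well-quasi-order has finite image
-- (`Set.PartiallyWellOrderedOn.finite_image`). Certificates are checked by primitive recursion.

/-- A network of processes that consume the letters of their queues one by one and return to the
idle state before the next letter. -/
structure Net (κ Λ : Type) where
  size : ℕ
  tau : ℕ → κ → List (κ × Option (ℕ × Λ))
  inst : ℕ → Λ → List κ
  idle : κ
  goal : ℕ → κ → Bool
  target : ℕ → List Λ

-- Nets, their runs and the flushing of letters.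

namespace Net

variable {κ Λ μ : Type}

/-- What an emission adds to queue `j`. -/
def emitTo (em : Option (ℕ × Λ)) (j : ℕ) : Option Λ :=
  em.bind fun e => if e.1 = j then some e.2 else none

/-- Replace component `i` and distribute an emission, where `app` appends to the queues. -/
def updWith (app : μ → Option Λ → μ) (σ : ℕ → κ × μ) (i : ℕ) (c : κ × μ) (em : Option (ℕ × Λ)) :
    ℕ → κ × μ := fun j =>
  ((if j = i then c else σ j).1, app (if j = i then c else σ j).2 (emitTo em j))

def appList (w : List Λ) (o : Option Λ) : List Λ := w ++ o.toList

/-- Replace component `i` and append an emission to the queues. -/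
abbrev upd (σ : ℕ → κ × List Λ) (i : ℕ) (c : κ × List Λ) (em : Option (ℕ × Λ)) :
    ℕ → κ × List Λ := updWith appList σ i c em

variable (n : Net κ Λ)

/-- A component may send to itself, since `updWith` replaces the component before it appends. What
is sent to an index beyond `size` is never looked at. -/
inductive Step : (ℕ → κ × List Λ) → (ℕ → κ × List Λ) → Prop
  | tau {σ i q' em} (hi : i < n.size) (h : (q', em) ∈ n.tau i (σ i).1) :
      Step σ (upd σ i (q', (σ i).2) em)
  | pop {σ i x w q'} (hi : i < n.size) (hid : (σ i).1 = n.idle) (hw : (σ i).2 = x :: w)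
      (h : q' ∈ n.inst i x) : Step σ (upd σ i (q', w) none)

def Final (σ : ℕ → κ × List Λ) : Prop :=
  ∀ i < n.size, n.goal i (σ i).1 = true ∧ (n.target i).Sublist (σ i).2

/-- Some configuration above the target is reachable. -/
def Reach (σ : ℕ → κ × List Λ) : Prop := ∃ σ', Relation.ReflTransGen n.Step σ σ' ∧ n.Final σ'

/-- A local step of component `i` all of whose emissions are allowed by `K`. -/
def LStep (K : ℕ → Λ → Prop) (i : ℕ) (q q' : κ) : Prop :=
  ∃ em, (q', em) ∈ n.tau i q ∧ ∀ j y, emitTo em j = some y → j < n.size → K j y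

/-- Local steps do not read queues, so a path of them can be executed in any configuration with the
right control; all it does to the queues is to append letters allowed by `K`. -/
theorem exists_run {K : ℕ → Λ → Prop} {i : ℕ} (hi : i < n.size) {q q' : κ}
    (h : Relation.ReflTransGen (n.LStep K i) q q') (σ : ℕ → κ × List Λ) (hσ : (σ i).1 = q) :
    ∃ σ', Relation.ReflTransGen n.Step σ σ' ∧ (σ' i).1 = q' ∧ (∀ j ≠ i, (σ' j).1 = (σ j).1) ∧
      ∀ j < n.size, ∃ e, (∀ y ∈ e, K j y) ∧ (σ' j).2 = (σ j).2 ++ e := by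
  induction h with
  | refl => exact ⟨σ, .refl, hσ, fun _ _ => rfl, fun j _ => ⟨[], by simp, by simp⟩⟩
  | tail _ hs ih =>
    obtain ⟨σ', hr, hq, hc, he⟩ := ih
    obtain ⟨em, hm, hK⟩ := hs
    rw [← hq] at hm
    refine ⟨_, hr.tail (.tau hi hm), by simp [updWith], fun j hj => by simp [updWith, hj, hc j hj],
      fun j hj => ?_⟩
    obtain ⟨e, h1, h2⟩ := he j hj
    refine ⟨e ++ (emitTo em j).toList, ?_, ?_⟩
    · intro y hy
      rcases List.mem_append.1 hy with hy | hy
      · exact h1 y hy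
      · exact hK j y (by simpa using hy) hj
    · by_cases hji : j = i
      · subst hji; simp [updWith, appList, h2]
      · simp [updWith, appList, hji, h2]

/-- Letters with a known complete branch can be removed from the front of an idle queue. -/
theorem exists_flush {K : ℕ → Λ → Prop} {i : ℕ} (hi : i < n.size) (p : List Λ)
    (hp : ∀ x ∈ p, ∃ q ∈ n.inst i x, Relation.ReflTransGen (n.LStep K i) q n.idle) :
    ∀ (r : List Λ) (σ : ℕ → κ × List Λ), (σ i).1 = n.idle → (σ i).2 = p ++ r →
    ∃ σ', Relation.ReflTransGen n.Step σ σ' ∧ (∀ j, (σ' j).1 = (σ j).1) ∧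
      ∀ j < n.size, ∃ e, (∀ y ∈ e, K j y) ∧ (σ' j).2 = (if j = i then r else (σ j).2) ++ e := by
  induction p with
  | nil =>
    intro r σ _ hw
    refine ⟨σ, .refl, fun _ => rfl, fun j _ => ⟨[], by simp, ?_⟩⟩
    by_cases hji : j = i
    · subst hji; simpa using hw
    · simp [hji]
  | cons x p ih =>
    intro r σ hid hw
    obtain ⟨q, hq, hpath⟩ := hp x (by simp)
    have s1 : n.Step σ (upd σ i (q, p ++ r) none) := .pop hi hid (by simpa using hw) hq
    obtain ⟨σ1, hr1, hq1, hc1, he1⟩ := n.exists_run hi hpath (upd σ i (q, p ++ r) none)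
      (by simp [updWith])
    obtain ⟨e, heK, hew⟩ := he1 i hi
    -- The branch may send letters to component `i` itself. They land behind `r`, which is why the
    -- induction is over all remainders.
    obtain ⟨σ2, hr2, hc2, he2⟩ := ih (fun y hy => hp y (by simp [hy])) (r ++ e) σ1 hq1
      (by simpa [updWith, appList, emitTo] using hew)
    refine ⟨σ2, (Relation.ReflTransGen.head s1 hr1).trans hr2, fun j => ?_, fun j hj => ?_⟩
    · rw [hc2]
      by_cases hji : j = i
      · subst hji; rw [hq1, hid]
      · rw [hc1 j hji]; simp [updWith, hji]
    · obtain ⟨e1, h1, h2⟩ := he1 j hj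
      obtain ⟨e2, h3, h4⟩ := he2 j hj
      by_cases hji : j = i
      · subst hji
        refine ⟨e ++ e2, ?_, by simpa using h4⟩
        intro y hy
        rcases List.mem_append.1 hy with hy | hy
        exacts [heK y hy, h3 y hy]
      · refine ⟨e1 ++ e2, ?_, ?_⟩
        · intro y hy
          rcases List.mem_append.1 hy with hy | hy
          exacts [h1 y hy, h3 y hy]
        · simp only [hji, if_false] at h4 ⊢
          rw [h4, h2]
          simp [updWith, appList, emitTo, hji]

theorem LStep.mono {n : Net κ Λ} {K K' : ℕ → Λ → Prop} (hK : ∀ j < n.size, ∀ y, K j y → K' j y)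
    {i : ℕ} {q q' : κ} (h : n.LStep K i q q') : n.LStep K' i q q' := by
  obtain ⟨em, h1, h2⟩ := h
  exact ⟨em, h1, fun j y hy hj => hK j hj y (h2 j y hy hj)⟩

theorem path_mono {n : Net κ Λ} {K K' : ℕ → Λ → Prop} (hK : ∀ j < n.size, ∀ y, K j y → K' j y)
    {i : ℕ} {q q' : κ} (h : Relation.ReflTransGen (n.LStep K i) q q') :
    Relation.ReflTransGen (n.LStep K' i) q q' :=
  h.lift id fun _ _ => LStep.mono hK

-- The invariant on consumed letters.

/-- The letters received by component `j` so far, if `h j` are those consumed. -/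
def Known (h : ℕ → Finset Λ) (σ : ℕ → κ × List Λ) (j : ℕ) (y : Λ) : Prop := y ∈ h j ∨ y ∈ (σ j).2

/-- Each consumed letter has a branch that is complete or still being executed, and all of whose
emissions have been received before. -/
def Inv (h : ℕ → Finset Λ) (σ : ℕ → κ × List Λ) : Prop :=
  ∀ i < n.size, ∀ x ∈ h i, ∃ q ∈ n.inst i x, ∃ q',
    Relation.ReflTransGen (n.LStep (Known h σ) i) q q' ∧ (q' = n.idle ∨ q' = (σ i).1)

/-- An emission is known at its receiver as soon as it is sent, so a branch in progress is prolonged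
by the step, and complete branches are unaffected. -/
theorem Inv.tau {n : Net κ Λ} {h : ℕ → Finset Λ} {σ : ℕ → κ × List Λ} (H : n.Inv h σ) {i : ℕ}
    {q' : κ} {em : Option (ℕ × Λ)} (hm : (q', em) ∈ n.tau i (σ i).1) :
    n.Inv h (upd σ i (q', (σ i).2) em) := by
  have hK : ∀ j < n.size, ∀ y, Known h σ j y → Known h (upd σ i (q', (σ i).2) em) j y := by
    rintro j - y (hy | hy)
    · exact .inl hy
    · right
      by_cases hji : j = i
      · subst hji; simp [updWith, appList, hy]
      · simp [updWith, appList, hji, hy]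
  intro k hk x hx
  obtain ⟨q, hq, q1, hr, hq1⟩ := H k hk x hx
  have hr' := path_mono hK hr
  by_cases hki : k = i
  · subst hki
    rcases hq1 with rfl | rfl
    · exact ⟨q, hq, _, hr', .inl rfl⟩
    · refine ⟨q, hq, q', hr'.tail ⟨em, hm, fun j y hy _ => .inr ?_⟩, .inr (by simp [updWith])⟩
      simp [updWith, appList, hy]
  · exact ⟨q, hq, q1, hr', by simpa [updWith, hki] using hq1⟩

-- Superfluous letters, and monotonicity of reachability.

variable [DecidableEq Λ]

/-- `w'` is `w` with letters inserted, each of them in `h` or preceded by another occurrence. -/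
inductive Ext : Finset Λ → List Λ → List Λ → Prop
  | nil {h} : Ext h [] []
  | cons {h x w w'} : Ext (insert x h) w w' → Ext h (x :: w) (x :: w')
  | ins {h x w w'} : x ∈ h → Ext h w w' → Ext h w (x :: w')

theorem Ext.refl (h : Finset Λ) (w : List Λ) : Ext h w w := by
  induction w generalizing h with
  | nil => exact .nil
  | cons x w ih => exact .cons (ih _)

theorem Ext.mono {h h' : Finset Λ} {w w' : List Λ} (H : Ext h w w') (hh : h ⊆ h') :
    Ext h' w w' := by
  induction H generalizing h' with
  | nil => exact .nil
  | cons _ ih => exact .cons (ih (Finset.insert_subset_insert _ hh))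
  | ins hx _ ih => exact .ins (hh hx) (ih hh)

theorem Ext.known {h : Finset Λ} {w w' : List Λ} (H : Ext h w w') (y : Λ) :
    (y ∈ h ∨ y ∈ w) ↔ (y ∈ h ∨ y ∈ w') := by
  induction H with
  | nil => rfl
  | cons _ ih => simp only [Finset.mem_insert, List.mem_cons] at ih ⊢; tauto
  | @ins h x w w' hx _ ih =>
    simp only [List.mem_cons]
    constructor
    · intro h1; have := ih.1 h1; tauto
    · rintro (h1 | rfl | h1)
      · exact .inl h1
      · exact .inl hx
      · exact ih.2 (.inr h1)

theorem Ext.append {h : Finset Λ} {w w' v v' : List Λ} (H : Ext h w w') (H' : Ext ∅ v v') :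
    Ext h (w ++ v) (w' ++ v') := by
  induction H with
  | nil => exact H'.mono (Finset.empty_subset _)
  | cons _ ih => exact .cons ih
  | ins hx _ ih => exact .ins hx ih

/-- Needed for the letters that a flush leaves at the ends of the queues. -/
theorem Ext.append_known {h : Finset Λ} {w w' e : List Λ} (H : Ext h w w')
    (he : ∀ y ∈ e, y ∈ h ∨ y ∈ w) : Ext h w (w' ++ e) := by
  induction H with
  | nil =>
    induction e with
    | nil => exact .nil
    | cons y e ih =>
      exact .ins (by simpa using he y (by simp)) (ih fun z hz => he z (by simp [hz]))
  | cons _ ih =>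
    refine .cons (ih fun y hy => ?_)
    have := he y hy
    simp only [Finset.mem_insert, List.mem_cons] at this ⊢; tauto
  | ins hx _ ih => exact .ins hx (ih he)

theorem Ext.sublist {h : Finset Λ} {w w' : List Λ} (H : Ext h w w') : w.Sublist w' := by
  induction H with
  | nil => exact .slnil
  | cons _ ih => exact ih.cons_cons _
  | ins _ _ ih => exact ih.cons _

/-- In front of the first letter of the smaller word only history can justify an insertion. The
prefix `p` is what has to be flushed before `x` can be consumed. -/
theorem Ext.cons_split {h : Finset Λ} {x : Λ} {w w' : List Λ} (H : Ext h (x :: w) w') :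
    ∃ p r, w' = p ++ x :: r ∧ (∀ y ∈ p, y ∈ h) ∧ Ext (insert x h) w r := by
  generalize hv : x :: w = v at H
  induction H with
  | nil => cases hv
  | @cons h y u u' H' _ => cases hv; exact ⟨[], u', rfl, by simp, H'⟩
  | @ins h y u u' hy _ ih =>
    obtain ⟨p, r, rfl, h1, h2⟩ := ih hv
    refine ⟨y :: p, r, rfl, ?_, h2⟩
    intro z hz
    rcases List.mem_cons.1 hz with rfl | hz
    exacts [hy, h1 z hz]

/-- The new letter enters the history with the branch that has just begun. The earlier branches of
the component are complete, because it is idle. -/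
theorem Inv.pop {n : Net κ Λ} {h : ℕ → Finset Λ} {σ : ℕ → κ × List Λ} (H : n.Inv h σ) {i : ℕ}
    {x : Λ} {w : List Λ} {q' : κ} (hid : (σ i).1 = n.idle) (hw : (σ i).2 = x :: w)
    (hq' : q' ∈ n.inst i x) :
    n.Inv (Function.update h i (insert x (h i))) (upd σ i (q', w) none) := by
  have hK : ∀ j < n.size, ∀ y, Known h σ j y →
      Known (Function.update h i (insert x (h i))) (upd σ i (q', w) none) j y := by
    rintro j - y hy
    by_cases hji : j = i
    · subst hji
      simp only [Known, updWith, appList, emitTo, hw, List.mem_cons, Function.update_self,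
        Finset.mem_insert, if_true, Option.bind_none, Option.toList_none, List.append_nil] at hy ⊢
      tauto
    · simpa [Known, updWith, appList, emitTo, hji] using hy
  intro k hk y hy
  by_cases hki : k = i
  · subst hki
    simp only [Function.update_self, Finset.mem_insert] at hy
    rcases hy with rfl | hy
    · exact ⟨q', hq', q', .refl, .inr (by simp [updWith])⟩
    · obtain ⟨q, hq, q1, hr, hq1⟩ := H k hk y hy
      refine ⟨q, hq, q1, path_mono hK hr, .inl ?_⟩
      rcases hq1 with h1 | h1
      exacts [h1, h1.trans hid]
  · obtain ⟨q, hq, q1, hr, hq1⟩ := H k hk y (by simpa [hki] using hy)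
    exact ⟨q, hq, q1, path_mono hK hr,
      by simpa [updWith, hki] using hq1⟩

/-- The same control states, and queues extended by superfluous letters. -/
def Below (h : ℕ → Finset Λ) (σ σ' : ℕ → κ × List Λ) : Prop :=
  ∀ j < n.size, (σ' j).1 = (σ j).1 ∧ Ext (h j) (σ j).2 (σ' j).2

/-- `Inv` sees the queues only through the letters that are known, and an inserted letter was known
before (`Ext.known`). -/
theorem Below.inv_iff {n : Net κ Λ} {h : ℕ → Finset Λ} {σ σ' : ℕ → κ × List Λ}
    (H : n.Below h σ σ') : n.Inv h σ ↔ n.Inv h σ' := by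
  have hK : ∀ j < n.size, ∀ y, Known h σ j y ↔ Known h σ' j y := fun j hj y =>
    (H j hj).2.known y
  constructor
  · intro HI i hi x hx
    obtain ⟨q, hq, q', hr, h1⟩ := HI i hi x hx
    exact ⟨q, hq, q', path_mono (fun j hj y => (hK j hj y).1) hr, by rwa [(H i hi).1]⟩
  · intro HI i hi x hx
    obtain ⟨q, hq, q', hr, h1⟩ := HI i hi x hx
    exact ⟨q, hq, q', path_mono (fun j hj y => (hK j hj y).2) hr, by rwa [← (H i hi).1]⟩

/-- The larger configuration copies the run of the smaller one. Before a letter is consumed, the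
superfluous letters in front of it are flushed by repeating the branches that `Inv` provides; the
letters this leaves behind are known, so `Below` persists. -/
theorem Reach.mono {n : Net κ Λ} {σ : ℕ → κ × List Λ} (H : n.Reach σ) :
    ∀ (h : ℕ → Finset Λ) (σ' : ℕ → κ × List Λ), n.Inv h σ → n.Below h σ σ' → n.Reach σ' := by
  obtain ⟨τ, hr, hf⟩ := H
  induction hr using Relation.ReflTransGen.head_induction_on with
  | refl =>
    intro h σ' _ hb
    refine ⟨σ', .refl, fun i hi => ?_⟩
    rw [(hb i hi).1]
    exact ⟨(hf i hi).1, (hf i hi).2.trans (hb i hi).2.sublist⟩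
  | @head ς _ hs _ ih =>
    intro h σ' hI hb
    cases hs with
    | @tau i q' em hi hm =>
      have hm' : (q', em) ∈ n.tau i (σ' i).1 := by rwa [(hb i hi).1]
      obtain ⟨τ', h1, h2⟩ := ih h (upd σ' i (q', (σ' i).2) em) (hI.tau hm) (by
        intro j hj
        by_cases hji : j = i
        · subst hji
          simp only [updWith, appList, if_true, true_and]
          exact (hb j hj).2.append (.refl _ _)
        · simp only [updWith, appList, hji, if_false]
          exact ⟨(hb j hj).1, (hb j hj).2.append (.refl _ _)⟩)
      exact ⟨τ', .head (.tau hi hm') h1, h2⟩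
    | @pop i x w q' hi hid hw hq' =>
      have hb' := hb i hi
      rw [hw] at hb'
      obtain ⟨p, r, hpr, hp, hext⟩ := hb'.2.cons_split
      -- The letters allowed are those known in the smaller configuration, as `Ext.append_known`
      -- requires. The branches are complete because the component is idle.
      obtain ⟨σ1, hr1, hc1, he1⟩ := n.exists_flush (K := Known h ς) hi p (fun y hy => by
        obtain ⟨q, hq, q1, hq1, h1⟩ := hI i hi y (hp y hy)
        refine ⟨q, hq, ?_⟩
        rcases h1 with rfl | rfl
        · exact hq1
        · rwa [hid] at hq1) (x :: r) σ' (by rw [hb'.1, hid]) hpr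
      obtain ⟨e, heK, hew⟩ := he1 i hi
      simp only [if_true, List.cons_append] at hew
      have hid1 : (σ1 i).1 = n.idle := by rw [hc1, hb'.1, hid]
      obtain ⟨τ', h1, h2⟩ := ih (Function.update h i (insert x (h i)))
        (upd σ1 i (q', r ++ e) none) (hI.pop hid hw hq') (by
        intro j hj
        by_cases hji : j = i
        · subst hji
          simp only [updWith, appList, if_true, true_and, emitTo, Option.bind_none,
            Option.toList_none, List.append_nil, Function.update_self]
          refine hext.append_known fun y hy => ?_
          have := heK y hy
          simp only [Known, hw, List.mem_cons, Finset.mem_insert] at this ⊢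
          tauto
        · obtain ⟨e, h3, h4⟩ := he1 j hj
          simp only [updWith, appList, hji, if_false, emitTo, Option.bind_none,
            Option.toList_none, List.append_nil, ne_eq, not_false_eq_true,
            Function.update_of_ne] at h4 ⊢
          rw [h4, hc1]
          exact ⟨(hb j hj).1, (hb j hj).2.append_known h3⟩)
      exact ⟨τ', hr1.trans (.head (.pop hi hid1 hew hq') h1), h2⟩

-- A well-quasi-order on words.

/-- The word with a mark at every letter that is in `h` or has occurred before. -/
def mark : Finset Λ → List Λ → List (Λ × Bool)
  | _, [] => []
  | h, x :: w => (x, decide (x ∈ h)) :: mark (insert x h) w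

theorem mem_mark_false {h : Finset Λ} {w : List Λ} {x : Λ} :
    (x, false) ∈ mark h w ↔ x ∉ h ∧ x ∈ w := by
  induction w generalizing h with
  | nil => simp [mark]
  | cons y w ih =>
    simp only [mark, List.mem_cons, ih, Prod.mk.injEq, Finset.mem_insert]
    by_cases hxy : x = y
    · subst hxy; simp
    · simp [hxy]

theorem mem_of_mem_mark {h : Finset Λ} {w : List Λ} {x : Λ × Bool} (H : x ∈ mark h w) :
    x.1 ∈ w := by
  induction w generalizing h with
  | nil => simp [mark] at H
  | cons y w ih =>
    simp only [mark, List.mem_cons] at H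
    rcases H with rfl | H
    · simp
    · exact List.mem_cons_of_mem _ (ih H)

/-- The unmarked copy of a letter is unique, so an embedding of marked words cannot skip the first
occurrence of a new letter; whatever it skips is a repetition. -/
theorem ext_of_mark {h : Finset Λ} {w w' : List Λ} (H : (mark h w).Sublist (mark h w'))
    (hl : ∀ x ∈ w', x ∈ h ∨ x ∈ w) : Ext h w w' := by
  induction w' generalizing h w with
  | nil =>
    cases w with
    | nil => exact .nil
    | cons => simp [mark] at H
  | cons y w' ih =>
    rw [mark] at H
    generalize hu : mark h w = u at H
    cases H with
    | cons _ H =>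
      rw [← hu] at H
      by_cases hy : y ∈ h
      · rw [Finset.insert_eq_of_mem hy] at H
        exact .ins hy (ih H fun x hx => hl x (by simp [hx]))
      · have hyw : y ∈ w := (hl y (by simp)).resolve_left hy
        have := H.subset (mem_mark_false.2 ⟨hy, hyw⟩)
        simp [mem_mark_false] at this
    | @cons_cons u' _ _ H =>
      cases w with
      | nil => simp [mark] at hu
      | cons z v =>
        simp only [mark, List.cons.injEq, Prod.mk.injEq] at hu
        obtain ⟨⟨rfl, -⟩, rfl⟩ := hu
        refine .cons (ih H fun x hx => ?_)
        have := hl x (by simp [hx])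
        simp only [Finset.mem_insert, List.mem_cons] at this ⊢
        tauto

/-- A well-quasi-order on words that implies `Ext ∅`. -/
def WordLE (w w' : List Λ) : Prop := (mark ∅ w).Sublist (mark ∅ w') ∧ w.toFinset = w'.toFinset

instance : IsPreorder (List Λ) (WordLE (Λ := Λ)) where
  refl _ := ⟨.refl _, rfl⟩
  trans _ _ _ h h' := ⟨h.1.trans h'.1, h.2.trans h'.2⟩

theorem WordLE.ext {w w' : List Λ} (H : WordLE w w') : Ext ∅ w w' :=
  ext_of_mark H.1 fun x hx => .inr (by rw [← List.mem_toFinset, H.2]; simpa using hx)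

/-- Higman's lemma over the finite alphabet `A × Bool`, combined with the finitely many possible
sets of letters. -/
theorem wordLE_pwo (A : Finset Λ) :
    {w : List Λ | ∀ x ∈ w, x ∈ A}.PartiallyWellOrderedOn WordLE := by
  have h1 := Set.PartiallyWellOrderedOn.partiallyWellOrderedOn_sublistForall₂
    (Eq : Λ × Bool → Λ × Bool → Prop) (s := ((A ×ˢ Finset.univ : Finset (Λ × Bool)) : Set _))
    (Finset.finite_toSet _).partiallyWellOrderedOn
  have h2 : ((A.powerset : Finset (Finset Λ)) : Set (Finset Λ)).PartiallyWellOrderedOn Eq :=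
    (Finset.finite_toSet _).partiallyWellOrderedOn
  have : IsPreorder (List (Λ × Bool)) (List.SublistForall₂ Eq) :=
    { refl := List.SublistForall₂.is_refl.refl, trans := List.SublistForall₂.is_trans.trans }
  have h3 := h1.prod h2
  intro f
  obtain ⟨a, b, hab, h4, h5⟩ := h3.exists_lt (f := fun k => (mark ∅ (f k).1, (f k).1.toFinset))
    (fun k => by
      refine ⟨fun x hx => ?_, ?_⟩
      · simpa using (f k).2 _ (mem_of_mem_mark hx)
      · simp only [Finset.coe_powerset, Set.mem_preimage, Set.mem_powerset_iff]
        intro x hx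
        exact (f k).2 x (by simpa using hx))
  refine ⟨a, b, hab, ?_, h5⟩
  simpa [List.sublistForall₂_iff, List.forall₂_eq_eq_eq] using h4

end Net

-- Finiteness of images, and finite tables.

/-- Finitely many sets arise as images of a monotone map from a well-quasi-order to the upward
closed subsets of a well-quasi-order. -/
theorem Set.PartiallyWellOrderedOn.finite_image {α γ : Type*} {r : α → α → Prop} [IsPreorder α r]
    {s : Set α} (hs : s.PartiallyWellOrderedOn r) {ρ : γ → γ → Prop} {t : Set γ}
    (ht : t.PartiallyWellOrderedOn ρ) (F : α → Set γ) (hF : ∀ a ∈ s, F a ⊆ t)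
    (hmono : ∀ a ∈ s, ∀ b ∈ s, r a b → F a ⊆ F b)
    (hup : ∀ a ∈ s, ∀ c ∈ t, ∀ c' ∈ t, ρ c c' → c ∈ F a → c' ∈ F a) : (F '' s).Finite := by
  by_contra hinf
  have hemb := Set.Infinite.natEmbedding _ hinf
  choose w hw hFw using fun k => (hemb k).2
  obtain ⟨g, hg⟩ := hs.exists_monotone_subseq hw
  have hsub : ∀ m n, m ≤ n → F (w (g m)) ⊆ F (w (g n)) := fun m n hmn =>
    hmono _ (hw _) _ (hw _) (hg m n hmn)
  -- Along a monotone subsequence of words with different images the sets increase strictly.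
  -- Elements `c k` that are new at stage `k + 1` form a sequence without an increasing pair,
  -- because the sets are upward closed.
  have hne : ∀ k, ∃ c, c ∈ F (w (g (k + 1))) ∧ c ∉ F (w (g k)) := by
    intro k
    by_contra hcon
    push Not at hcon
    have heq : F (w (g (k + 1))) = F (w (g k)) :=
      Set.Subset.antisymm hcon (hsub k (k + 1) (by omega))
    rw [hFw, hFw] at heq
    have := g.injective (hemb.injective (Subtype.ext heq))
    omega
  choose c hc hc' using hne
  obtain ⟨m, n, hmn, hle⟩ := ht.exists_lt fun k => hF _ (hw _) (hc k)
  exact hc' n (hup _ (hw _) _ (hF _ (hw _) (hc m)) _ (hF _ (hw _) (hc n)) hle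
    (hsub (m + 1) n hmn (hc m)))

theorem Set.Finite.lists {α : Type*} {s : Set α} (hs : s.Finite) (N : ℕ) :
    {l : List α | l.length = N ∧ ∀ x ∈ l, x ∈ s}.Finite := by
  induction N with
  | zero =>
    refine (Set.finite_singleton ([] : List α)).subset ?_
    rintro l ⟨hl, -⟩
    simpa using hl
  | succ N ih =>
    refine ((hs.prod ih).image fun p => p.1 :: p.2).subset ?_
    rintro l ⟨hl, hm⟩
    cases l with
    | nil => simp at hl
    | cons x l => exact ⟨(x, l), ⟨hm x (by simp), by simpa using hl, fun y hy => hm y (by simp [hy])⟩, rfl⟩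

/-- Any function of an encodable argument in a finite set and a bounded number is given by a
table. -/
theorem exists_table {Λ β : Type*} [Encodable Λ] (A : Finset Λ) (M : ℕ) (F : Λ → ℕ → β) (d : β) :
    ∃ l : List β, ∀ x ∈ A, ∀ m < M, l.getD (Nat.pair (Encodable.encode x) m) d = F x m := by
  classical
  let s : Finset ℕ := (A ×ˢ Finset.range M).image fun p => Nat.pair (Encodable.encode p.1) p.2
  refine ⟨(List.range (s.sup id + 1)).map fun k =>
    ((Encodable.decode (α := Λ) k.unpair.1).map fun x => F x k.unpair.2).getD d, ?_⟩
  intro x hx m hm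
  have : Nat.pair (Encodable.encode x) m < s.sup id + 1 :=
    Nat.lt_succ_of_le (Finset.le_sup (f := id) (Finset.mem_image.2
      ⟨(x, m), Finset.mem_product.2 ⟨hx, Finset.mem_range.2 hm⟩, rfl⟩))
  rw [List.getD_eq_getElem?_getD, List.getElem?_map, List.getElem?_range this]
  simp

-- Certificates of non-reachability and their soundness.

namespace Net

variable {κ Λ : Type}

section

variable (n : Net κ Λ)

def toList {μ : Type} (s : ℕ → κ × μ) : List (κ × μ) := (List.range n.size).map s

def ofList {μ : Type} (d : μ) (l : List (κ × μ)) (j : ℕ) : κ × μ := l.getD j (n.idle, d)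

theorem ofList_toList {μ : Type} (d : μ) (s : ℕ → κ × μ) {j : ℕ} (hj : j < n.size) :
    n.ofList d (n.toList s) j = s j := by
  simp [ofList, toList, List.getD_eq_getElem?_getD, hj]

theorem toList_congr {μ : Type} {s s' : ℕ → κ × μ} (h : ∀ j < n.size, s j = s' j) :
    n.toList s = n.toList s' :=
  List.map_congr_left fun j hj => h j (List.mem_range.1 hj)

theorem toList_updWith {μ : Type} (d : μ) (app : μ → Option Λ → μ) (s : ℕ → κ × μ) (i : ℕ)
    (c : κ × μ) (em : Option (ℕ × Λ)) :
    n.toList (updWith app (n.ofList d (n.toList s)) i c em) = n.toList (updWith app s i c em) :=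
  n.toList_congr fun j hj => by simp only [updWith, n.ofList_toList d s hj]

end

variable [DecidableEq Λ]

/-- What remains of a word to be matched after the greedy matching of one letter. -/
def matchStep (t : List Λ) (x : Λ) : List Λ := if t.head? = some x then t.tail else t

/-- Greedy matching is optimal: an embedding can always be moved to use the first possible
occurrence of each letter. -/
theorem foldl_matchStep (w t : List Λ) : w.foldl matchStep t = [] ↔ t.Sublist w := by
  induction w generalizing t with
  | nil => simp
  | cons x w ih =>
    rw [List.foldl_cons, ih]
    cases t with
    | nil => simp [matchStep]
    | cons y t =>
      simp only [matchStep, List.head?_cons, Option.some.injEq, List.tail_cons]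
      split_ifs with h
      · subst h; simp
      · constructor
        · exact fun H => H.cons _
        · rintro (_ | _)
          · assumption
          · exact absurd rfl h

/-- Hence only finitely many remainders of the target words occur. -/
theorem foldl_matchStep_suffix (w t : List Λ) : w.foldl matchStep t <:+ t := by
  induction w generalizing t with
  | nil => simp
  | cons x w ih =>
    refine (ih _).trans ?_
    rw [matchStep]
    split_ifs
    exacts [List.tail_suffix t, List.suffix_rfl]

/-- A finite abstraction of the configurations: an alphabet, the number of classes of words, the
class of the empty word, the left and right actions of the letters on the classes, what remains of
the target words after matching a word of the class, and a set of abstract configurations. -/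
abbrev Cert (κ Λ : Type) : Type :=
  List Λ × ℕ × ℕ × List ℕ × List ℕ × List (List Λ) × List (List (κ × ℕ))

section

variable [Encodable Λ]

def act (tab : List ℕ) (x : Λ) (m : ℕ) : ℕ := tab.getD (Nat.pair (Encodable.encode x) m) 0

def appClass (tab : List ℕ) (m : ℕ) (o : Option Λ) : ℕ := o.elim m fun x => act tab x m

def rest (tab : List (List Λ)) (j m : ℕ) : List Λ := tab.getD (Nat.pair j m) []

variable (n : Net κ Λ)

/-- The class of a word is computed by right actions alone, but consuming a letter requires the
class of the tail. That the two actions commute and agree on the class `e` of the empty word is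
enough for `act L x` to send the class of `w` to that of `x :: w`. -/
def TablesOK (A : List Λ) (M e : ℕ) (L R : List ℕ) (S : List (List Λ)) : Prop :=
  e < M ∧ (∀ x ∈ A, ∀ m < M, act L x m < M ∧ act R x m < M) ∧ (∀ x ∈ A, act R x e = act L x e) ∧
  (∀ x ∈ A, ∀ y ∈ A, ∀ m < M, act R y (act L x m) = act L x (act R y m)) ∧
  (∀ j < n.size, rest S j e = n.target j ∧
    ∀ x ∈ A, ∀ m < M, rest S j (act R x m) = matchStep (rest S j m) x)

def TauOK (A : List Λ) (R : List ℕ) (I : List (List (κ × ℕ))) : Prop :=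
  ∀ s ∈ I, ∀ i < n.size, ∀ u ∈ n.tau i (n.ofList 0 s i).1,
    (∀ e ∈ u.2.toList, e.2 ∈ A) ∧ n.toList
      (updWith (appClass R) (n.ofList 0 s) i (u.1, (n.ofList 0 s i).2) u.2) ∈ I

/-- A class does not show the first letter of the queue, so every decomposition of the class into a
letter `x` and a class `m` is considered. -/
def PopOK (A : List Λ) (M : ℕ) (L R : List ℕ) (I : List (List (κ × ℕ))) : Prop :=
  ∀ s ∈ I, ∀ i < n.size, (n.ofList 0 s i).1 = n.idle → ∀ x ∈ A, ∀ m < M,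
    act L x m = (n.ofList 0 s i).2 → ∀ q ∈ n.inst i x,
      n.toList (updWith (appClass (Λ := Λ) R) (n.ofList 0 s) i (q, m) none) ∈ I

def GoalOK (S : List (List Λ)) (I : List (List (κ × ℕ))) : Prop :=
  ∀ s ∈ I, ∃ i < n.size, n.goal i (n.ofList 0 s i).1 = false ∨ rest S i (n.ofList 0 s i).2 ≠ []

def InitOK (σ : ℕ → κ × List Λ) (A : List Λ) (e : ℕ) (R : List ℕ) (I : List (List (κ × ℕ))) :
    Prop :=
  (∀ i < n.size, ∀ x ∈ (σ i).2, x ∈ A) ∧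
    n.toList (fun j => ((σ j).1, (σ j).2.foldl (fun m x => act R x m) e)) ∈ I

/-- The abstraction shows that the target is not reachable. -/
def CertOK (σ : ℕ → κ × List Λ) (c : Cert κ Λ) : Prop :=
  n.TablesOK c.1 c.2.1 c.2.2.1 c.2.2.2.1 c.2.2.2.2.1 c.2.2.2.2.2.1 ∧
  n.InitOK σ c.1 c.2.2.1 c.2.2.2.2.1 c.2.2.2.2.2.2 ∧
  n.TauOK c.1 c.2.2.2.2.1 c.2.2.2.2.2.2 ∧
  n.PopOK c.1 c.2.1 c.2.2.2.1 c.2.2.2.2.1 c.2.2.2.2.2.2 ∧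
  n.GoalOK c.2.2.2.2.2.1 c.2.2.2.2.2.2

/-- By induction on a run, the abstraction of every configuration reached is in `I`, and `GoalOK`
says that no member of `I` looks final. -/
theorem CertOK.not_reach {n : Net κ Λ} {σ : ℕ → κ × List Λ} {c : Cert κ Λ} (h : n.CertOK σ c) :
    ¬ n.Reach σ := by
  obtain ⟨A, M, e, L, R, S, I⟩ := c
  obtain ⟨⟨he, hM, hLe, hLR, hS⟩, ⟨hA, hI⟩, ht, hp, hg⟩ := h
  dsimp only at *
  let cl : List Λ → ℕ := fun w => w.foldl (fun m x => act R x m) e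
  have hcl : ∀ w : List Λ, (∀ x ∈ w, x ∈ A) → cl w < M := by
    intro w
    induction w using List.reverseRecOn with
    | nil => exact fun _ => he
    | append_singleton w x ih =>
      intro hw
      simp only [cl, List.foldl_append, List.foldl_cons, List.foldl_nil]
      exact (hM x (hw x (by simp)) _ (ih fun y hy => hw y (by simp [hy]))).2
  -- Words are read from the right end, where they grow; commutation moves the left action past the
  -- last letter.
  have hcons : ∀ x ∈ A, ∀ w : List Λ, (∀ y ∈ w, y ∈ A) → cl (x :: w) = act L x (cl w) := by
    intro x hx w
    induction w using List.reverseRecOn with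
    | nil => exact fun _ => hLe x hx
    | append_singleton w y ih =>
      intro hw
      have hw' : ∀ z ∈ w, z ∈ A := fun z hz => hw z (by simp [hz])
      have := ih hw'
      rw [← List.cons_append]
      simp only [cl, List.foldl_append, List.foldl_cons, List.foldl_nil] at this ⊢
      rw [this, hLR x hx y (hw y (by simp)) _ (hcl w hw')]
  have hrest : ∀ j < n.size, ∀ w : List Λ, (∀ x ∈ w, x ∈ A) →
      rest S j (cl w) = w.foldl matchStep (n.target j) := by
    intro j hj w
    induction w using List.reverseRecOn with
    | nil => exact fun _ => (hS j hj).1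
    | append_singleton w x ih =>
      intro hw
      have hw' : ∀ z ∈ w, z ∈ A := fun z hz => hw z (by simp [hz])
      have h1 := ih hw'
      have h2 := (hS j hj).2 x (hw x (by simp)) _ (hcl w hw')
      simp only [cl, List.foldl_append, List.foldl_cons, List.foldl_nil] at h1 h2 ⊢
      rw [h2, h1]
  rintro ⟨τ, hr, hf⟩
  suffices H : (∀ i < n.size, ∀ x ∈ (τ i).2, x ∈ A) ∧
      n.toList (fun j => ((τ j).1, cl (τ j).2)) ∈ I by
    obtain ⟨i, hi, h1⟩ := hg _ H.2
    rw [n.ofList_toList 0 _ hi] at h1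
    have h2 := hf i hi
    rcases h1 with h1 | h1
    · simp [h2.1] at h1
    · exact h1 ((hrest i hi _ (H.1 i hi)).trans ((foldl_matchStep _ _).2 h2.2))
  clear hf
  induction hr with
  | refl => exact ⟨hA, hI⟩
  | @tail ς _ _ hs ih =>
    obtain ⟨ihA, ihI⟩ := ih
    cases hs with
    | @tau i q' em hi hm =>
      have hm' := hm
      have h1 := ht _ ihI i hi
      rw [n.ofList_toList 0 _ hi] at h1
      obtain ⟨hemA, hmem⟩ := h1 _ hm
      rw [toList_updWith] at hmem
      refine ⟨fun j hj x hx => ?_, ?_⟩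
      · have hx' : x ∈ (ς j).2 ∨ emitTo em j = some x := by
          by_cases hji : j = i
          · subst hji; simpa [updWith, appList] using hx
          · simpa [updWith, appList, hji] using hx
        rcases hx' with hx' | hx'
        · exact ihA j hj x hx'
        · simp only [emitTo, Option.bind_eq_some_iff, Option.ite_none_right_eq_some,
            Option.some.injEq] at hx'
          obtain ⟨u, hu, -, rfl⟩ := hx'
          exact hemA u (by simp [hu])
      · convert hmem using 1
        refine n.toList_congr fun j hj => ?_
        by_cases hji : j = i
        · subst hji
          cases h2 : emitTo em j <;> simp [updWith, appList, appClass, h2, cl]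
        · cases h2 : emitTo em j <;> simp [updWith, appList, appClass, hji, h2, cl]
    | @pop i x w q' hi hid hw hq' =>
      have h1 := hp _ ihI i hi
      rw [n.ofList_toList 0 _ hi] at h1
      have hxw := ihA i hi
      rw [hw] at hxw
      have hwA : ∀ y ∈ w, y ∈ A := fun y hy => hxw y (by simp [hy])
      have hmem := h1 hid x (hxw x (by simp)) (cl w) (hcl w hwA)
        (by rw [hw, hcons x (hxw x (by simp)) w hwA]) q' hq'
      rw [toList_updWith] at hmem
      refine ⟨fun j hj y hy => ?_, ?_⟩
      · by_cases hji : j = i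
        · subst hji
          simp only [updWith, if_true, emitTo, Option.bind_none, appList, Option.toList_none,
            List.append_nil] at hy
          exact hwA y hy
        · exact ihA j hj y (by simpa [updWith, emitTo, appList, hji] using hy)
      · convert hmem using 1
        refine n.toList_congr fun j hj => ?_
        by_cases hji : j = i
        · subst hji; simp [updWith, emitTo, appList, appClass]
        · simp [updWith, emitTo, appList, appClass, hji]

end

end Net

-- Existence of certificates.

namespace Net

variable {κ Λ : Type} (n : Net κ Λ)

/-- Configurations with the sets of letters consumed by the components. -/
abbrev Ann (κ Λ : Type) : Type := ℕ → κ × Finset Λ × List Λ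

def Ann.cfg (a : Ann κ Λ) (j : ℕ) : κ × List Λ := ((a j).1, (a j).2.2)

def Ann.hist (a : Ann κ Λ) (j : ℕ) : Finset Λ := (a j).2.1

/-- The configuration violates the invariant or reaches the target. -/
def Hits (a : Ann κ Λ) : Prop := n.Inv a.hist a.cfg → n.Reach a.cfg

variable {n}

theorem Inv.congr_hist {h h' : ℕ → Finset Λ} {σ : ℕ → κ × List Λ} (hh : ∀ j < n.size, h j = h' j)
    (H : n.Inv h σ) : n.Inv h' σ := by
  intro i hi x hx
  rw [← hh i hi] at hx
  obtain ⟨q, hq, q', hr, h1⟩ := H i hi x hx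
  exact ⟨q, hq, q', path_mono (fun j hj y hy => by rwa [Known, ← hh j hj]) hr, h1⟩

def words (A : Finset Λ) : Set (List Λ) := {w | ∀ x ∈ w, x ∈ A}

theorem append_mem_words {A : Finset Λ} {u v : List Λ} (hu : u ∈ words A) (hv : v ∈ words A) :
    u ++ v ∈ words A := by
  intro x hx
  rcases List.mem_append.1 hx with h | h
  exacts [hu x h, hv x h]

variable (n) in
def Suffixes : Set (List Λ) := {s | ∃ j < n.size, s <:+ n.target j}

theorem suffixes_finite : (n.Suffixes).Finite := by
  refine ((Set.finite_lt_nat n.size).biUnion fun j _ =>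
    (n.target j).tails.finite_toSet).subset ?_
  rintro s ⟨j, hj, hs⟩
  exact Set.mem_biUnion (x := j) hj (by simpa using hs)

variable [DecidableEq Λ]

/-- The invariant holds in both configurations or in neither. Counting its violation as a hit
therefore makes the hits upward closed among all annotated configurations. -/
theorem Hits.mono {a b : Ann κ Λ} (H : n.Hits a) (hab : ∀ j < n.size, (a j).1 = (b j).1 ∧
    (a j).2.1 = (b j).2.1 ∧ Ext (a j).2.1 (a j).2.2 (b j).2.2) : n.Hits b := by
  intro hI
  have hb : n.Below a.hist a.cfg b.cfg := fun j hj => ⟨(hab j hj).1.symm, (hab j hj).2.2⟩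
  have hI' : n.Inv a.hist a.cfg :=
    hb.inv_iff.2 (hI.congr_hist fun j hj => (hab j hj).2.1.symm)
  exact (H hI').mono _ _ hI' hb

def ValidCell (Q : Finset κ) (A : Finset Λ) : Set (κ × Finset Λ × List Λ) :=
  (Q : Set κ) ×ˢ (((A.powerset : Finset (Finset Λ)) : Set (Finset Λ)) ×ˢ words A)

def CellLE (c c' : κ × Finset Λ × List Λ) : Prop :=
  c.1 = c'.1 ∧ c.2.1 = c'.2.1 ∧ WordLE c.2.2 c'.2.2

instance : IsPreorder (κ × Finset Λ × List Λ) CellLE where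
  refl _ := ⟨rfl, rfl, refl_of WordLE _⟩
  trans _ _ _ h h' := ⟨h.1.trans h'.1, h.2.1.trans h'.2.1, _root_.trans h.2.2 h'.2.2⟩

theorem validCell_pwo (Q : Finset κ) (A : Finset Λ) :
    (ValidCell Q A).PartiallyWellOrderedOn CellLE := by
  have h1 : (Q : Set κ).PartiallyWellOrderedOn Eq := (Finset.finite_toSet _).partiallyWellOrderedOn
  have h2 : ((A.powerset : Finset (Finset Λ)) : Set (Finset Λ)).PartiallyWellOrderedOn Eq :=
    (Finset.finite_toSet _).partiallyWellOrderedOn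
  exact h1.prod (h2.prod (wordLE_pwo A))

/-- A component and a context for its queue. -/
abbrev Ctx (κ Λ : Type) : Type := List Λ × List Λ × ℕ × Ann κ Λ

def Ctx.plug (c : Ctx κ Λ) (w : List Λ) : Ann κ Λ :=
  Function.update c.2.2.2 c.2.2.1
    ((c.2.2.2 c.2.2.1).1, (c.2.2.2 c.2.2.1).2.1, c.1 ++ w ++ c.2.1)

variable (n) in
def ValidAnn (Q : Finset κ) (A : Finset Λ) : Set (Ann κ Λ) :=
  {a | ∀ j < n.size, a j ∈ ValidCell Q A}

variable (n) in
def ValidCtx (Q : Finset κ) (A : Finset Λ) : Set (Ctx κ Λ) :=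
  words A ×ˢ (words A ×ˢ ({i | i < n.size} ×ˢ n.ValidAnn Q A))

variable (n) in
def CtxLE (c c' : Ctx κ Λ) : Prop :=
  WordLE c.1 c'.1 ∧ WordLE c.2.1 c'.2.1 ∧ c.2.2.1 = c'.2.2.1 ∧
    ∀ j < n.size, CellLE (c.2.2.2 j) (c'.2.2.2 j)

/-- A finite product of well-quasi-orders; components beyond `size` are unconstrained and ignored by
the order. -/
theorem validCtx_pwo (Q : Finset κ) (A : Finset Λ) :
    (n.ValidCtx Q A).PartiallyWellOrderedOn n.CtxLE := by
  have h1 : (n.ValidAnn Q A).PartiallyWellOrderedOn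
      fun a b => ∀ j < n.size, CellLE (a j) (b j) := by
    have h := Set.PartiallyWellOrderedOn.pi (ι := Fin n.size) (r := fun _ => CellLE)
      fun _ => validCell_pwo Q A
    rw [Set.partiallyWellOrderedOn_iff_exists_lt]
    intro f hf
    obtain ⟨a, b, hab, h2⟩ := h.exists_lt (f := fun k j => f k j) fun k j _ => hf k j j.2
    exact ⟨a, b, hab, fun j hj => h2 ⟨j, hj⟩⟩
  have h2 : {i | i < n.size}.PartiallyWellOrderedOn Eq :=
    (Set.finite_lt_nat _).partiallyWellOrderedOn
  exact (wordLE_pwo A).prod ((wordLE_pwo A).prod (h2.prod h1))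

variable (n) in
/-- The contexts in which a word leads to the target. -/
def hitCtx (Q : Finset κ) (A : Finset Λ) (w : List Λ) : Set (Ctx κ Λ) :=
  {c | c ∈ n.ValidCtx Q A ∧ n.Hits (c.plug w)}

/-- Both hypotheses of `finite_image`, monotonicity in the word and upward closure in the context,
are instances of `Hits.mono`. -/
theorem hitCtx_finite (Q : Finset κ) (A : Finset Λ) : (n.hitCtx Q A '' words A).Finite := by
  refine (wordLE_pwo A).finite_image (validCtx_pwo (n := n) Q A) _ (fun _ _ _ h => h.1) ?_ ?_
  · rintro w - w' - hw c ⟨hc, hU⟩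
    refine ⟨hc, hU.mono fun j hj => ?_⟩
    by_cases hji : j = c.2.2.1
    · subst hji
      simp only [Ctx.plug, Function.update_self, true_and]
      exact ((Ext.refl _ _).append hw.ext).append (.refl _ _)
    · simp only [Ctx.plug, ne_eq, hji, not_false_eq_true, Function.update_of_ne, true_and]
      exact .refl _ _
  · rintro w - c - c' hc' ⟨h1, h2, h3, h4⟩ ⟨hc, hU⟩
    refine ⟨hc', hU.mono fun j hj => ?_⟩
    obtain ⟨h5, h6, h7⟩ := h4 j hj
    by_cases hji : j = c.2.2.1
    · subst hji
      simp only [Ctx.plug, ← h3, Function.update_self]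
      exact ⟨h5, h6, ((h1.ext.mono (Finset.empty_subset _)).append (.refl _ _)).append h2.ext⟩
    · have hji' : j ≠ c'.2.2.1 := h3 ▸ hji
      simp only [Ctx.plug, ne_eq, hji, hji', not_false_eq_true, Function.update_of_ne]
      exact ⟨h5, h6, h7.ext.mono (Finset.empty_subset _)⟩

-- The words `u` and `v` can be moved into the context.
omit [DecidableEq Λ] in
theorem hitCtx_congr {Q : Finset κ} {A : Finset Λ} {w w' u v : List Λ} (hu : u ∈ words A)
    (hv : v ∈ words A) (h : n.hitCtx Q A w = n.hitCtx Q A w') :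
    n.hitCtx Q A (u ++ w ++ v) = n.hitCtx Q A (u ++ w' ++ v) := by
  have key : ∀ w c, c ∈ n.hitCtx Q A (u ++ w ++ v) ↔ c ∈ n.ValidCtx Q A ∧
      (c.1 ++ u, v ++ c.2.1, c.2.2) ∈ n.hitCtx Q A w := by
    intro w c
    simp only [hitCtx, Set.mem_ofPred_eq, Ctx.plug, List.append_assoc]
    refine and_congr_right fun hc => (and_iff_right ?_).symm
    exact ⟨append_mem_words hc.1 hu, append_mem_words hv hc.2.1, hc.2.2⟩
  ext c
  rw [key, key, h]

-- The effect of a word on all suffixes of target words is recorded, not only on the targets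
-- themselves: this is what composes under concatenation and makes `wordKey` a congruence.
variable (n) in
def matchAct (w : List Λ) (s : n.Suffixes) : n.Suffixes :=
  ⟨w.foldl matchStep s, s.2.imp fun _ h => ⟨h.1, (foldl_matchStep_suffix w s).trans h.2⟩⟩

theorem matchAct_append (u v : List Λ) (s : n.Suffixes) :
    n.matchAct (u ++ v) s = n.matchAct v (n.matchAct u s) :=
  Subtype.ext (by simp [matchAct])

variable (n) in
def wordKey (Q : Finset κ) (A : Finset Λ) (w : List Λ) :
    Set (Ctx κ Λ) × (n.Suffixes → n.Suffixes) := (n.hitCtx Q A w, n.matchAct w)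

theorem wordKey_congr {Q : Finset κ} {A : Finset Λ} {w w' u v : List Λ} (hu : u ∈ words A)
    (hv : v ∈ words A) (h : n.wordKey Q A w = n.wordKey Q A w') :
    n.wordKey Q A (u ++ w ++ v) = n.wordKey Q A (u ++ w' ++ v) := by
  obtain ⟨h1, h2⟩ := Prod.mk.inj h
  refine Prod.ext (hitCtx_congr hu hv h1) (funext fun s => ?_)
  simp only [wordKey, matchAct_append, h2]

variable (n) in
theorem exists_classes (Q : Finset κ) (A : Finset Λ) : ∃ (M : ℕ) (α : List Λ → ℕ),
    (∀ w ∈ words A, α w < M) ∧ (∀ m < M, ∃ w ∈ words A, α w = m) ∧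
    ∀ w ∈ words A, ∀ w' ∈ words A, α w = α w' ↔ n.wordKey Q A w = n.wordKey Q A w' := by
  classical
  have : Finite n.Suffixes := suffixes_finite
  have hfin : (n.wordKey Q A '' words A).Finite := by
    refine ((hitCtx_finite (n := n) Q A).prod (Set.toFinite Set.univ)).subset ?_
    rintro _ ⟨w, hw, rfl⟩
    exact ⟨⟨w, hw, rfl⟩, trivial⟩
  have : Finite ↥(n.wordKey Q A '' words A) := hfin
  let e := Finite.equivFin ↥(n.wordKey Q A '' words A)
  refine ⟨Nat.card ↥(n.wordKey Q A '' words A),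
    fun w => if h : w ∈ words A then (e ⟨n.wordKey Q A w, Set.mem_image_of_mem _ h⟩).1 else 0, ?_, ?_, ?_⟩
  · intro w hw
    simp only [dif_pos hw]
    exact Fin.is_lt _
  · intro m hm
    obtain ⟨⟨k, w, hw, rfl⟩, hk⟩ := e.surjective ⟨m, hm⟩
    exact ⟨w, hw, by simp only [dif_pos hw, hk]⟩
  · intro w hw w' hw'
    simp only [dif_pos hw, dif_pos hw']
    rw [← Fin.ext_iff, e.injective.eq_iff, Subtype.ext_iff]

/-- A net with finitely many control states and letters has a certificate whenever the target is
not reachable. -/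
theorem exists_certOK [Encodable Λ] {σ : ℕ → κ × List Λ} (Q : Finset κ) (A : Finset Λ)
    (hσ : ∀ j < n.size, (σ j).1 ∈ Q ∧ ∀ x ∈ (σ j).2, x ∈ A)
    (htau : ∀ i < n.size, ∀ q ∈ Q, ∀ u ∈ n.tau i q, u.1 ∈ Q ∧ ∀ e ∈ u.2.toList, e.2 ∈ A)
    (hinst : ∀ i < n.size, ∀ x ∈ A, ∀ q ∈ n.inst i x, q ∈ Q) (h : ¬ n.Reach σ) :
    ∃ c : Cert κ Λ, n.CertOK σ c := by
  classical
  obtain ⟨M, α, hM, hsurj, hα⟩ := n.exists_classes Q A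
  have hcongr : ∀ {u v w w'}, u ∈ words A → v ∈ words A → w ∈ words A → w' ∈ words A →
      α w = α w' → α (u ++ w ++ v) = α (u ++ w' ++ v) := fun hu hv hw hw' heq =>
    (hα _ (append_mem_words (append_mem_words hu hw) hv) _
      (append_mem_words (append_mem_words hu hw') hv)).2
      (wordKey_congr hu hv ((hα _ hw _ hw').1 heq))
  have hnil : [] ∈ words A := by simp [words]
  have hsing : ∀ x ∈ A, [x] ∈ words A := fun x hx => by simpa [words] using hx
  -- Each class gets a representative. The tables below are computed on representatives, and the
  -- congruence makes them correct for all words.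
  have htable : ∀ {β : Type} (F : List Λ → β) (d : β), ∃ f : ℕ → β, ∀ m < M, ∃ w ∈ words A,
      α w = m ∧ f m = F w := fun F d => by
    choose! g hg1 hg2 using hsurj
    exact ⟨fun m => F (g m), fun m hm => ⟨g m, hg1 m hm, hg2 m hm, rfl⟩⟩
  obtain ⟨L, hL⟩ : ∃ L : List ℕ, ∀ x ∈ A, ∀ w ∈ words A, act L x (α w) = α (x :: w) := by
    choose f hf using fun x : Λ => htable (fun w => α (x :: w)) 0
    obtain ⟨L, hL⟩ := exists_table A M f 0
    refine ⟨L, fun x hx w hw => ?_⟩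
    obtain ⟨w', hw', h1, h2⟩ := hf x _ (hM w hw)
    rw [act, hL x hx _ (hM w hw), h2]
    simpa using hcongr (hsing x hx) hnil hw' hw h1
  obtain ⟨R, hR⟩ : ∃ R : List ℕ, ∀ x ∈ A, ∀ w ∈ words A, act R x (α w) = α (w ++ [x]) := by
    choose f hf using fun x : Λ => htable (fun w => α (w ++ [x])) 0
    obtain ⟨R, hR⟩ := exists_table A M f 0
    refine ⟨R, fun x hx w hw => ?_⟩
    obtain ⟨w', hw', h1, h2⟩ := hf x _ (hM w hw)
    rw [act, hR x hx _ (hM w hw), h2]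
    simpa using hcongr hnil (hsing x hx) hw' hw h1
  obtain ⟨S, hS⟩ : ∃ S : List (List Λ), ∀ j < n.size, ∀ w ∈ words A,
      rest S j (α w) = w.foldl matchStep (n.target j) := by
    choose f hf using fun j : ℕ => htable (fun w => w.foldl matchStep (n.target j)) []
    obtain ⟨S, hS⟩ := exists_table (Finset.range n.size) M f []
    refine ⟨S, fun j hj w hw => ?_⟩
    obtain ⟨w', hw', h1, h2⟩ := hf j _ (hM w hw)
    have h3 := hS j (Finset.mem_range.2 hj) _ (hM w hw)
    rw [Encodable.encode_nat] at h3
    rw [rest, h3, h2]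
    have h4 := congrArg Prod.snd ((hα _ hw' _ hw).1 h1)
    exact congrArg Subtype.val (congrFun h4 ⟨n.target j, j, hj, List.suffix_rfl⟩)
  have hfold : ∀ w ∈ words A, w.foldl (fun m x => act R x m) (α []) = α w := by
    intro w
    induction w using List.reverseRecOn with
    | nil => exact fun _ => rfl
    | append_singleton w x ih =>
      intro hw
      have hw' : w ∈ words A := fun y hy => hw y (by simp [hy])
      rw [List.foldl_append, ih hw', List.foldl_cons, List.foldl_nil, hR x (hw x (by simp)) w hw']
  let abs : Ann κ Λ → ℕ → κ × ℕ := fun a j => ((a j).1, α (a j).2.2)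
  have hQ : ∀ {a}, a ∈ n.ValidAnn Q A → ∀ j < n.size, (a j).1 ∈ Q := fun ha j hj => (ha j hj).1
  have hW : ∀ {a}, a ∈ n.ValidAnn Q A → ∀ j < n.size, (a j).2.2 ∈ words A :=
    fun ha j hj => (ha j hj).2.2
  -- The abstract configurations are the images of the annotated configurations that satisfy the
  -- invariant and do not reach the target.
  have hfin : {l | ∃ a ∈ n.ValidAnn Q A, ¬ n.Hits a ∧ l = n.toList (abs a)}.Finite := by
    refine ((Q.finite_toSet.prod (Set.finite_lt_nat M)).lists n.size).subset ?_
    rintro _ ⟨a, ha, -, rfl⟩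
    refine ⟨by simp [toList], fun x hx => ?_⟩
    obtain ⟨j, hj, rfl⟩ := List.mem_map.1 hx
    exact ⟨hQ ha j (List.mem_range.1 hj), hM _ (hW ha j (List.mem_range.1 hj))⟩
  let I := hfin.toFinset.toList
  have hI : ∀ l, l ∈ I ↔ ∃ a ∈ n.ValidAnn Q A, ¬ n.Hits a ∧ l = n.toList (abs a) := by
    simp [I]
  refine ⟨(A.toList, M, α [], L, R, S, I), ⟨?_, ?_, ?_, ?_, ?_⟩, ⟨?_, ?_⟩, ?_, ?_, ?_⟩
  · exact hM _ hnil
  · intro x hx m hm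
    obtain ⟨w, hw, rfl⟩ := hsurj m hm
    have hx := Finset.mem_toList.1 hx
    rw [hL x hx w hw, hR x hx w hw]
    exact ⟨hM _ (append_mem_words (hsing x hx) hw), hM _ (append_mem_words hw (hsing x hx))⟩
  · intro x hx
    have hx := Finset.mem_toList.1 hx
    rw [hL x hx _ hnil, hR x hx _ hnil, List.nil_append]
  · intro x hx y hy m hm
    obtain ⟨w, hw, rfl⟩ := hsurj m hm
    have hx := Finset.mem_toList.1 hx
    have hy := Finset.mem_toList.1 hy
    rw [hL x hx w hw, hR y hy w hw, hR y hy (x :: w) (append_mem_words (hsing x hx) hw),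
      hL x hx _ (append_mem_words hw (hsing y hy)), List.cons_append]
  · intro j hj
    refine ⟨hS j hj _ hnil, fun x hx m hm => ?_⟩
    obtain ⟨w, hw, rfl⟩ := hsurj m hm
    have hx := Finset.mem_toList.1 hx
    rw [hR x hx w hw, hS j hj w hw, hS j hj _ (append_mem_words hw (hsing x hx)),
      List.foldl_append, List.foldl_cons, List.foldl_nil]
  · exact fun i hi x hx => Finset.mem_toList.2 ((hσ i hi).2 x hx)
  -- Nothing has been consumed at the start, so the invariant is vacuous.
  · refine (hI _).2 ⟨fun j => ((σ j).1, ∅, (σ j).2), ?_, ?_, ?_⟩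
    · exact fun j hj => ⟨(hσ j hj).1, by simp, (hσ j hj).2⟩
    · exact fun H => h (H fun i _ x hx => absurd hx (by simp [Ann.hist]))
    · exact n.toList_congr fun j hj => by rw [hfold _ (hσ j hj).2]
  · intro s hs i hi u hu
    obtain ⟨a, ha, hU, rfl⟩ := (hI s).1 hs
    rw [n.ofList_toList 0 _ hi] at hu ⊢
    rw [toList_updWith]
    have hu' := htau i hi _ (hQ ha i hi) u hu
    refine ⟨fun e he => Finset.mem_toList.2 (hu'.2 e he), (hI _).2 ?_⟩
    have hem : ∀ j, (emitTo u.2 j).toList ∈ words A := by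
      intro j x hx
      simp only [emitTo, Option.mem_toList, Option.bind_eq_some_iff,
        Option.ite_none_right_eq_some, Option.some.injEq] at hx
      obtain ⟨e, he, -, rfl⟩ := hx
      exact hu'.2 e (by simp [he])
    have hstep : n.Step a.cfg (upd a.cfg i (u.1, (a i).2.2) u.2) := .tau hi hu
    refine ⟨fun j => ((upd a.cfg i (u.1, (a i).2.2) u.2 j).1, (a j).2.1,
      (upd a.cfg i (u.1, (a i).2.2) u.2 j).2), fun j hj => ?_, fun H => hU fun hInv => ?_, ?_⟩
    · by_cases hji : j = i
      · subst hji
        refine ⟨by simpa [updWith] using hu'.1, (ha j hj).2.1, ?_⟩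
        simpa [updWith, appList] using append_mem_words (hW ha j hj) (hem j)
      · refine ⟨by simpa [updWith, hji, Ann.cfg] using hQ ha j hj, (ha j hj).2.1, ?_⟩
        simpa [updWith, hji, appList, Ann.cfg] using append_mem_words (hW ha j hj) (hem j)
    · obtain ⟨τ, h1, h2⟩ := H (hInv.tau hu)
      exact ⟨τ, .head hstep h1, h2⟩
    · refine n.toList_congr fun j hj => ?_
      have hx : ∀ x, emitTo u.2 j = some x → act R x (α (a j).2.2) = α ((a j).2.2 ++ [x]) :=
        fun x hx => hR x (hem j x (by simp [hx])) _ (hW ha j hj)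
      by_cases hji : j = i
      · subst hji
        cases h2 : emitTo u.2 j <;> simp [updWith, abs, appList, appClass, h2, hx]
      · cases h2 : emitTo u.2 j <;>
          simp [updWith, abs, appList, appClass, hji, h2, hx, Ann.cfg]
  · intro s hs i hi hid x hx m hm hLm q hq
    obtain ⟨a, ha, hU, rfl⟩ := (hI s).1 hs
    rw [n.ofList_toList 0 _ hi] at hid hLm
    rw [toList_updWith]
    have hx := Finset.mem_toList.1 hx
    obtain ⟨w, hw, rfl⟩ := hsurj m hm
    rw [hL x hx w hw] at hLm
    have hxw : x :: w ∈ words A := append_mem_words (hsing x hx) hw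
    have hctx := congrArg Prod.fst ((hα _ hxw _ (hW ha i hi)).1 hLm)
    have hvc : (([], [], i, a) : Ctx κ Λ) ∈ n.ValidCtx Q A := ⟨hnil, hnil, hi, ha⟩
    have hplug : Ctx.plug (([], [], i, a) : Ctx κ Λ) (a i).2.2 = a := by
      simp [Ctx.plug]
    -- The queue of `a` need not begin with `x`; it is only in the same class as `x :: w`. Replacing
    -- it by `x :: w` does not turn `a` into a hit, since words of one class hit in the same
    -- contexts. In `b` the letter can be consumed.
    let b : Ann κ Λ := Ctx.plug ([], [], i, a) (x :: w)
    have hUb : ¬ n.Hits b := fun H => hU (by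
      have : (([], [], i, a) : Ctx κ Λ) ∈ n.hitCtx Q A (a i).2.2 := by
        have h1 : (([], [], i, a) : Ctx κ Λ) ∈ n.hitCtx Q A (x :: w) := ⟨hvc, H⟩
        exact (congrArg (fun s : Set (Ctx κ Λ) => ([], [], i, a) ∈ s) hctx).mp h1
      simpa [hplug] using this.2)
    have hbi : b i = ((a i).1, (a i).2.1, x :: w) := by simp [b, Ctx.plug]
    have hbj : ∀ j ≠ i, b j = a j := fun j hj => by simp [b, Ctx.plug, hj]
    have hidb : (b.cfg i).1 = n.idle := by simpa [Ann.cfg, hbi] using hid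
    have hwb : (b.cfg i).2 = x :: w := by simp [Ann.cfg, hbi]
    have hstep : n.Step b.cfg (upd b.cfg i (q, w) none) := .pop hi hidb hwb hq
    refine (hI _).2 ⟨fun j => ((upd b.cfg i (q, w) none j).1,
      Function.update b.hist i (insert x (b.hist i)) j, (upd b.cfg i (q, w) none j).2),
      fun j hj => ?_, fun H => hUb fun hInv => ?_, ?_⟩
    · by_cases hji : j = i
      · subst hji
        refine ⟨by simpa [updWith] using hinst j hj x hx q hq, ?_, ?_⟩
        · have := (ha j hj).2.1
          simp only [Finset.coe_powerset, Set.mem_preimage, Set.mem_powerset_iff,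
            Finset.coe_subset, Function.update_self, Ann.hist, hbi] at this ⊢
          exact Finset.insert_subset hx this
        · simpa [updWith, appList, emitTo] using hw
      · have := ha j hj
        rw [← hbj j hji] at this
        exact ⟨by simpa [updWith, hji, Ann.cfg] using this.1, by simpa [hji, Ann.hist] using this.2.1,
          by simpa [updWith, hji, appList, emitTo, Ann.cfg] using this.2.2⟩
    · obtain ⟨τ, h1, h2⟩ := H (hInv.pop hidb hwb hq)
      exact ⟨τ, .head hstep h1, h2⟩
    · refine n.toList_congr fun j hj => ?_
      by_cases hji : j = i
      · subst hji; simp [updWith, abs, appList, appClass, emitTo]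
      · simp [updWith, abs, appList, appClass, emitTo, hji, Ann.cfg, hbj j hji]
  · intro s hs
    obtain ⟨a, ha, hU, rfl⟩ := (hI s).1 hs
    by_contra hcon
    push Not at hcon
    refine hU fun _ => ⟨a.cfg, .refl, fun i hi => ?_⟩
    obtain ⟨h1, h2⟩ := hcon i hi
    rw [n.ofList_toList 0 _ hi] at h1 h2
    refine ⟨Bool.of_not_eq_false h1, (foldl_matchStep _ _).1 ?_⟩
    exact (hS i hi _ (hW ha i hi)).symm.trans h2

end Net

-- Primitive recursive predicates with bounded quantifiers.

set_option linter.unusedSectionVars false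

section Prim

variable {α β γ : Type*} [Primcodable α] [Primcodable β] [Primcodable γ]

theorem PrimrecPred.forall_mem {f : α → List β} (hf : Primrec f) {R : α → β → Prop}
    (hR : PrimrecPred fun p : α × β => R p.1 p.2) : PrimrecPred fun a => ∀ b ∈ f a, R a b :=
  (PrimrecRel.forall_mem_list (R := fun b a => R a b)
    (hR.comp (Primrec.snd.pair Primrec.fst))).comp hf Primrec.id

theorem PrimrecPred.exists_mem {f : α → List β} (hf : Primrec f) {R : α → β → Prop}
    (hR : PrimrecPred fun p : α × β => R p.1 p.2) : PrimrecPred fun a => ∃ b ∈ f a, R a b :=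
  (PrimrecRel.exists_mem_list (R := fun b a => R a b)
    (hR.comp (Primrec.snd.pair Primrec.fst))).comp hf Primrec.id

theorem PrimrecPred.forall_lt' {f : α → ℕ} (hf : Primrec f) {R : α → ℕ → Prop}
    (hR : PrimrecPred fun p : α × ℕ => R p.1 p.2) : PrimrecPred fun a => ∀ b < f a, R a b :=
  (PrimrecPred.forall_mem (Primrec.list_range.comp hf) hR).of_eq (by simp)

theorem PrimrecPred.exists_lt' {f : α → ℕ} (hf : Primrec f) {R : α → ℕ → Prop}
    (hR : PrimrecPred fun p : α × ℕ => R p.1 p.2) : PrimrecPred fun a => ∃ b < f a, R a b :=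
  (PrimrecPred.exists_mem (Primrec.list_range.comp hf) hR).of_eq (by simp)

theorem PrimrecPred.imp {p q : α → Prop} (hp : PrimrecPred p) (hq : PrimrecPred q) :
    PrimrecPred fun a => p a → q a :=
  (hp.not.or hq).of_eq fun _ => imp_iff_not_or.symm

theorem PrimrecPred.eq' [DecidableEq β] {f g : α → β} (hf : Primrec f) (hg : Primrec g) :
    PrimrecPred fun a => f a = g a :=
  Primrec.eq.comp hf hg

theorem PrimrecPred.mem' [DecidableEq β] {f : α → β} {g : α → List β} (hf : Primrec f)
    (hg : Primrec g) : PrimrecPred fun a => f a ∈ g a :=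
  (PrimrecPred.exists_mem (R := fun a b => b = f a) hg
    (.eq' Primrec.snd (hf.comp Primrec.fst))).of_eq (by simp)

/-- Unbounded search through the codes of possible witnesses, each test being total. -/
theorem REPred.of_exists {R : α → β → Prop} (hR : PrimrecPred fun p : α × β => R p.1 p.2) :
    REPred fun a => ∃ b, R a b := by
  classical
  have h1 : Computable₂ fun (a : α) (k : ℕ) =>
      ((Encodable.decode (α := β) k).bind fun b => if R a b then some () else none) := by
    refine (Primrec.option_bind (Primrec.decode.comp Primrec.snd) ?_).to_comp
    exact Primrec.ite (hR.comp ((Primrec.fst.comp Primrec.fst).pair Primrec.snd))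
      (Primrec.const _) (Primrec.const _)
  refine (Partrec.dom_re (Partrec.rfindOpt h1)).of_eq fun a => ?_
  rw [Nat.rfindOpt_dom]
  constructor
  · rintro ⟨k, _, hk⟩
    simp only [Option.mem_def, Option.bind_eq_some_iff, Option.ite_none_right_eq_some] at hk
    obtain ⟨b, -, hb, -⟩ := hk
    exact ⟨b, hb⟩
  · rintro ⟨b, hb⟩
    exact ⟨Encodable.encode b, (), by simp [hb]⟩

end Prim

-- Checking certificates is primitive recursive.

namespace Net

open Primrec

variable {ι κ Λ μ α β : Type} [Primcodable ι] [Primcodable κ] [Primcodable Λ] [Primcodable μ]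
  [Primcodable α] [Primcodable β] [DecidableEq κ] [DecidableEq Λ]

/-- A primitive recursive family of nets. -/
structure IsPrim (net : ι → Net κ Λ) : Prop where
  size : Primrec fun a => (net a).size
  tau : Primrec fun p : ι × ℕ × κ => (net p.1).tau p.2.1 p.2.2
  inst : Primrec fun p : ι × ℕ × Λ => (net p.1).inst p.2.1 p.2.2
  idle : Primrec fun a => (net a).idle
  goal : Primrec fun p : ι × ℕ × κ => (net p.1).goal p.2.1 p.2.2
  target : Primrec fun p : ι × ℕ => (net p.1).target p.2

theorem prim_emitTo {em : α → Option (ℕ × Λ)} {j : α → ℕ} (hem : Primrec em) (hj : Primrec j) :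
    Primrec fun x => emitTo (em x) (j x) :=
  option_bind hem (Primrec.ite (.eq' (fst.comp snd) (hj.comp fst))
    (option_some.comp (snd.comp snd)) (const none))

/-- The parameter `b` lets the way of appending depend on the input, as `appClass` depends on a
table. -/
theorem prim_updWith {app : β → μ → Option Λ → μ}
    (happ : Primrec fun p : β × μ × Option Λ => app p.1 p.2.1 p.2.2) {b : α → β}
    {s : α → ℕ → κ × μ} {i : α → ℕ} {c : α → κ × μ} {em : α → Option (ℕ × Λ)} (hb : Primrec b)
    (hs : Primrec₂ s) (hi : Primrec i) (hc : Primrec c) (hem : Primrec em) :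
    Primrec₂ fun x j => updWith (app (b x)) (s x) (i x) (c x) (em x) j := by
  have h1 : Primrec fun p : α × ℕ => if p.2 = i p.1 then c p.1 else s p.1 p.2 :=
    Primrec.ite (.eq' snd (hi.comp fst)) (hc.comp fst) hs
  exact (fst.comp h1).pair (happ.comp ((hb.comp fst).pair ((snd.comp h1).pair
    (prim_emitTo (hem.comp fst) snd))))

theorem prim_act {t : α → List ℕ} {x : α → Λ} {m : α → ℕ} (ht : Primrec t) (hx : Primrec x)
    (hm : Primrec m) : Primrec fun a => act (t a) (x a) (m a) :=
  (list_getD 0).comp ht (Primrec₂.natPair.comp (Primrec.encode.comp hx) hm)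

theorem prim_appClass :
    Primrec fun p : List ℕ × ℕ × Option Λ => appClass p.1 p.2.1 p.2.2 :=
  (option_casesOn (snd.comp snd) (fst.comp snd)
    (g := fun (q : List ℕ × ℕ × Option Λ) (x : Λ) => act q.1 x q.2.1)
    (prim_act (fst.comp fst) snd (fst.comp (snd.comp fst)))).of_eq fun p => by
      rcases p with ⟨t, m, _ | x⟩ <;> rfl

theorem prim_appList :
    Primrec fun p : Unit × List Λ × Option Λ => appList p.2.1 p.2.2 :=
  list_append.comp (fst.comp snd) (optionToList.comp (snd.comp snd))

theorem prim_rest {t : α → List (List Λ)} {j m : α → ℕ} (ht : Primrec t) (hj : Primrec j)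
    (hm : Primrec m) : Primrec fun a => rest (t a) (j a) (m a) :=
  (list_getD []).comp ht (Primrec₂.natPair.comp hj hm)

theorem prim_matchStep {t : α → List Λ} {x : α → Λ} (ht : Primrec t) (hx : Primrec x) :
    Primrec fun a => matchStep (t a) (x a) :=
  Primrec.ite (.eq' (list_head?.comp ht) (option_some.comp hx)) (list_tail.comp ht) ht

variable {net : ι → Net κ Λ}

theorem IsPrim.toList (h : IsPrim net) {a : α → ι} {f : α → ℕ → κ × μ} (ha : Primrec a)
    (hf : Primrec₂ f) : Primrec fun x => (net (a x)).toList (f x) :=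
  list_map (list_range.comp (h.size.comp ha)) hf

theorem IsPrim.ofList (h : IsPrim net) (d : μ) {a : α → ι} {l : α → List (κ × μ)} {i : α → ℕ}
    (ha : Primrec a) (hl : Primrec l) (hi : Primrec i) :
    Primrec fun x => (net (a x)).ofList d (l x) (i x) :=
  (option_getD.comp (list_getElem?.comp hl hi) ((h.idle.comp ha).pair (const d))).of_eq
    fun x => by simp [Net.ofList, List.getD_eq_getElem?_getD]

theorem IsPrim.tablesOK (h : IsPrim net) : PrimrecPred fun p : ι × Cert κ Λ =>
    (net p.1).TablesOK p.2.1 p.2.2.1 p.2.2.2.1 p.2.2.2.2.1 p.2.2.2.2.2.1 p.2.2.2.2.2.2.1 := by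
  have hA : Primrec fun p : ι × Cert κ Λ => p.2.1 := fst.comp snd
  have hM : Primrec fun p : ι × Cert κ Λ => p.2.2.1 := fst.comp (snd.comp snd)
  have he : Primrec fun p : ι × Cert κ Λ => p.2.2.2.1 := fst.comp (snd.comp (snd.comp snd))
  have hL : Primrec fun p : ι × Cert κ Λ => p.2.2.2.2.1 :=
    fst.comp (snd.comp (snd.comp (snd.comp snd)))
  have hR : Primrec fun p : ι × Cert κ Λ => p.2.2.2.2.2.1 :=
    fst.comp (snd.comp (snd.comp (snd.comp (snd.comp snd))))
  have hS : Primrec fun p : ι × Cert κ Λ => p.2.2.2.2.2.2.1 :=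
    fst.comp (snd.comp (snd.comp (snd.comp (snd.comp (snd.comp snd)))))
  refine (nat_lt.comp he hM).and (.and ?_ (.and ?_ (.and ?_ ?_)))
  · refine .forall_mem hA (.forall_lt' (hM.comp fst) ?_)
    exact (nat_lt.comp (prim_act (hL.comp (fst.comp fst)) (snd.comp fst) snd)
      (hM.comp (fst.comp fst))).and (nat_lt.comp (prim_act (hR.comp (fst.comp fst))
        (snd.comp fst) snd) (hM.comp (fst.comp fst)))
  · exact .forall_mem hA (.eq' (prim_act (hR.comp fst) snd (he.comp fst))
      (prim_act (hL.comp fst) snd (he.comp fst)))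
  · refine .forall_mem hA (.forall_mem (hA.comp fst) (.forall_lt' (hM.comp (fst.comp fst)) ?_))
    have hx : Primrec fun q : (((ι × Cert κ Λ) × Λ) × Λ) × ℕ => q.1.1.2 :=
      snd.comp (fst.comp fst)
    have hy : Primrec fun q : (((ι × Cert κ Λ) × Λ) × Λ) × ℕ => q.1.2 := snd.comp fst
    have h0 : Primrec fun q : (((ι × Cert κ Λ) × Λ) × Λ) × ℕ => q.1.1.1 :=
      fst.comp (fst.comp fst)
    exact .eq' (prim_act (hR.comp h0) hy (prim_act (hL.comp h0) hx snd))
      (prim_act (hL.comp h0) hx (prim_act (hR.comp h0) hy snd))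
  · refine .forall_lt' (h.size.comp fst) (.and ?_ ?_)
    · exact .eq' (prim_rest (hS.comp fst) snd (he.comp fst)) (h.target.comp ((fst.comp fst).pair snd))
    · refine .forall_mem (hA.comp fst) (.forall_lt' (hM.comp (fst.comp fst)) ?_)
      have h0 : Primrec fun q : (((ι × Cert κ Λ) × ℕ) × Λ) × ℕ => q.1.1.1 :=
        fst.comp (fst.comp fst)
      have hj : Primrec fun q : (((ι × Cert κ Λ) × ℕ) × Λ) × ℕ => q.1.1.2 :=
        snd.comp (fst.comp fst)
      have hx : Primrec fun q : (((ι × Cert κ Λ) × ℕ) × Λ) × ℕ => q.1.2 := snd.comp fst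
      exact .eq' (prim_rest (hS.comp h0) hj (prim_act (hR.comp h0) hx snd))
        (prim_matchStep (prim_rest (hS.comp h0) hj snd) hx)

theorem IsPrim.initOK (h : IsPrim net) {init : ι → ℕ → κ × List Λ} (hi : Primrec₂ init)
    {A : α → List Λ} {e : α → ℕ} {R : α → List ℕ} {I : α → List (List (κ × ℕ))} {a : α → ι}
    (ha : Primrec a) (hA : Primrec A) (he : Primrec e) (hR : Primrec R) (hI : Primrec I) :
    PrimrecPred fun p => (net (a p)).InitOK (init (a p)) (A p) (e p) (R p) (I p) := by
  refine .and ?_ ?_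
  · refine .forall_lt' (h.size.comp ha) (.forall_mem (snd.comp (hi.comp (ha.comp fst) snd)) ?_)
    exact .mem' snd (hA.comp (fst.comp fst))
  · refine .mem' (h.toList ha ?_) hI
    refine (fst.comp (hi.comp (ha.comp fst) snd)).pair (list_foldl
      (h := fun p (q : ℕ × Λ) => act (R p.1) q.2 q.1)
      (snd.comp (hi.comp (ha.comp fst) snd)) (he.comp fst) ?_)
    exact prim_act (hR.comp (fst.comp fst)) (snd.comp snd) (fst.comp snd)

theorem IsPrim.tauOK (h : IsPrim net)
    {A : α → List Λ} {R : α → List ℕ} {I : α → List (List (κ × ℕ))} {a : α → ι}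
    (ha : Primrec a) (hA : Primrec A) (hR : Primrec R) (hI : Primrec I) :
    PrimrecPred fun p => (net (a p)).TauOK (A p) (R p) (I p) := by
  refine .forall_mem hI (.forall_lt' (h.size.comp (ha.comp fst)) ?_)
  have hc : Primrec fun q : (α × List (κ × ℕ)) × ℕ => (net (a q.1.1)).ofList 0 q.1.2 q.2 :=
    h.ofList 0 (ha.comp (fst.comp fst)) (snd.comp fst) snd
  refine .forall_mem (h.tau.comp ((ha.comp (fst.comp fst)).pair (snd.pair (fst.comp hc)))) ?_
  refine .and (.forall_mem (optionToList.comp (snd.comp snd))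
    (.mem' (snd.comp snd) (hA.comp (fst.comp (fst.comp (fst.comp fst)))))) ?_
  refine .mem' (h.toList (ha.comp (fst.comp (fst.comp fst))) ?_)
    (hI.comp (fst.comp (fst.comp fst)))
  exact prim_updWith (app := fun b m o => appClass b m o) prim_appClass
    (hR.comp (fst.comp (fst.comp fst)))
    (h.ofList 0 (ha.comp (fst.comp (fst.comp (fst.comp fst))))
      (snd.comp (fst.comp (fst.comp fst))) snd)
    (snd.comp fst) ((fst.comp snd).pair (snd.comp (hc.comp fst))) (snd.comp snd)

theorem IsPrim.popOK (h : IsPrim net)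
    {A : α → List Λ} {M : α → ℕ} {L R : α → List ℕ} {I : α → List (List (κ × ℕ))} {a : α → ι}
    (ha : Primrec a) (hA : Primrec A) (hM : Primrec M) (hL : Primrec L) (hR : Primrec R)
    (hI : Primrec I) :
    PrimrecPred fun p => (net (a p)).PopOK (A p) (M p) (L p) (R p) (I p) := by
  refine .forall_mem hI (.forall_lt' (h.size.comp (ha.comp fst)) ?_)
  have hc : Primrec fun q : (α × List (κ × ℕ)) × ℕ => (net (a q.1.1)).ofList 0 q.1.2 q.2 :=
    h.ofList 0 (ha.comp (fst.comp fst)) (snd.comp fst) snd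
  refine .imp (.eq' (fst.comp hc) (h.idle.comp (ha.comp (fst.comp fst)))) ?_
  refine .forall_mem (hA.comp (fst.comp fst)) (.forall_lt' (hM.comp (fst.comp (fst.comp fst))) ?_)
  have h0 : Primrec fun q : (((α × List (κ × ℕ)) × ℕ) × Λ) × ℕ => q.1.1.1.1 :=
    fst.comp (fst.comp (fst.comp fst))
  have hs : Primrec fun q : (((α × List (κ × ℕ)) × ℕ) × Λ) × ℕ => q.1.1.1.2 :=
    snd.comp (fst.comp (fst.comp fst))
  have hi : Primrec fun q : (((α × List (κ × ℕ)) × ℕ) × Λ) × ℕ => q.1.1.2 :=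
    snd.comp (fst.comp fst)
  have hx : Primrec fun q : (((α × List (κ × ℕ)) × ℕ) × Λ) × ℕ => q.1.2 := snd.comp fst
  refine .imp (.eq' (prim_act (hL.comp h0) hx snd) (snd.comp (hc.comp (fst.comp fst)))) ?_
  refine .forall_mem (h.inst.comp ((ha.comp h0).pair (hi.pair hx))) ?_
  refine .mem' (h.toList (ha.comp (h0.comp fst)) ?_) (hI.comp (h0.comp fst))
  exact prim_updWith (app := fun b m o => appClass (Λ := Λ) b m o) prim_appClass
    (hR.comp (h0.comp fst))
    (h.ofList 0 (ha.comp (h0.comp (fst.comp fst))) (hs.comp (fst.comp fst)) snd)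
    (hi.comp fst) (snd.pair (snd.comp fst)) (const none)

theorem IsPrim.goalOK (h : IsPrim net)
    {S : α → List (List Λ)} {I : α → List (List (κ × ℕ))} {a : α → ι}
    (ha : Primrec a) (hS : Primrec S) (hI : Primrec I) :
    PrimrecPred fun p => (net (a p)).GoalOK (S p) (I p) := by
  refine .forall_mem hI (.exists_lt' (h.size.comp (ha.comp fst)) ?_)
  have hc : Primrec fun q : (α × List (κ × ℕ)) × ℕ => (net (a q.1.1)).ofList 0 q.1.2 q.2 :=
    h.ofList 0 (ha.comp (fst.comp fst)) (snd.comp fst) snd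
  refine .or (.eq' (h.goal.comp ((ha.comp (fst.comp fst)).pair (snd.pair (fst.comp hc))))
    (const false)) (.not (.eq' (prim_rest (hS.comp (fst.comp fst)) snd (snd.comp hc)) (const [])))

theorem IsPrim.certOK (h : IsPrim net) {init : ι → ℕ → κ × List Λ} (hi : Primrec₂ init) :
    PrimrecPred fun p : ι × Cert κ Λ => (net p.1).CertOK (init p.1) p.2 := by
  have hA : Primrec fun p : ι × Cert κ Λ => p.2.1 := fst.comp snd
  have hM : Primrec fun p : ι × Cert κ Λ => p.2.2.1 := fst.comp (snd.comp snd)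
  have he : Primrec fun p : ι × Cert κ Λ => p.2.2.2.1 := fst.comp (snd.comp (snd.comp snd))
  have hL : Primrec fun p : ι × Cert κ Λ => p.2.2.2.2.1 :=
    fst.comp (snd.comp (snd.comp (snd.comp snd)))
  have hR : Primrec fun p : ι × Cert κ Λ => p.2.2.2.2.2.1 :=
    fst.comp (snd.comp (snd.comp (snd.comp (snd.comp snd))))
  have hS : Primrec fun p : ι × Cert κ Λ => p.2.2.2.2.2.2.1 :=
    fst.comp (snd.comp (snd.comp (snd.comp (snd.comp (snd.comp snd)))))
  have hI : Primrec fun p : ι × Cert κ Λ => p.2.2.2.2.2.2.2 :=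
    snd.comp (snd.comp (snd.comp (snd.comp (snd.comp (snd.comp snd)))))
  exact h.tablesOK.and ((h.initOK hi fst hA he hR hI).and ((h.tauOK fst hA hR hI).and
    ((h.popOK fst hA hM hL hR hI).and (h.goalOK fst hS hI))))

-- Enumeration of runs, and decidability for nets.

/-- The successors of a configuration. -/
def succs (n : Net κ Λ) (l : List (κ × List Λ)) : List (List (κ × List Λ)) :=
  (List.range n.size).flatMap fun i =>
    ((n.tau i (n.ofList [] l i).1).map fun u =>
      n.toList (upd (n.ofList [] l) i (u.1, (n.ofList [] l i).2) u.2)) ++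
    if (n.ofList [] l i).1 = n.idle then
      (n.ofList [] l i).2.head?.toList.flatMap fun x => (n.inst i x).map fun q =>
        n.toList (upd (n.ofList [] l) i (q, (n.ofList [] l i).2.tail) none)
    else []

theorem mem_succs_toList (n : Net κ Λ) (σ : ℕ → κ × List Λ) (l : List (κ × List Λ)) :
    l ∈ n.succs (n.toList σ) ↔ ∃ σ', n.Step σ σ' ∧ l = n.toList σ' := by
  simp only [succs, List.mem_flatMap, List.mem_range, List.mem_append, List.mem_map,
    toList_updWith]
  constructor
  · rintro ⟨i, hi, h⟩
    rw [n.ofList_toList [] σ hi] at h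
    rcases h with ⟨u, hu, rfl⟩ | h
    · exact ⟨_, .tau hi hu, rfl⟩
    · split_ifs at h with hid
      · simp only [List.mem_flatMap, Option.mem_toList, List.mem_map] at h
        obtain ⟨x, hx, q, hq, rfl⟩ := h
        exact ⟨_, .pop hi hid (List.cons_head?_tail hx).symm hq, rfl⟩
      · simp at h
  · rintro ⟨_, ⟨hi, hu⟩ | ⟨hi, hid, hw, hq⟩, rfl⟩
    · refine ⟨_, hi, .inl ⟨_, by rwa [n.ofList_toList [] σ hi], ?_⟩⟩
      rw [n.ofList_toList [] σ hi]
    · refine ⟨_, hi, .inr ?_⟩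
      rw [n.ofList_toList [] σ hi, if_pos hid, hw]
      simp only [List.head?_cons, Option.toList_some, List.flatMap_cons, List.flatMap_nil,
        List.append_nil, List.mem_map, List.tail_cons]
      exact ⟨_, hq, rfl⟩

/-- The configuration reached by a sequence of choices of successors. -/
def exec (n : Net κ Λ) (l : List (κ × List Λ)) (c : List ℕ) : List (κ × List Λ) :=
  c.foldl (fun l k => (n.succs l).getD k l) l

theorem exec_concat (n : Net κ Λ) (l : List (κ × List Λ)) (c : List ℕ) (k : ℕ) :
    n.exec l (c ++ [k]) = (n.succs (n.exec l c)).getD k (n.exec l c) := by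
  simp only [exec, List.foldl_append, List.foldl_cons, List.foldl_nil]

/-- A run is coded by the numbers of the successors chosen. A number out of range leaves the
configuration unchanged, so every list of numbers codes a run. -/
theorem reach_iff_exec (n : Net κ Λ) (σ : ℕ → κ × List Λ) : n.Reach σ ↔
    ∃ c : List ℕ, ∀ i < n.size, n.goal i (n.ofList [] (n.exec (n.toList σ) c) i).1 = true ∧
      (n.ofList [] (n.exec (n.toList σ) c) i).2.foldl matchStep (n.target i) = [] := by
  have key : ∀ τ, Relation.ReflTransGen n.Step σ τ → ∃ c, n.exec (n.toList σ) c = n.toList τ := by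
    intro τ h
    induction h with
    | refl => exact ⟨[], rfl⟩
    | tail _ hs ih =>
      obtain ⟨c, hc⟩ := ih
      have := (n.mem_succs_toList _ _).2 ⟨_, hs, rfl⟩
      obtain ⟨k, hk, hk'⟩ := List.mem_iff_getElem.1 this
      refine ⟨c ++ [k], ?_⟩
      rw [exec_concat, hc, List.getD_eq_getElem _ _ hk, hk']
  have key' : ∀ c, ∃ τ, Relation.ReflTransGen n.Step σ τ ∧
      n.exec (n.toList σ) c = n.toList τ := by
    intro c
    induction c using List.reverseRecOn with
    | nil => exact ⟨σ, .refl, rfl⟩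
    | append_singleton c k ih =>
      obtain ⟨τ, h1, h2⟩ := ih
      rw [exec_concat, h2]
      by_cases hk : k < (n.succs (n.toList τ)).length
      · rw [List.getD_eq_getElem _ _ hk]
        obtain ⟨τ', h3, h4⟩ := (n.mem_succs_toList _ _).1 (List.getElem_mem hk)
        exact ⟨τ', h1.tail h3, h4⟩
      · exact ⟨τ, h1, by rw [List.getD_eq_default _ _ (by omega)]⟩
  have fin : ∀ τ, n.Final τ ↔ ∀ i < n.size, n.goal i (n.ofList [] (n.toList τ) i).1 = true ∧
      (n.ofList [] (n.toList τ) i).2.foldl matchStep (n.target i) = [] := by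
    refine fun τ => forall₂_congr fun i hi => ?_
    rw [n.ofList_toList [] τ hi, foldl_matchStep]
  constructor
  · rintro ⟨τ, h1, h2⟩
    obtain ⟨c, hc⟩ := key τ h1
    exact ⟨c, by rw [hc]; exact (fin τ).1 h2⟩
  · rintro ⟨c, hc⟩
    obtain ⟨τ, h1, h2⟩ := key' c
    rw [h2] at hc
    exact ⟨τ, h1, (fin τ).2 hc⟩

theorem IsPrim.succs (h : IsPrim net) {a : α → ι} {l : α → List (κ × List Λ)} (ha : Primrec a)
    (hl : Primrec l) : Primrec fun x => (net (a x)).succs (l x) := by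
  have hc : Primrec₂ fun (x : α) (i : ℕ) => (net (a x)).ofList [] (l x) i :=
    h.ofList [] (ha.comp fst) (hl.comp fst) snd
  refine list_flatMap (list_range.comp (h.size.comp ha)) (list_append.comp ?_ ?_)
  · refine list_map (h.tau.comp ((ha.comp fst).pair (snd.pair (fst.comp hc)))) ?_
    refine h.toList (ha.comp (fst.comp fst)) ?_
    exact prim_updWith (app := fun _ m o => appList m o) (b := fun _ => ()) prim_appList (const ())
      (h.ofList [] (ha.comp (fst.comp (fst.comp fst))) (hl.comp (fst.comp (fst.comp fst))) snd)
      (snd.comp fst) ((fst.comp snd).pair (snd.comp (hc.comp (fst.comp fst) (snd.comp fst))))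
      (snd.comp snd)
  · refine Primrec.ite (.eq' (fst.comp hc) (h.idle.comp (ha.comp fst))) ?_ (const [])
    refine list_flatMap (optionToList.comp (list_head?.comp (snd.comp hc))) ?_
    refine list_map (h.inst.comp ((ha.comp (fst.comp fst)).pair ((snd.comp fst).pair snd))) ?_
    refine h.toList (ha.comp (fst.comp (fst.comp fst))) ?_
    have h0 : Primrec fun q : ((α × ℕ) × Λ) × κ => q.1.1 := fst.comp fst
    exact prim_updWith (app := fun _ m o => appList (Λ := Λ) m o) (b := fun _ => ()) prim_appList
      (const ())
      (h.ofList [] (ha.comp (fst.comp (h0.comp fst))) (hl.comp (fst.comp (h0.comp fst))) snd)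
      (snd.comp h0) (snd.pair (list_tail.comp (snd.comp (hc.comp (fst.comp h0) (snd.comp h0)))))
      (const none)

theorem IsPrim.exec (h : IsPrim net) {a : α → ι} {l : α → List (κ × List Λ)} {c : α → List ℕ}
    (ha : Primrec a) (hl : Primrec l) (hc : Primrec c) :
    Primrec fun x => (net (a x)).exec (l x) (c x) := by
  have hs : Primrec fun p : α × List (κ × List Λ) × ℕ =>
      ((net (a p.1)).succs p.2.1)[p.2.2]?.getD p.2.1 :=
    option_getD.comp (list_getElem?.comp (h.succs (ha.comp fst) (fst.comp snd))
      (snd.comp snd)) (fst.comp snd)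
  refine (list_foldl hc hl hs.to₂).of_eq fun x => ?_
  simp only [Net.exec, List.getD_eq_getElem?_getD]

/-- Coverability is decidable for a primitive recursive family of nets with finitely many control
states and letters. -/
theorem IsPrim.computablePred_reach (h : IsPrim net) {init : ι → ℕ → κ × List Λ}
    (hi : Primrec₂ init)
    (hfin : ∀ a, ∃ (Q : Finset κ) (A : Finset Λ),
      (∀ j < (net a).size, (init a j).1 ∈ Q ∧ ∀ x ∈ (init a j).2, x ∈ A) ∧
      (∀ i < (net a).size, ∀ q ∈ Q, ∀ u ∈ (net a).tau i q,
        u.1 ∈ Q ∧ ∀ e ∈ u.2.toList, e.2 ∈ A) ∧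
      (∀ i < (net a).size, ∀ x ∈ A, ∀ q ∈ (net a).inst i x, q ∈ Q)) :
    ComputablePred fun a => (net a).Reach (init a) := by
  -- Post's theorem: runs witness the predicate, certificates witness its complement.
  refine ComputablePred.computable_iff_re_compl_re'.2 ⟨?_, ?_⟩
  · refine (REPred.of_exists (R := fun a (c : List ℕ) => ∀ i < (net a).size,
      (net a).goal i ((net a).ofList [] ((net a).exec ((net a).toList (init a)) c) i).1 = true ∧
      ((net a).ofList [] ((net a).exec ((net a).toList (init a)) c) i).2.foldl matchStep
        ((net a).target i) = []) ?_).of_eq fun a => ((net a).reach_iff_exec (init a)).symm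
    have hex : Primrec fun p : ι × List ℕ => (net p.1).exec ((net p.1).toList (init p.1)) p.2 :=
      h.exec fst (h.toList fst (hi.comp (fst.comp fst) snd)) snd
    refine .forall_lt' (h.size.comp fst) ?_
    have hc : Primrec fun q : (ι × List ℕ) × ℕ => (net q.1.1).ofList []
        ((net q.1.1).exec ((net q.1.1).toList (init q.1.1)) q.1.2) q.2 :=
      h.ofList [] (fst.comp fst) (hex.comp fst) snd
    refine .and (.eq' (h.goal.comp ((fst.comp fst).pair (snd.pair (fst.comp hc)))) (const true))
      (.eq' (list_foldl (h := fun _ (q : List Λ × Λ) => matchStep q.1 q.2) (snd.comp hc) (h.target.comp ((fst.comp fst).pair snd)) ?_) (const []))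
    exact prim_matchStep (fst.comp snd) (snd.comp snd)
  · refine (REPred.of_exists (R := fun a (c : Cert κ Λ) => (net a).CertOK (init a) c)
      (h.certOK hi)).of_eq fun a => ⟨fun ⟨c, hc⟩ => hc.not_reach, fun hn => ?_⟩
    obtain ⟨Q, A, h1, h2, h3⟩ := hfin a
    exact exists_certOK Q A h1 h2 h3 hn

end Net

namespace ActorLang

open Primrec

/-! ### Compilation to tokens -/

theorem lt_pair_right {a b : ℕ} (h : 1 ≤ a) : b < Nat.pair a b := by
  unfold Nat.pair
  split_ifs with h1
  · nlinarith
  · nlinarith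

/-- The termination argument of the recursions on codes: a nonzero tag makes a code larger than its
contents. -/
theorem unpair_snd_lt {c : ℕ} (h : c.unpair.1 ≠ 0) : c.unpair.2 < c := by
  conv_rhs => rw [← Nat.pair_unpair c]
  exact lt_pair_right (by omega)

/-- The tokens, in postfix order, of the expression (or, if `b`, the tuple of expressions) with code
`c` under `k` binders, and the length of the tuple. -/
def expToks (k : ℕ) (b : Bool) (c : ℕ) : List ℕ × ℕ :=
  if b then
    if c = 0 then ([], 0)
    else
      ((expToks k false (c - 1).unpair.1).1 ++ (expToks k true (c - 1).unpair.2).1,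
        (expToks k true (c - 1).unpair.2).2 + 1)
  -- Odd tokens are operators. Even tokens are references, recorded with the number `k` of binders
  -- above them.
  else if c.unpair.1 = 0 then ([2 * c + 1], 1)
  else if c.unpair.1 = 1 then ([2 * Nat.pair k c.unpair.2], 1)
  else if c.unpair.1 = 2 then
    ((expToks k true c.unpair.2.unpair.2).1 ++
      [2 * Nat.pair 1 (Nat.pair c.unpair.2.unpair.1 (expToks k true c.unpair.2.unpair.2).2) + 1], 1)
  else ([], 1)
termination_by c
decreasing_by
  all_goals
    have h1 := Nat.unpair_left_le (c - 1)
    have h2 := Nat.unpair_right_le (c - 1)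
    have h3 := Nat.unpair_right_le c.unpair.2
    have h4 := unpair_snd_lt (c := c)
    omega

/-- The tokens, in postfix order, of the process with code `c` under `k` binders. -/
def procToks (k c : ℕ) : List ℕ :=
  -- Operator tags 0 and 1 belong to expressions, 2 to 7 to processes. The operator comes last, so a
  -- word of tokens can be decoded from its end.
  if c.unpair.1 = 0 then [2 * Nat.pair 2 0 + 1]
  else if c.unpair.1 = 1 then
    procToks k c.unpair.2.unpair.2.unpair.2 ++ (expToks k false c.unpair.2.unpair.2.unpair.1).1 ++
      [2 * Nat.pair 3 c.unpair.2.unpair.1 + 1]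
  else if c.unpair.1 = 2 then
    procToks (k + 1) c.unpair.2.unpair.2 ++ (expToks k false c.unpair.2.unpair.1).1 ++
      [2 * Nat.pair 4 0 + 1]
  else if c.unpair.1 = 3 then
    procToks k c.unpair.2.unpair.2.unpair.2.unpair.2 ++
      (expToks k true c.unpair.2.unpair.2.unpair.2.unpair.1).1 ++
      [2 * Nat.pair k c.unpair.2.unpair.1,
        2 * Nat.pair 5 (Nat.pair c.unpair.2.unpair.2.unpair.1
          (expToks k true c.unpair.2.unpair.2.unpair.2.unpair.1).2) + 1]
  else if c.unpair.1 = 4 then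
    procToks k c.unpair.2.unpair.2.unpair.2.unpair.1 ++
      procToks k c.unpair.2.unpair.2.unpair.2.unpair.2 ++ (expToks k false c.unpair.2.unpair.1).1 ++
      (expToks k false c.unpair.2.unpair.2.unpair.1).1 ++ [2 * Nat.pair 6 0 + 1]
  else if c.unpair.1 = 5 then
    procToks k c.unpair.2.unpair.1 ++ procToks k c.unpair.2.unpair.2 ++ [2 * Nat.pair 7 0 + 1]
  else []
termination_by c
decreasing_by
  all_goals
    have h1 := unpair_snd_lt (c := c) (by omega)
    have h2 := Nat.unpair_right_le c.unpair.2
    have h3 := Nat.unpair_left_le c.unpair.2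
    have h4 := Nat.unpair_right_le c.unpair.2.unpair.2
    have h5 := Nat.unpair_right_le c.unpair.2.unpair.2.unpair.2
    have h6 := Nat.unpair_left_le c.unpair.2.unpair.2.unpair.2
    omega

section Prim

variable {α : Type} [Primcodable α]

theorem prim_unpair₁ {f : α → ℕ} (hf : Primrec f) : Primrec fun a => (f a).unpair.1 :=
  fst.comp (unpair.comp hf)

theorem prim_unpair₂ {f : α → ℕ} (hf : Primrec f) : Primrec fun a => (f a).unpair.2 :=
  snd.comp (unpair.comp hf)

theorem prim_tok {f : α → ℕ} {t : α → ℕ} (ht : Primrec t) (hf : Primrec f) :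
    Primrec fun a => 2 * Nat.pair (t a) (f a) + 1 :=
  succ.comp (nat_double.comp (Primrec₂.natPair.comp ht hf))

theorem prim_ref {f : α → ℕ} {t : α → ℕ} (ht : Primrec t) (hf : Primrec f) :
    Primrec fun a => 2 * Nat.pair (t a) (f a) :=
  nat_double.comp (Primrec₂.natPair.comp ht hf)

theorem prim_natEq {f : α → ℕ} (hf : Primrec f) (n : ℕ) : PrimrecPred fun a => f a = n :=
  .eq' hf (const n)

/-- Course-of-values recursion with the code as measure: `l` lists the arguments of the recursive
calls and `g` combines their results. The same scheme serves for `prim_procToks`. -/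
theorem prim_expToks : Primrec fun p : ℕ × Bool × ℕ => expToks p.1 p.2.1 p.2.2 := by
  let l : ℕ × Bool × ℕ → List (ℕ × Bool × ℕ) := fun p =>
    if p.2.1 = true then
      if p.2.2 = 0 then []
      else [(p.1, false, (p.2.2 - 1).unpair.1), (p.1, true, (p.2.2 - 1).unpair.2)]
    else if p.2.2.unpair.1 = 2 then [(p.1, true, p.2.2.unpair.2.unpair.2)] else []
  let g : ℕ × Bool × ℕ → List (List ℕ × ℕ) → Option (List ℕ × ℕ) := fun p r => some (
    if p.2.1 = true then
      if p.2.2 = 0 then ([], 0)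
      else ((r.getD 0 ([], 0)).1 ++ (r.getD 1 ([], 0)).1, (r.getD 1 ([], 0)).2 + 1)
    else if p.2.2.unpair.1 = 0 then ([2 * p.2.2 + 1], 1)
    else if p.2.2.unpair.1 = 1 then ([2 * Nat.pair p.1 p.2.2.unpair.2], 1)
    else if p.2.2.unpair.1 = 2 then
      ((r.getD 0 ([], 0)).1 ++
        [2 * Nat.pair 1 (Nat.pair p.2.2.unpair.2.unpair.1 (r.getD 0 ([], 0)).2) + 1], 1)
    else ([], 1))
  have hc : Primrec fun p : ℕ × Bool × ℕ => p.2.2 := snd.comp snd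
  have hb : Primrec fun p : ℕ × Bool × ℕ => p.2.1 := fst.comp snd
  have hl : Primrec l := by
    have hp : Primrec fun p : ℕ × Bool × ℕ => p.2.2 - 1 := nat_sub.comp hc (const 1)
    refine Primrec.ite (.eq' hb (const true)) (Primrec.ite (prim_natEq hc 0) (const []) ?_)
      (Primrec.ite (prim_natEq (prim_unpair₁ hc) 2) ?_ (const []))
    · exact list_cons.comp (fst.pair ((const false).pair (prim_unpair₁ hp)))
        (list_cons.comp (fst.pair ((const true).pair (prim_unpair₂ hp))) (const []))
    · exact list_cons.comp (fst.pair ((const true).pair (prim_unpair₂ (prim_unpair₂ hc)))) (const [])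
  have hg : Primrec₂ g := by
    have hc' : Primrec fun q : (ℕ × Bool × ℕ) × List (List ℕ × ℕ) => q.1.2.2 := hc.comp fst
    have hr : ∀ i, Primrec fun q : (ℕ × Bool × ℕ) × List (List ℕ × ℕ) => q.2.getD i ([], 0) :=
      fun i => (list_getD ([], 0)).comp snd (const i)
    refine option_some.comp (Primrec.ite (.eq' (hb.comp fst) (const true)) (Primrec.ite
      (prim_natEq hc' 0) (const _) ?_) (Primrec.ite (prim_natEq (prim_unpair₁ hc') 0) ?_
      (Primrec.ite (prim_natEq (prim_unpair₁ hc') 1) ?_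
      (Primrec.ite (prim_natEq (prim_unpair₁ hc') 2) ?_ (const _)))))
    · exact (list_append.comp (fst.comp (hr 0)) (fst.comp (hr 1))).pair (succ.comp (snd.comp (hr 1)))
    · exact (list_cons.comp (nat_double_succ.comp hc') (const [])).pair (const 1)
    · exact (list_cons.comp (nat_double.comp (Primrec₂.natPair.comp (fst.comp fst)
        (prim_unpair₂ hc'))) (const [])).pair (const 1)
    · exact (list_append.comp (fst.comp (hr 0)) (list_cons.comp (prim_tok (const 1)
        (Primrec₂.natPair.comp (prim_unpair₁ (prim_unpair₂ hc')) (snd.comp (hr 0))))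
        (const []))).pair (const 1)
  refine nat_omega_rec' _ (m := fun p => p.2.2) (l := l) (g := g) hc hl hg ?_ ?_
  · rintro ⟨k, b, c⟩ b' hb'
    simp only [l] at hb'
    split_ifs at hb' with h1 h2 h3
    · simp at hb'
    · have h4 := Nat.unpair_left_le (c - 1)
      have h5 := Nat.unpair_right_le (c - 1)
      simp only [List.mem_cons, List.not_mem_nil, or_false] at hb'
      rcases hb' with rfl | rfl
      · show (c - 1).unpair.1 < c; omega
      · show (c - 1).unpair.2 < c; omega
    · have h4 := Nat.unpair_right_le c.unpair.2
      have h5 := unpair_snd_lt (c := c) (by omega)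
      simp only [List.mem_cons, List.not_mem_nil, or_false] at hb'
      subst hb'
      show c.unpair.2.unpair.2 < c
      omega
    · simp at hb'
  · rintro ⟨k, b, c⟩
    simp only [l, g, Option.some.injEq]
    rw [expToks.eq_def k b c]
    cases b
    · by_cases h2 : c.unpair.1 = 2
      · simp [h2]
      · simp [h2]
    · by_cases h2 : c = 0
      · simp [h2]
      · simp [h2]

theorem prim_procToks : Primrec fun p : ℕ × ℕ => procToks p.1 p.2 := by
  let l : ℕ × ℕ → List (ℕ × ℕ) := fun p =>
    if p.2.unpair.1 = 1 then [(p.1, p.2.unpair.2.unpair.2.unpair.2)]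
    else if p.2.unpair.1 = 2 then [(p.1 + 1, p.2.unpair.2.unpair.2)]
    else if p.2.unpair.1 = 3 then [(p.1, p.2.unpair.2.unpair.2.unpair.2.unpair.2)]
    else if p.2.unpair.1 = 4 then [(p.1, p.2.unpair.2.unpair.2.unpair.2.unpair.1),
      (p.1, p.2.unpair.2.unpair.2.unpair.2.unpair.2)]
    else if p.2.unpair.1 = 5 then [(p.1, p.2.unpair.2.unpair.1), (p.1, p.2.unpair.2.unpair.2)]
    else []
  let g : ℕ × ℕ → List (List ℕ) → Option (List ℕ) := fun p r => some (
    if p.2.unpair.1 = 0 then [2 * Nat.pair 2 0 + 1]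
    else if p.2.unpair.1 = 1 then
      r.getD 0 [] ++ (expToks p.1 false p.2.unpair.2.unpair.2.unpair.1).1 ++
        [2 * Nat.pair 3 p.2.unpair.2.unpair.1 + 1]
    else if p.2.unpair.1 = 2 then
      r.getD 0 [] ++ (expToks p.1 false p.2.unpair.2.unpair.1).1 ++ [2 * Nat.pair 4 0 + 1]
    else if p.2.unpair.1 = 3 then
      r.getD 0 [] ++ (expToks p.1 true p.2.unpair.2.unpair.2.unpair.2.unpair.1).1 ++
        [2 * Nat.pair p.1 p.2.unpair.2.unpair.1,
          2 * Nat.pair 5 (Nat.pair p.2.unpair.2.unpair.2.unpair.1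
            (expToks p.1 true p.2.unpair.2.unpair.2.unpair.2.unpair.1).2) + 1]
    else if p.2.unpair.1 = 4 then
      r.getD 0 [] ++ r.getD 1 [] ++ (expToks p.1 false p.2.unpair.2.unpair.1).1 ++
        (expToks p.1 false p.2.unpair.2.unpair.2.unpair.1).1 ++ [2 * Nat.pair 6 0 + 1]
    else if p.2.unpair.1 = 5 then r.getD 0 [] ++ r.getD 1 [] ++ [2 * Nat.pair 7 0 + 1]
    else [])
  have hc : Primrec fun p : ℕ × ℕ => p.2 := snd
  have h1 := prim_unpair₁ hc
  have h2 := prim_unpair₂ hc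
  have h21 := prim_unpair₁ h2
  have h22 := prim_unpair₂ h2
  have h221 := prim_unpair₁ h22
  have h222 := prim_unpair₂ h22
  have h2221 := prim_unpair₁ h222
  have h2222 := prim_unpair₂ h222
  have hl : Primrec l := by
    have one : ∀ {f g : ℕ × ℕ → ℕ}, Primrec f → Primrec g → Primrec fun p => [(f p, g p)] :=
      fun hf hg => list_cons.comp (hf.pair hg) (const [])
    refine Primrec.ite (prim_natEq h1 1) (one fst h222) (Primrec.ite (prim_natEq h1 2)
      (one (succ.comp fst) h22) (Primrec.ite (prim_natEq h1 3) (one fst h2222)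
      (Primrec.ite (prim_natEq h1 4) (list_cons.comp (fst.pair h2221) (one fst h2222))
      (Primrec.ite (prim_natEq h1 5) (list_cons.comp (fst.pair h21) (one fst h22)) (const [])))))
  have hg : Primrec₂ g := by
    have hr : ∀ i, Primrec fun q : (ℕ × ℕ) × List (List ℕ) => q.2.getD i [] :=
      fun i => (list_getD []).comp snd (const i)
    have e : ∀ (b : Bool) {f : ℕ × ℕ → ℕ}, Primrec f →
        Primrec fun q : (ℕ × ℕ) × List (List ℕ) => expToks q.1.1 b (f q.1) := fun b f hf =>
      prim_expToks.comp ((fst.comp fst).pair ((const b).pair (hf.comp fst)))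
    have one : ∀ (t : ℕ) {f : (ℕ × ℕ) × List (List ℕ) → ℕ}, Primrec f →
        Primrec fun q : (ℕ × ℕ) × List (List ℕ) => [2 * Nat.pair t (f q) + 1] := fun t f hf =>
      list_cons.comp (prim_tok (const t) hf) (const [])
    have eq : ∀ n, PrimrecPred fun q : (ℕ × ℕ) × List (List ℕ) => q.1.2.unpair.1 = n := fun n =>
      prim_natEq (h1.comp fst) n
    refine option_some.comp (Primrec.ite (eq 0) (const _) (Primrec.ite (eq 1) ?_
      (Primrec.ite (eq 2) ?_ (Primrec.ite (eq 3) ?_ (Primrec.ite (eq 4) ?_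
      (Primrec.ite (eq 5) ?_ (const _)))))))
    · exact list_append.comp (list_append.comp (hr 0) (fst.comp (e false h221)))
        (one 3 (h21.comp fst))
    · exact list_append.comp (list_append.comp (hr 0) (fst.comp (e false h21))) (const _)
    · have e3 := e true h2221
      have e4 : Primrec fun q : (ℕ × ℕ) × List (List ℕ) =>
          2 * Nat.pair q.1.1 q.1.2.unpair.2.unpair.1 := prim_ref (fst.comp fst) (h21.comp fst)
      have e5 := list_cons.comp e4 (one 5 (Primrec₂.natPair.comp (h221.comp fst) (snd.comp e3)))
      exact list_append.comp (list_append.comp (hr 0) (fst.comp e3)) e5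
    · exact list_append.comp (list_append.comp (list_append.comp (list_append.comp (hr 0) (hr 1))
        (fst.comp (e false h21))) (fst.comp (e false h221))) (const _)
    · exact list_append.comp (list_append.comp (hr 0) (hr 1)) (const _)
  refine nat_omega_rec' _ (m := fun p => p.2) (l := l) (g := g) hc hl hg ?_ ?_
  · rintro ⟨k, c⟩ b' hb'
    simp only [l] at hb'
    have k1 : c.unpair.1 ≠ 0 → c.unpair.2 < c := unpair_snd_lt
    have k2 := Nat.unpair_right_le c.unpair.2
    have k3 := Nat.unpair_left_le c.unpair.2
    have k4 := Nat.unpair_right_le c.unpair.2.unpair.2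
    have k5 := Nat.unpair_right_le c.unpair.2.unpair.2.unpair.2
    have k6 := Nat.unpair_left_le c.unpair.2.unpair.2.unpair.2
    split_ifs at hb' <;>
      simp only [List.mem_cons, List.not_mem_nil, or_false] at hb'
    · subst hb'; dsimp only; omega
    · subst hb'; dsimp only; omega
    · subst hb'; dsimp only; omega
    · rcases hb' with rfl | rfl <;> dsimp only <;> omega
    · rcases hb' with rfl | rfl <;> dsimp only <;> omega
  · rintro ⟨k, c⟩
    simp only [l, g, Option.some.injEq]
    rw [procToks.eq_def k c]
    by_cases e0 : c.unpair.1 = 0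
    · simp [e0]
    by_cases e1 : c.unpair.1 = 1
    · simp [e1]
    by_cases e2 : c.unpair.1 = 2
    · simp [e2]
    by_cases e3 : c.unpair.1 = 3
    · simp [e3]
    by_cases e4 : c.unpair.1 = 4
    · simp [e4]
    by_cases e5 : c.unpair.1 = 5
    · simp [e5]
    simp [e0, e1, e2, e3, e4, e5]

end Prim

/-! ### The net of an instance -/

abbrev ProgCode := ℕ × List (ℕ × List ℕ) × List (ℕ × ℕ × List ℕ × ℕ)
abbrev CellCode := ℕ × List (ℕ × ℕ) × List (ℕ × List ℕ)
abbrev ConfCode := List (ℕ × CellCode)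
abbrev Inst := ProgCode × ConfCode × ConfCode

/-- The values of the bound variables, the arguments of the method and its parameters, and the tag of
the other free variables. -/
abbrev Env := List ℕ × (List ℕ × List ℕ) × ℕ

/-- A process code, its environment, and the actors created so far. -/
abbrev Ctrl := ℕ × Env × List ℕ

abbrev Letter := ℕ × List ℕ

namespace Inst

abbrev main (I : Inst) : ℕ := I.1.1
abbrev source (I : Inst) : ConfCode := I.2.1
abbrev tgt (I : Inst) : ConfCode := I.2.2
abbrev methods (I : Inst) : List (ℕ × ℕ × List ℕ × ℕ) := I.1.2.2
-- The components of the net are the actors of the target, in the order of its list.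
abbrev names (I : Inst) : List ℕ := I.tgt.map Prod.fst

def fields (I : Inst) (C : ℕ) : List ℕ := (I.1.2.1.lookup C).getD []

/-- The state of the actor `a` in the target. -/
def stateOf (I : Inst) (a : ℕ) : Option (List (ℕ × ℕ)) := (I.tgt.lookup a).map fun c => c.2.1

/-- The name of the actor with index `i`. -/
def nameOf (I : Inst) (i : ℕ) : ℕ := (I.names[i]?).getD 0

end Inst

/-- The value that a token refers to, if any. -/
def tokVal (t : ℕ) : ℕ :=
  -- The default is the code of no value, as values have tags 0 and 1.
  if t % 2 = 0 ∧ (t / 2).unpair.2.unpair.1 = 2 then (t / 2).unpair.2.unpair.2 else Nat.pair 2 0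

/-- The value is an actor name or a free variable of the main process. -/
def RigidCode (I : Inst) (v : ℕ) : Prop :=
  v.unpair.1 = 1 ∨ v.unpair.1 = 0 ∧ v ∈ (procToks 0 I.main).map tokVal

instance (I : Inst) (v : ℕ) : Decidable (RigidCode I v) :=
  inferInstanceAs (Decidable (_ ∨ _))

/-- Replace the values that are not rigid by the position of their first occurrence. -/
def canonVals (I : Inst) (l : List ℕ) : List ℕ :=
  -- Tag 2 marks positions and is the tag of no value. Tag 3 is reserved for the fresh variables of
  -- method bodies.
  l.map fun v => if RigidCode I v then v else Nat.pair 2 (l.idxOf v)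

/-- Replace the tokens of values that are not rigid by the position of their first occurrence. -/
def canonToks (I : Inst) (l : List ℕ) : List ℕ :=
  l.map fun t => if t % 2 = 1 ∨ RigidCode I (t / 2) then t else 2 * Nat.pair 2 (l.idxOf t)

/-- The value of the reference `r.unpair.2` under `r.unpair.1` binders. -/
def resolve (a : ℕ) (E : Env) (r : ℕ) : Option ℕ :=
  if r.unpair.2.unpair.1 = 0 then
    if r.unpair.2.unpair.2 < r.unpair.1 then none else E.1[r.unpair.2.unpair.2 - r.unpair.1]?
  else if r.unpair.2.unpair.1 = 1 then some (Nat.pair 1 a)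
  else if r.unpair.2.unpair.1 = 2 then
    some (if r.unpair.2.unpair.2.unpair.1 = 0 then
      -- For a variable that is not a parameter the index is the number of parameters, out of range
      -- for the arguments, so the default applies. Its tag is 0 for processes of the source
      -- configuration, whose variables stand for themselves, and 3 for method bodies, whose other
      -- variables become fresh.
      (E.2.1.1[E.2.1.2.idxOf r.unpair.2.unpair.2.unpair.2]?).getD
        (Nat.pair E.2.2 r.unpair.2.unpair.2.unpair.2)
      else r.unpair.2.unpair.2)
  else none

/-- The token with its reference resolved. -/
def resolveTok (a : ℕ) (E : Env) (t : ℕ) : ℕ :=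
  if t % 2 = 0 then
    -- Resolved values stay even. Unresolved references and operators become `2 * u + 1` with `u`
    -- even and odd respectively, so they are not confused.
    ((resolve a E (t / 2)).map fun v => 2 * v).getD (2 * (2 * (t / 2).unpair.2) + 1)
  else 2 * t + 1

/-- The first unused name of class `C`. -/
def freshCode (C : ℕ) (D : List ℕ) : ℕ :=
  Nat.pair C (((List.range (D.length + 1)).filterMap fun i =>
    if Nat.pair C i + 1 ∈ D then none else some i).headD 0) + 1

/-- Execute one token on a stack of values, `D` being the actors created so far. -/
def evalTok (I : Inst) (a : ℕ) (E : Env) (s : List ℕ × List ℕ) (t : ℕ) :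
    Option (List ℕ × List ℕ) :=
  if t % 2 = 0 then (resolve a E (t / 2)).map fun v => (v :: s.1, s.2)
  else if (t / 2).unpair.1 = 0 then
    ((I.stateOf a).bind fun φ => φ.lookup (t / 2).unpair.2).map fun v => (v :: s.1, s.2)
  else if (t / 2).unpair.1 = 1 then
    -- A creation is possible only if the target has this actor with this very state; other
    -- creations can never lead to the target, since actors and their states persist.
    if (I.stateOf (freshCode (t / 2).unpair.2.unpair.1 s.2)).map
          (fun φ => (φ.map Prod.fst, φ.map Prod.snd)) =
        some (I.fields (t / 2).unpair.2.unpair.1, (s.1.take (t / 2).unpair.2.unpair.2).reverse) then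
      some (Nat.pair 1 (freshCode (t / 2).unpair.2.unpair.1 s.2) ::
          s.1.drop (t / 2).unpair.2.unpair.2,
        freshCode (t / 2).unpair.2.unpair.1 s.2 :: s.2)
    else none
  else none

def evalToks (I : Inst) (a : ℕ) (E : Env) (D : List ℕ) (ts : List ℕ) :
    Option (List ℕ × List ℕ) :=
  ts.foldl (fun o t => o.bind fun s => evalTok I a E s t) (some ([], D))

/-- Forget the environment of a terminated process. -/
def norm (q : Ctrl) : Ctrl := if q.1 = 0 then (0, ([], ([], []), 0), q.2.2) else q

/-- Tags 2 to 5 are those of `let`, send, conditional and sum; an update (tag 1) has no transition,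
the program being read-only. Abstract values are compared directly, which is correct as they are
interpreted injectively. A receiver is only required to occur in the target; that it already exists
follows from the relation between nets and configurations. -/
def tauAt (I : Inst) (a : ℕ) (q : Ctrl) : List (Ctrl × Option (ℕ × Letter)) :=
  if q.1.unpair.1 = 2 then
    (evalToks I a q.2.1 q.2.2 (expToks 0 false q.1.unpair.2.unpair.1).1).toList.map fun r =>
      (norm (q.1.unpair.2.unpair.2, (r.1.headD 0 :: q.2.1.1, q.2.1.2), r.2), none)
  else if q.1.unpair.1 = 3 then
    if ((resolve a q.2.1 (Nat.pair 0 q.1.unpair.2.unpair.1)).getD 0).unpair.1 = 1 ∧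
        ((resolve a q.2.1 (Nat.pair 0 q.1.unpair.2.unpair.1)).getD 0).unpair.2 ∈ I.names then
      (evalToks I a q.2.1 q.2.2
          (expToks 0 true q.1.unpair.2.unpair.2.unpair.2.unpair.1).1).toList.map fun r =>
        (norm (q.1.unpair.2.unpair.2.unpair.2.unpair.2, q.2.1, r.2),
          some (I.names.idxOf
            ((resolve a q.2.1 (Nat.pair 0 q.1.unpair.2.unpair.1)).getD 0).unpair.2,
            (q.1.unpair.2.unpair.2.unpair.1, canonVals I r.1.reverse)))
    else []
  else if q.1.unpair.1 = 4 then
    (evalToks I a q.2.1 q.2.2 ((expToks 0 false q.1.unpair.2.unpair.1).1 ++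
        (expToks 0 false q.1.unpair.2.unpair.2.unpair.1).1)).toList.map fun r =>
      (norm (if r.1[0]? = r.1[1]? then q.1.unpair.2.unpair.2.unpair.2.unpair.1
        else q.1.unpair.2.unpair.2.unpair.2.unpair.2, q.2.1, r.2), none)
  else if q.1.unpair.1 = 5 then
    [(norm (q.1.unpair.2.unpair.1, q.2), none), (norm (q.1.unpair.2.unpair.2, q.2), none)]
  else []

/-- Code 0 is the root, which has no methods. The list of created actors starts empty: it is
maintained for the root only, because no other actor creates any. -/
def instAt (I : Inst) (a : ℕ) (x : Letter) : List Ctrl :=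
  I.methods.filterMap fun d =>
    if a ≠ 0 ∧ d.1 = (a - 1).unpair.1 ∧ d.2.1 = x.1 ∧ x.2.length = d.2.2.1.length then
      some (norm (d.2.2.2, ([], (x.2, d.2.2.1), 3), []))
    else none

/-- The tokens of the process of the actor with index `i` in the target. -/
def targetToks (I : Inst) (i : ℕ) : List ℕ :=
  (procToks 0 (((I.tgt[i]?).map fun t : ℕ × CellCode => t.2.1).getD 0)).map
    (resolveTok (I.nameOf i) ([], ([], []), 0))

/-- The first condition concerns the instance and not the control: a source whose states disagree
with the target must have no accepting run. The second is similarity with the target process. The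
third makes sure, at the root, that every actor of the target exists. -/
def goalAt (I : Inst) (i : ℕ) (q : Ctrl) : Prop :=
  (∀ t ∈ I.source, I.stateOf t.1 = some t.2.2.1) ∧
  canonToks I (targetToks I i) =
    canonToks I ((procToks 0 q.1).map (resolveTok (I.nameOf i) q.2.1)) ∧
  (I.nameOf i = 0 → ∀ a ∈ I.names, a ∈ q.2.2)

instance (I : Inst) (i : ℕ) (q : Ctrl) : Decidable (goalAt I i q) :=
  inferInstanceAs (Decidable (_ ∧ _ ∧ _))

def letters (I : Inst) (q : List (ℕ × List ℕ)) : List Letter :=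
  q.map fun x => (x.1, canonVals I x.2)

/-- The net of an instance. -/
def net (I : Inst) : Net Ctrl Letter where
  size := I.tgt.length
  tau i q := tauAt I (I.nameOf i) q
  inst i x := instAt I (I.nameOf i) x
  idle := (0, ([], ([], []), 0), [])
  goal i q := decide (goalAt I i q)
  target i := letters I (((I.tgt[i]?).map fun t => t.2.2.2).getD [])

/-- The initial configuration of the net of an instance. -/
def netInit (I : Inst) (i : ℕ) : Ctrl × List Letter :=
  ((I.source.lookup (I.nameOf i)).map fun c =>
    (norm (c.1, ([], ([], []), 0), if I.nameOf i = 0 then I.source.map Prod.fst else []),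
      letters I c.2.2)).getD ((0, ([], ([], []), 0), []), [])

/-! ### Primitive recursion -/

section Prim

variable {α : Type} [Primcodable α]

theorem prim_names : Primrec fun I : Inst => I.names :=
  list_map (snd.comp snd) (fst.comp snd)

theorem prim_nameOf {I : α → Inst} {i : α → ℕ} (hI : Primrec I) (hi : Primrec i) :
    Primrec fun x => (I x).nameOf (i x) :=
  option_getD.comp (list_getElem?.comp (prim_names.comp hI) hi) (const 0)

theorem prim_fields {I : α → Inst} {C : α → ℕ} (hI : Primrec I) (hC : Primrec C) :
    Primrec fun x => (I x).fields (C x) :=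
  option_getD.comp (listLookup.comp hC (fst.comp (snd.comp (fst.comp hI)))) (const [])

theorem prim_stateOf {I : α → Inst} {a : α → ℕ} (hI : Primrec I) (ha : Primrec a) :
    Primrec fun x => (I x).stateOf (a x) :=
  option_map (listLookup.comp ha (snd.comp (snd.comp hI))) (fst.comp (snd.comp snd))

theorem prim_tokVal : Primrec tokVal := by
  have h2 : Primrec fun t : ℕ => (t / 2).unpair.2 := prim_unpair₂ (nat_div.comp .id (const 2))
  exact Primrec.ite ((prim_natEq (nat_mod.comp .id (const 2)) 0).and (prim_natEq (prim_unpair₁ h2) 2))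
    (prim_unpair₂ h2) (const _)

theorem prim_rigidCode {I : α → Inst} {v : α → ℕ} (hI : Primrec I) (hv : Primrec v) :
    PrimrecPred fun x => RigidCode (I x) (v x) := by
  have h1 : Primrec fun x => (procToks 0 (I x).main).map tokVal :=
    list_map (prim_procToks.comp ((const 0).pair (fst.comp (fst.comp hI)))) (prim_tokVal.comp snd)
  exact (prim_natEq (prim_unpair₁ hv) 1).or ((prim_natEq (prim_unpair₁ hv) 0).and (.mem' hv h1))

theorem prim_canonVals {I : α → Inst} {l : α → List ℕ} (hI : Primrec I) (hl : Primrec l) :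
    Primrec fun x => canonVals (I x) (l x) :=
  list_map hl (Primrec.ite (prim_rigidCode (hI.comp fst) snd) snd
    (Primrec₂.natPair.comp (const 2) (list_idxOf.comp snd (hl.comp fst))))

theorem prim_canonToks {I : α → Inst} {l : α → List ℕ} (hI : Primrec I) (hl : Primrec l) :
    Primrec fun x => canonToks (I x) (l x) := by
  have h1 : PrimrecPred fun p : α × ℕ => p.2 % 2 = 1 ∨ RigidCode (I p.1) (p.2 / 2) :=
    (prim_natEq (nat_mod.comp snd (const 2)) 1).or
      (prim_rigidCode (hI.comp fst) (nat_div.comp snd (const 2)))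
  exact list_map hl (Primrec.ite h1 snd (prim_ref (const 2) (list_idxOf.comp snd (hl.comp fst))))

theorem prim_resolve {a : α → ℕ} {E : α → Env} {r : α → ℕ} (ha : Primrec a) (hE : Primrec E)
    (hr : Primrec r) : Primrec fun x => resolve (a x) (E x) (r x) := by
  have h1 := prim_unpair₁ hr
  have h21 := prim_unpair₁ (prim_unpair₂ hr)
  have h22 := prim_unpair₂ (prim_unpair₂ hr)
  have h221 := prim_unpair₁ h22
  have h222 := prim_unpair₂ h22
  refine Primrec.ite (prim_natEq h21 0) (Primrec.ite (nat_lt.comp h22 h1) (const none) ?_)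
    (Primrec.ite (prim_natEq h21 1) ?_ (Primrec.ite (prim_natEq h21 2) ?_ (const none)))
  · exact list_getElem?.comp (fst.comp hE) (nat_sub.comp h22 h1)
  · exact option_some.comp (Primrec₂.natPair.comp (const 1) ha)
  · refine option_some.comp (Primrec.ite (prim_natEq h221 0) ?_ h22)
    have h3 : Primrec fun x => (E x).2.1 := fst.comp (snd.comp hE)
    exact option_getD.comp (list_getElem?.comp (fst.comp h3) (list_idxOf.comp h222 (snd.comp h3)))
      (Primrec₂.natPair.comp (snd.comp (snd.comp hE)) h222)

theorem prim_resolveTok {a : α → ℕ} {E : α → Env} {t : α → ℕ} (ha : Primrec a) (hE : Primrec E)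
    (ht : Primrec t) : Primrec fun x => resolveTok (a x) (E x) (t x) := by
  have h1 : Primrec fun x => t x / 2 := nat_div.comp ht (const 2)
  exact Primrec.ite (prim_natEq (nat_mod.comp ht (const 2)) 0)
    (option_getD.comp (option_map (prim_resolve ha hE h1) (nat_double.comp snd))
      (nat_double_succ.comp (nat_double.comp (prim_unpair₂ h1)))) (nat_double_succ.comp ht)

theorem prim_freshCode {C : α → ℕ} {D : α → List ℕ} (hC : Primrec C) (hD : Primrec D) :
    Primrec fun x => freshCode (C x) (D x) := by
  have h1 : Primrec fun x => (List.range ((D x).length + 1)).filterMap fun i =>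
      if Nat.pair (C x) i + 1 ∈ D x then none else some i :=
    listFilterMap (list_range.comp (succ.comp (list_length.comp hD)))
      (Primrec.ite (.mem' (succ.comp (Primrec₂.natPair.comp (hC.comp fst) snd)) (hD.comp fst))
        (const none) (option_some.comp snd))
  refine succ.comp (Primrec₂.natPair.comp hC ((option_getD.comp (list_head?.comp h1) (const 0)).of_eq
    fun x => ?_))
  simp [List.head?_eq_getElem?, List.headD_eq_head?_getD]

theorem prim_evalTok {I : α → Inst} {a : α → ℕ} {E : α → Env} {s : α → List ℕ × List ℕ} {t : α → ℕ}
    (hI : Primrec I) (ha : Primrec a) (hE : Primrec E) (hs : Primrec s) (ht : Primrec t) :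
    Primrec fun x => evalTok (I x) (a x) (E x) (s x) (t x) := by
  have h0 : Primrec fun x => t x / 2 := nat_div.comp ht (const 2)
  have h1 := prim_unpair₁ h0
  have h2 := prim_unpair₂ h0
  have h21 := prim_unpair₁ h2
  have h22 := prim_unpair₂ h2
  have hf : Primrec fun x => freshCode (t x / 2).unpair.2.unpair.1 (s x).2 :=
    prim_freshCode h21 (snd.comp hs)
  have push : Primrec fun p : α × ℕ => (p.2 :: (s p.1).1, (s p.1).2) :=
    (list_cons.comp snd (fst.comp (hs.comp fst))).pair (snd.comp (hs.comp fst))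
  refine Primrec.ite (prim_natEq (nat_mod.comp ht (const 2)) 0)
    (option_map (prim_resolve ha hE h0) push) (Primrec.ite (prim_natEq h1 0)
      (option_map (option_bind (prim_stateOf hI ha) (listLookup.comp (h2.comp fst) snd)) push)
      (Primrec.ite (prim_natEq h1 1) (Primrec.ite (.eq' ?_ ?_) ?_ (const none)) (const none)))
  · exact option_map (prim_stateOf hI hf)
      ((list_map snd (fst.comp snd).to₂).pair (list_map snd (snd.comp snd).to₂)).to₂
  · exact option_some.comp ((prim_fields hI h21).pair
      (list_reverse.comp (list_take.comp h22 (fst.comp hs))))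
  · exact option_some.comp ((list_cons.comp (Primrec₂.natPair.comp (const 1) hf)
      (list_drop.comp h22 (fst.comp hs))).pair (list_cons.comp hf (snd.comp hs)))

theorem prim_evalToks {I : α → Inst} {a : α → ℕ} {E : α → Env} {D ts : α → List ℕ}
    (hI : Primrec I) (ha : Primrec a) (hE : Primrec E) (hD : Primrec D) (ht : Primrec ts) :
    Primrec fun x => evalToks (I x) (a x) (E x) (D x) (ts x) :=
  list_foldl ht (option_some.comp ((const []).pair hD))
    (option_bind (fst.comp snd)
      (prim_evalTok (hI.comp (fst.comp fst)) (ha.comp (fst.comp fst)) (hE.comp (fst.comp fst)) snd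
        (snd.comp (snd.comp fst))).to₂).to₂

theorem prim_norm : Primrec norm :=
  Primrec.ite (prim_natEq fst 0) ((const 0).pair ((const _).pair (snd.comp snd))) .id

theorem prim_tauAt {I : α → Inst} {a : α → ℕ} {q : α → Ctrl} (hI : Primrec I) (ha : Primrec a)
    (hq : Primrec q) : Primrec fun x => tauAt (I x) (a x) (q x) := by
  have h := fst.comp hq
  have hE := fst.comp (snd.comp hq)
  have hD := snd.comp (snd.comp hq)
  have h1 := prim_unpair₁ h
  have h2 := prim_unpair₂ h
  have h21 := prim_unpair₁ h2
  have h22 := prim_unpair₂ h2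
  have h221 := prim_unpair₁ h22
  have h222 := prim_unpair₂ h22
  have h2221 := prim_unpair₁ h222
  have h2222 := prim_unpair₂ h222
  have hv : Primrec fun x => (resolve (a x) (q x).2.1 (Nat.pair 0 (q x).1.unpair.2.unpair.1)).getD 0 :=
    option_getD.comp (prim_resolve ha hE (Primrec₂.natPair.comp (const 0) h21)) (const 0)
  have hn := prim_names.comp hI
  have e : ∀ (b : Bool) {f : α → ℕ}, Primrec f → Primrec fun x => (expToks 0 b (f x)).1 :=
    fun b f hf => fst.comp (prim_expToks.comp ((const 0).pair ((const b).pair hf)))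
  have ev : ∀ {f : α → List ℕ}, Primrec f →
      Primrec fun x => (evalToks (I x) (a x) (q x).2.1 (q x).2.2 (f x)).toList :=
    fun hf => optionToList.comp (prim_evalToks hI ha hE hD hf)
  have hD' : Primrec fun p : α × List ℕ × List ℕ => p.2.2 := snd.comp snd
  have hE' : Primrec fun p : α × List ℕ × List ℕ => (q p.1).2.1 := hE.comp fst
  refine Primrec.ite (prim_natEq h1 2) (list_map (ev (e false h21)) ?_)
    (Primrec.ite (prim_natEq h1 3) (Primrec.ite ((prim_natEq (prim_unpair₁ hv) 1).and
      (.mem' (prim_unpair₂ hv) hn)) (list_map (ev (e true h2221)) ?_) (const []))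
    (Primrec.ite (prim_natEq h1 4) (list_map (ev (list_append.comp (e false h21) (e false h221))) ?_)
    (Primrec.ite (prim_natEq h1 5) ?_ (const []))))
  · have hu : Primrec fun p : α × List ℕ × List ℕ => p.2.1.headD 0 :=
      (option_getD.comp (list_head?.comp (fst.comp snd)) (const 0)).of_eq fun p => by
        simp [List.headD_eq_head?_getD]
    exact ((prim_norm.comp ((h22.comp fst).pair (((list_cons.comp hu (fst.comp hE')).pair
      (snd.comp hE')).pair hD'))).pair (const none)).to₂
  · exact ((prim_norm.comp ((h2222.comp fst).pair (hE'.pair hD'))).pair (option_some.comp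
      ((list_idxOf.comp (prim_unpair₂ (hv.comp fst)) (hn.comp fst)).pair ((h221.comp fst).pair
      (prim_canonVals (hI.comp fst) (list_reverse.comp (fst.comp snd))))))).to₂
  · have hc : Primrec fun p : α × List ℕ × List ℕ => if p.2.1[0]? = p.2.1[1]? then
        (q p.1).1.unpair.2.unpair.2.unpair.2.unpair.1
        else (q p.1).1.unpair.2.unpair.2.unpair.2.unpair.2 :=
      Primrec.ite (.eq' (list_getElem?.comp (fst.comp snd) (const 0))
        (list_getElem?.comp (fst.comp snd) (const 1))) (h2221.comp fst) (h2222.comp fst)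
    exact ((prim_norm.comp (hc.pair (hE'.pair hD'))).pair (const none)).to₂
  · exact list_cons.comp ((prim_norm.comp (h21.pair (snd.comp hq))).pair (const none))
      (list_cons.comp ((prim_norm.comp (h22.pair (snd.comp hq))).pair (const none)) (const []))

theorem prim_instAt {I : α → Inst} {a : α → ℕ} {x : α → Letter} (hI : Primrec I) (ha : Primrec a)
    (hx : Primrec x) : Primrec fun z => instAt (I z) (a z) (x z) := by
  let M := ℕ × ℕ × List ℕ × ℕ
  have hd : Primrec fun p : α × M => p.2 := snd
  have hx' : Primrec fun p : α × M => x p.1 := hx.comp fst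
  have ha' : Primrec fun p : α × M => a p.1 := ha.comp fst
  have hps : Primrec fun p : α × M => p.2.2.2.1 := fst.comp (snd.comp (snd.comp hd))
  refine listFilterMap (snd.comp (snd.comp (fst.comp hI))) (Primrec.ite
    ((prim_natEq ha' 0).not.and ((PrimrecPred.eq' (fst.comp hd)
      (prim_unpair₁ (nat_sub.comp ha' (const 1)))).and ((PrimrecPred.eq' (fst.comp (snd.comp hd))
      (fst.comp hx')).and (.eq' (list_length.comp (snd.comp hx')) (list_length.comp hps)))))
    (option_some.comp (prim_norm.comp ((snd.comp (snd.comp (snd.comp hd))).pair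
      (((const []).pair (((snd.comp hx').pair hps).pair (const 3))).pair (const [])))))
    (const none)).to₂

theorem prim_letters {I : α → Inst} {q : α → List (ℕ × List ℕ)} (hI : Primrec I) (hq : Primrec q) :
    Primrec fun x => letters (I x) (q x) :=
  list_map hq ((fst.comp snd).pair (prim_canonVals (hI.comp fst) (snd.comp snd))).to₂

theorem prim_goalAt {I : α → Inst} {i : α → ℕ} {q : α → Ctrl} (hI : Primrec I) (hi : Primrec i)
    (hq : Primrec q) : PrimrecPred fun x => goalAt (I x) (i x) (q x) := by
  have hn := prim_nameOf hI hi
  have htok : ∀ {c : α → ℕ} {E : α → Env}, Primrec c → Primrec E → Primrec fun x =>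
      (procToks 0 (c x)).map (resolveTok ((I x).nameOf (i x)) (E x)) := fun hc hE =>
    list_map (prim_procToks.comp ((const 0).pair hc))
      (prim_resolveTok (hn.comp fst) (hE.comp fst) snd).to₂
  have ht : Primrec fun x => targetToks (I x) (i x) :=
    htok (option_getD.comp (option_map (list_getElem?.comp (snd.comp (snd.comp hI)) hi)
      (fst.comp (snd.comp snd)).to₂) (const 0)) (const _)
  refine (PrimrecPred.forall_mem (fst.comp (snd.comp hI)) ?_).and ((PrimrecPred.eq'
    (prim_canonToks hI ht) (prim_canonToks hI (htok (fst.comp hq) (fst.comp (snd.comp hq))))).and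
    ((prim_natEq hn 0).imp (.forall_mem (prim_names.comp hI)
      (.mem' snd (snd.comp (snd.comp (hq.comp fst)))))))
  exact .eq' (prim_stateOf (hI.comp fst) (fst.comp snd))
    (option_some.comp (fst.comp (snd.comp (snd.comp snd))))

theorem isPrim_net : Net.IsPrim net where
  size := list_length.comp (snd.comp snd)
  tau := prim_tauAt fst (prim_nameOf fst (fst.comp snd)) (snd.comp snd)
  inst := prim_instAt fst (prim_nameOf fst (fst.comp snd)) (snd.comp snd)
  idle := const _
  goal := (prim_goalAt fst (fst.comp snd) (snd.comp snd)).decide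
  target := prim_letters fst (option_getD.comp (option_map (list_getElem?.comp
    (snd.comp (snd.comp fst)) snd) (snd.comp (snd.comp (snd.comp snd))).to₂) (const []))

theorem prim_netInit : Primrec₂ netInit := by
  have hn : Primrec fun p : Inst × ℕ => p.1.nameOf p.2 := prim_nameOf fst snd
  have hs : Primrec fun p : Inst × ℕ => p.1.source := fst.comp (snd.comp fst)
  have hD : Primrec fun p : Inst × ℕ => if p.1.nameOf p.2 = 0 then p.1.source.map Prod.fst else [] :=
    Primrec.ite (prim_natEq hn 0) (list_map hs (fst.comp snd).to₂) (const [])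
  exact option_getD.comp (option_map (listLookup.comp hn hs)
    (((prim_norm.comp ((fst.comp snd).pair ((const _).pair (hD.comp fst)))).pair
      (prim_letters (fst.comp fst) (snd.comp (snd.comp snd)))).to₂)) (const _)

/-- The decoding of an instance. -/
def parse (n : ℕ) : Inst :=
  let t := (Encodable.decode (α := ℕ × ℕ × ℕ) n).getD (0, 0, 0)
  let p := (Encodable.decode (α := ℕ × List (ℕ × List ℕ) × List ℕ) t.1).getD (0, [], [])
  let conf : ℕ → ConfCode := fun c => ((Encodable.decode (α := List (ℕ × ℕ)) c).getD []).map fun x =>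
    (x.1, (Encodable.decode (α := CellCode) x.2).getD (0, [], []))
  ((p.1, p.2.1, p.2.2.map fun d => (Encodable.decode d).getD (0, 0, [], 0)), conf t.2.1, conf t.2.2)

theorem prim_parse : Primrec parse := by
  have ht : Primrec fun n => (Encodable.decode (α := ℕ × ℕ × ℕ) n).getD (0, 0, 0) :=
    option_getD.comp Primrec.decode (const _)
  have hp : Primrec fun n => (Encodable.decode (α := ℕ × List (ℕ × List ℕ) × List ℕ) n).getD
      (0, [], []) := option_getD.comp Primrec.decode (const _)
  have hp' := hp.comp (fst.comp ht)
  have hc : Primrec fun c => ((Encodable.decode (α := List (ℕ × ℕ)) c).getD []).map fun x =>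
      (x.1, (Encodable.decode (α := CellCode) x.2).getD (0, [], [])) :=
    list_map (option_getD.comp Primrec.decode (const _)) ((fst.comp snd).pair
      (option_getD.comp (Primrec.decode.comp (snd.comp snd)) (const _))).to₂
  exact ((fst.comp hp').pair ((fst.comp (snd.comp hp')).pair (list_map (snd.comp (snd.comp hp'))
    (option_getD.comp (Primrec.decode.comp snd) (const _)).to₂))).pair
    ((hc.comp (fst.comp (snd.comp ht))).pair (hc.comp (snd.comp (snd.comp ht))))

end Prim

/-! ### Finiteness of the net of an instance -/

/-- Both components of the value are at most `M`. -/
def Small (M v : ℕ) : Prop := v.unpair.1 ≤ M ∧ v.unpair.2 ≤ M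

theorem Small.of_le {M v : ℕ} (h : v ≤ M) : Small M v :=
  ⟨(Nat.unpair_left_le v).trans h, (Nat.unpair_right_le v).trans h⟩

theorem Small.pair {M a b : ℕ} (ha : a ≤ M) (hb : b ≤ M) : Small M (Nat.pair a b) := by
  simpa [Small] using ⟨ha, hb⟩

/-- Neither the length of the environment nor the created actors are bounded here. Finiteness of the
controls comes from the decrease of the process code, and these bounds serve to keep the alphabet of
letters finite. -/
structure CtrlBound (M : ℕ) (q : Ctrl) : Prop where
  code : q.1 ≤ M
  bound : ∀ v ∈ q.2.1.1, Small M v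
  args : ∀ v ∈ q.2.1.2.1.1, Small M v
  tag : q.2.1.2.2 ≤ M

structure LetterBound (M : ℕ) (x : Letter) : Prop where
  name : x.1 ≤ M
  length : x.2.length ≤ M + 1
  vals : ∀ v ∈ x.2, Small M v

structure InstBound (M : ℕ) (I : Inst) : Prop where
  -- The largest tag of an abstract value is 3.
  three : 3 ≤ M
  name : ∀ t ∈ I.tgt, t.1 ≤ M
  state : ∀ t ∈ I.tgt, ∀ b ∈ t.2.2.1, Small M b.2
  body : ∀ d ∈ I.methods, d.2.2.2 ≤ M
  proc : ∀ t ∈ I.source, t.2.1 ≤ M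
  queue : ∀ t ∈ I.source, ∀ x ∈ t.2.2.2, LetterBound M x

theorem eventually_forall_mem {α : Type*} {P : α → ℕ → Prop} (l : List α)
    (h : ∀ x ∈ l, ∀ᶠ M in Filter.atTop, P x M) : ∀ᶠ M in Filter.atTop, ∀ x ∈ l, P x M := by
  classical
  simpa using (Filter.eventually_all_finset (p := fun x M => P x M) (l := Filter.atTop)
    l.toFinset).2 (by simpa using h)

theorem eventually_small (v : ℕ) : ∀ᶠ M in Filter.atTop, Small M v :=
  (Filter.eventually_ge_atTop _).and (Filter.eventually_ge_atTop _)

theorem exists_instBound (I : Inst) : ∃ M, InstBound M I := by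
  have h1 := eventually_forall_mem (P := fun t M => t.1 ≤ M) I.tgt
    fun t _ => Filter.eventually_ge_atTop _
  have h2 := eventually_forall_mem (P := fun t M => ∀ b ∈ t.2.2.1, Small M b.2) I.tgt
    fun t _ => eventually_forall_mem _ fun b _ => eventually_small _
  have h3 := eventually_forall_mem (P := fun d M => d.2.2.2 ≤ M) I.methods
    fun t _ => Filter.eventually_ge_atTop _
  have h4 := eventually_forall_mem (P := fun t M => t.2.1 ≤ M) I.source
    fun t _ => Filter.eventually_ge_atTop _
  have h5 := eventually_forall_mem (P := fun t M => ∀ x ∈ t.2.2.2, LetterBound M x) I.source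
    fun t _ => eventually_forall_mem _ fun x _ => by
      filter_upwards [Filter.eventually_ge_atTop x.1, Filter.eventually_ge_atTop x.2.length,
        eventually_forall_mem (P := fun v M => Small M v) x.2 fun v _ => eventually_small v]
        with M a b c using ⟨a, by omega, c⟩
  obtain ⟨M, h⟩ := (((h1.and h2).and (h3.and h4)).and
    (h5.and (Filter.eventually_ge_atTop 3))).exists
  exact ⟨M, h.2.2, h.1.1.1, h.1.1.2, h.1.2.1, h.1.2.2, h.2.1⟩

/-- Bounds the number of arguments of a message that a process of given code can send. -/
theorem expToks_length_le (k : ℕ) (b : Bool) (c : ℕ) : (expToks k b c).1.length ≤ c + 1 := by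
  induction c using Nat.strong_induction_on generalizing b with
  | _ c ih =>
    rw [expToks]
    split_ifs with h1 h2 h3 h4 h5
    · simp
    · have e := Nat.add_le_pair (c - 1).unpair.1 (c - 1).unpair.2
      rw [Nat.pair_unpair] at e
      have := ih (c - 1).unpair.1 (by omega) false
      have := ih (c - 1).unpair.2 (by omega) true
      simp only [List.length_append]
      omega
    · simp
    · simp
    · have e1 := unpair_snd_lt (c := c) (by omega)
      have e2 := Nat.unpair_right_le c.unpair.2
      have := ih c.unpair.2.unpair.2 (by omega) true
      simp only [List.length_append, List.length_singleton]
      omega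
    · simp

theorem expToks_mem_le (k : ℕ) (b : Bool) (c : ℕ) :
    ∀ t ∈ (expToks k b c).1, t % 2 = 0 → (t / 2).unpair.2 ≤ c := by
  induction c using Nat.strong_induction_on generalizing b with
  | _ c ih =>
    rw [expToks]
    have e1 := Nat.unpair_left_le (c - 1)
    have e2 := Nat.unpair_right_le (c - 1)
    have e3 := unpair_snd_lt (c := c)
    have e4 := Nat.unpair_right_le c.unpair.2
    have e5 := Nat.unpair_right_le c
    split_ifs with h1 h2 h3 h4 h5 <;> intro t ht hp
    · simp at ht
    · rcases List.mem_append.1 ht with ht | ht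
      · exact (ih _ (by omega) false t ht hp).trans (by omega)
      · exact (ih _ (by omega) true t ht hp).trans (by omega)
    · simp only [List.mem_singleton] at ht; omega
    · simp only [List.mem_singleton] at ht
      subst ht
      simpa using e5
    · rcases List.mem_append.1 ht with ht | ht
      · exact (ih _ (by omega) true t ht hp).trans (by omega)
      · simp only [List.mem_singleton] at ht; omega
    · simp at ht

theorem resolve_small {M a : ℕ} {q : Ctrl} (hq : CtrlBound M q) (ha : a ≤ M) (h3 : 3 ≤ M) {r v : ℕ}
    (hr : r.unpair.2 ≤ M) (h : resolve a q.2.1 r = some v) : Small M v := by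
  have e1 := Nat.unpair_right_le r.unpair.2
  have e2 := Nat.unpair_right_le r.unpair.2.unpair.2
  unfold resolve at h
  split_ifs at h with h1 h2 h3 h4 h5
  · exact hq.bound v (List.mem_of_getElem? h)
  · cases h; exact Small.pair (by omega) ha
  · cases h
    cases h6 : q.2.1.2.1.1[q.2.1.2.1.2.idxOf r.unpair.2.unpair.2.unpair.2]? with
    | none => exact Small.pair hq.tag (by omega)
    | some w => exact hq.args w (List.mem_of_getElem? h6)
  · cases h; exact .of_le (by omega)

theorem lookup_mem {α β : Type*} [DecidableEq α] {l : List (α × β)} {a : α} {b : β}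
    (h : l.lookup a = some b) : (a, b) ∈ l := by
  induction l with
  | nil => simp at h
  | cons x l ih =>
    obtain ⟨a', b'⟩ := x
    by_cases e : a = a'
    · subst e; simp at h; simp [h]
    · rw [List.lookup_cons, show (a == a') = false by simpa using e] at h
      exact List.mem_cons_of_mem _ (ih h)

theorem stateOf_bound {M : ℕ} {I : Inst} (hI : InstBound M I) {a : ℕ} {φ : List (ℕ × ℕ)}
    (h : I.stateOf a = some φ) : a ≤ M ∧ ∀ b ∈ φ, Small M b.2 := by
  simp only [Inst.stateOf, Option.map_eq_some_iff] at h
  obtain ⟨c, hc, rfl⟩ := h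
  exact ⟨hI.name _ (lookup_mem hc), hI.state _ (lookup_mem hc)⟩

theorem evalTok_small {M a : ℕ} {I : Inst} (hI : InstBound M I) {q : Ctrl} (hq : CtrlBound M q)
    (ha : a ≤ M) {t : ℕ} (ht : t % 2 = 0 → (t / 2).unpair.2 ≤ M) {s s' : List ℕ × List ℕ}
    (hs : ∀ v ∈ s.1, Small M v) (h : evalTok I a q.2.1 s t = some s') :
    (∀ v ∈ s'.1, Small M v) ∧ s'.1.length ≤ s.1.length + 1 := by
  unfold evalTok at h
  split_ifs at h with h1 h2 h3 h4
  · simp only [Option.map_eq_some_iff] at h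
    obtain ⟨v, hv, rfl⟩ := h
    refine ⟨?_, by simp⟩
    simp only [List.mem_cons, forall_eq_or_imp]
    exact ⟨resolve_small hq ha hI.three (ht h1) hv, hs⟩
  · simp only [Option.map_eq_some_iff, Option.bind_eq_some_iff] at h
    obtain ⟨v, ⟨φ, hφ, hv⟩, rfl⟩ := h
    refine ⟨?_, by simp⟩
    simp only [List.mem_cons, forall_eq_or_imp]
    exact ⟨(stateOf_bound hI hφ).2 _ (lookup_mem hv), hs⟩
  · cases h
    simp only [Option.map_eq_some_iff] at h4
    obtain ⟨φ, hφ, -⟩ := h4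
    refine ⟨?_, by simp⟩
    simp only [List.mem_cons, forall_eq_or_imp]
    exact ⟨.pair (by linarith [hI.three]) (stateOf_bound hI hφ).1,
      fun v hv => hs v (List.mem_of_mem_drop hv)⟩

theorem evalToks_small {M a : ℕ} {I : Inst} (hI : InstBound M I) {q : Ctrl} (hq : CtrlBound M q)
    (ha : a ≤ M) {D : List ℕ} (ts : List ℕ) (ht : ∀ t ∈ ts, t % 2 = 0 → (t / 2).unpair.2 ≤ M)
    {s : List ℕ × List ℕ} (h : evalToks I a q.2.1 D ts = some s) :
    (∀ v ∈ s.1, Small M v) ∧ s.1.length ≤ ts.length := by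
  induction ts using List.reverseRecOn generalizing s with
  | nil => simp only [evalToks, List.foldl_nil, Option.some.injEq] at h; subst h; simp
  | append_singleton ts t ih =>
    simp only [evalToks, List.foldl_append, List.foldl_cons, List.foldl_nil,
      Option.bind_eq_some_iff] at h
    obtain ⟨s', h1, h2⟩ := h
    obtain ⟨h3, h4⟩ := ih (fun t' ht' => ht t' (by simp [ht'])) h1
    obtain ⟨h5, h6⟩ := evalTok_small hI hq ha (ht t (by simp)) h3 h2
    exact ⟨h5, by simp; omega⟩

theorem canonVals_length (I : Inst) (l : List ℕ) : (canonVals I l).length = l.length := by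
  simp [canonVals]

theorem canonVals_bound {M : ℕ} {I : Inst} (h2 : 3 ≤ M) {l : List ℕ} (hl : ∀ v ∈ l, Small M v)
    (hlen : l.length ≤ M + 1) : ∀ v ∈ canonVals I l, Small M v := by
  intro v hv
  simp only [canonVals, List.mem_map] at hv
  obtain ⟨u, hu, rfl⟩ := hv
  split_ifs
  · exact hl u hu
  · have := List.idxOf_lt_length_of_mem hu
    exact .pair (by omega) (by omega)

theorem norm_fst (q : Ctrl) : (norm q).1 = q.1 := by
  unfold norm; split_ifs with h <;> simp [h]

theorem CtrlBound.norm {M : ℕ} {q : Ctrl} (h : CtrlBound M q) : CtrlBound M (norm q) := by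
  unfold ActorLang.norm
  split_ifs
  · exact ⟨by simp, by simp, by simp, by simp⟩
  · exact h

theorem nameOf_le {M : ℕ} {I : Inst} (hI : InstBound M I) (i : ℕ) : I.nameOf i ≤ M := by
  unfold Inst.nameOf
  cases h : I.names[i]? with
  | none => simp
  | some a =>
    obtain ⟨t, ht, rfl⟩ := List.mem_map.1 (List.mem_of_getElem? h)
    exact hI.name t ht

/-- Each internal step passes to a proper subprocess, whose code is smaller; this bounds the length
of branches. -/
theorem tauAt_spec {M a : ℕ} {I : Inst} (hI : InstBound M I) {q : Ctrl} (hq : CtrlBound M q)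
    (ha : a ≤ M) {u : Ctrl × Option (ℕ × Letter)} (hu : u ∈ tauAt I a q) :
    u.1.1 < q.1 ∧ CtrlBound M u.1 ∧ ∀ e ∈ u.2.toList, LetterBound M e.2 := by
  have k0 := hq.code
  have k1 : q.1.unpair.1 ≠ 0 → q.1.unpair.2 < q.1 := unpair_snd_lt
  have k2 := Nat.unpair_right_le q.1.unpair.2
  have k3 := Nat.unpair_left_le q.1.unpair.2
  have k4 := Nat.unpair_right_le q.1.unpair.2.unpair.2
  have k4' := Nat.unpair_left_le q.1.unpair.2.unpair.2
  have k5 := Nat.unpair_right_le q.1.unpair.2.unpair.2.unpair.2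
  have k6 := Nat.unpair_left_le q.1.unpair.2.unpair.2.unpair.2
  have h3 := hI.three
  unfold tauAt at hu
  split_ifs at hu with h1 h2 h2' h4 h5
  · simp only [List.mem_map, Option.mem_toList] at hu
    obtain ⟨r, hr, rfl⟩ := hu
    dsimp only
    obtain ⟨e1, -⟩ := evalToks_small hI hq ha _ (fun t ht hp =>
      (expToks_mem_le _ _ _ t ht hp).trans (by omega)) hr
    have e7 : q.1.unpair.2.unpair.2 < q.1 := by omega
    have e8 : CtrlBound M (q.1.unpair.2.unpair.2, (r.1.headD 0 :: q.2.1.1, q.2.1.2), r.2) := by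
      refine ⟨e7.le.trans k0, ?_, hq.args, hq.tag⟩
      simp only [List.mem_cons, forall_eq_or_imp]
      refine ⟨?_, hq.bound⟩
      cases h : r.1 with
      | nil => exact .of_le (by simp)
      | cons v l => exact e1 v (by simp [h])
    exact ⟨by rwa [norm_fst], e8.norm, by simp⟩
  · simp only [List.mem_map, Option.mem_toList] at hu
    obtain ⟨r, hr, hr'⟩ := hu
    obtain ⟨e1, e2⟩ := evalToks_small hI hq ha _ (fun t ht hp =>
      (expToks_mem_le _ _ _ t ht hp).trans (by omega)) hr
    have e3 := expToks_length_le 0 true q.1.unpair.2.unpair.2.unpair.2.unpair.1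
    have e4 : r.1.reverse.length ≤ M + 1 := by simp; omega
    have e7 : q.1.unpair.2.unpair.2.unpair.2.unpair.2 < q.1 := by omega
    have e8 : CtrlBound M (q.1.unpair.2.unpair.2.unpair.2.unpair.2, q.2.1, r.2) :=
      ⟨e7.le.trans k0, hq.bound, hq.args, hq.tag⟩
    rw [← hr']
    dsimp only
    refine ⟨by rwa [norm_fst], e8.norm, ?_⟩
    rw [Option.toList_some]
    intro e he
    rw [List.mem_singleton.1 he]
    have e5 : ∀ v ∈ r.1.reverse, Small M v := fun v hv => e1 v (List.mem_reverse.1 hv)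
    have e6 : q.1.unpair.2.unpair.2.unpair.1 ≤ M := by omega
    rw [← canonVals_length I] at e4
    constructor
    · dsimp only; exact e6
    · dsimp only; exact e4
    · dsimp only; exact canonVals_bound h3 e5 (by rwa [canonVals_length] at e4)
  · simp at hu
  · simp only [List.mem_map, Option.mem_toList] at hu
    obtain ⟨r, hr, rfl⟩ := hu
    dsimp only
    have e7 : (if r.1[0]? = r.1[1]? then q.1.unpair.2.unpair.2.unpair.2.unpair.1
        else q.1.unpair.2.unpair.2.unpair.2.unpair.2) < q.1 := by split_ifs <;> omega
    have e8 : CtrlBound M ((if r.1[0]? = r.1[1]? then q.1.unpair.2.unpair.2.unpair.2.unpair.1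
        else q.1.unpair.2.unpair.2.unpair.2.unpair.2), q.2.1, r.2) :=
      ⟨e7.le.trans k0, hq.bound, hq.args, hq.tag⟩
    exact ⟨(norm_fst _).trans_lt e7, e8.norm, by simp⟩
  · simp only [List.mem_cons, List.not_mem_nil, or_false] at hu
    rcases hu with rfl | rfl <;> dsimp only <;>
    exact ⟨by rw [norm_fst]; omega, CtrlBound.norm ⟨by omega, hq.bound,
      hq.args, hq.tag⟩, by simp⟩
  · simp at hu

theorem instAt_bound {M a : ℕ} {I : Inst} (hI : InstBound M I) {x : Letter} (hx : LetterBound M x)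
    {q : Ctrl} (hq : q ∈ instAt I a x) : CtrlBound M q := by
  simp only [instAt, List.mem_filterMap, Option.ite_none_right_eq_some, Option.some.injEq] at hq
  obtain ⟨d, hd, -, rfl⟩ := hq
  exact CtrlBound.norm ⟨hI.body d hd, by simp, hx.vals, hI.three⟩

/-- Induction on the measure: what is reachable from `x` is `x` itself and what is reachable from
its finitely many successors. -/
theorem finite_reachable {α : Type*} (r : α → α → Prop) (f : α → ℕ) (P : α → Prop)
    (hr : ∀ x y, P x → r x y → P y ∧ f y < f x) (hfin : ∀ x, {y | r x y}.Finite) (x : α) (hx : P x) :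
    {y | Relation.ReflTransGen r x y}.Finite := by
  induction hn : f x using Nat.strong_induction_on generalizing x with
  | _ n ih =>
    refine ((Set.finite_singleton x).union ((hfin x).biUnion fun y hy =>
      ih (f y) (hn ▸ (hr x y hx hy).2) y (hr x y hx hy).1 rfl)).subset ?_
    intro z hz
    rcases Relation.ReflTransGen.cases_head hz with rfl | ⟨y, hy, hyz⟩
    · exact Or.inl rfl
    · exact Or.inr (Set.mem_biUnion hy hyz)

theorem finite_letterBound (M : ℕ) : {x : Letter | LetterBound M x}.Finite := by
  have h1 : {v | Small M v}.Finite := by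
    refine (((Set.finite_Iic M).prod (Set.finite_Iic M)).image fun p => Nat.pair p.1 p.2).subset ?_
    intro v hv
    exact ⟨v.unpair, hv, by simp⟩
  have h2 : (⋃ n ∈ Set.Iic (M + 1), {l : List ℕ | l.length = n ∧ ∀ v ∈ l, v ∈ {v | Small M v}}).Finite :=
    (Set.finite_Iic (M + 1)).biUnion fun n _ => Set.Finite.lists h1 n
  refine ((Set.finite_Iic M).prod h2).subset ?_
  rintro ⟨m, l⟩ ⟨h3, h4, h5⟩
  exact ⟨h3, Set.mem_biUnion (x := l.length) h4 ⟨rfl, h5⟩⟩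

theorem net_finite (I : Inst) : ∃ (Q : Finset Ctrl) (A : Finset Letter),
    (∀ j < (net I).size, (netInit I j).1 ∈ Q ∧ ∀ x ∈ (netInit I j).2, x ∈ A) ∧
    (∀ i < (net I).size, ∀ q ∈ Q, ∀ u ∈ (net I).tau i q,
      u.1 ∈ Q ∧ ∀ e ∈ u.2.toList, e.2 ∈ A) ∧
    (∀ i < (net I).size, ∀ x ∈ A, ∀ q ∈ (net I).inst i x, q ∈ Q) := by
  obtain ⟨M, hM⟩ := exists_instBound I
  have hA := finite_letterBound M
  have h0 : CtrlBound M (0, ([], ([], []), 0), []) := ⟨by simp, by simp, by simp, by simp⟩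
  have hinit : ∀ j, CtrlBound M (netInit I j).1 ∧ ∀ x ∈ (netInit I j).2, LetterBound M x := by
    intro j
    unfold netInit
    cases h : I.source.lookup (I.nameOf j) with
    | none => exact ⟨h0, by simp⟩
    | some c =>
      have hm := lookup_mem h
      refine ⟨CtrlBound.norm ⟨hM.proc _ hm, by simp, by simp, by simp⟩, ?_⟩
      intro x hx
      simp only [Option.map_some, Option.getD_some, letters, List.mem_map] at hx
      obtain ⟨y, hy, rfl⟩ := hx
      have hb := hM.queue _ hm y hy
      exact ⟨hb.name, by simpa [canonVals] using hb.length, canonVals_bound hM.three hb.vals hb.length⟩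
  let r : Ctrl → Ctrl → Prop := fun q q' =>
    ∃ i < (net I).size, ∃ em, (q', em) ∈ (net I).tau i q
  have hstep : ∀ x y, CtrlBound M x → r x y → CtrlBound M y ∧ y.1 < x.1 := by
    rintro x y hx ⟨i, -, em, h⟩
    exact ⟨(tauAt_spec hM hx (nameOf_le hM i) h).2.1, (tauAt_spec hM hx (nameOf_le hM i) h).1⟩
  have hfin : ∀ x, {y | r x y}.Finite := by
    intro x
    refine ((Set.finite_lt_nat (net I).size).biUnion fun i _ =>
      ((((net I).tau i x).map Prod.fst).finite_toSet)).subset ?_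
    rintro y ⟨i, hi, em, h⟩
    exact Set.mem_biUnion hi (by simpa using ⟨em, h⟩)
  -- Every control arises by internal steps from an initial one or from the start of a method on a
  -- bounded letter.
  let S : Set Ctrl := (⋃ j ∈ {j | j < (net I).size}, {(netInit I j).1}) ∪
    ⋃ i ∈ {j | j < (net I).size}, ⋃ x ∈ {x | LetterBound M x}, {q | q ∈ (net I).inst i x}
  have hS : S.Finite := ((Set.finite_lt_nat _).biUnion fun _ _ => Set.finite_singleton _).union
    ((Set.finite_lt_nat _).biUnion fun i _ => hA.biUnion fun x _ =>
      (((net I).inst i x).finite_toSet))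
  have hSb : ∀ q ∈ S, CtrlBound M q := by
    intro q hq
    simp only [S, Set.mem_union, Set.mem_iUnion, Set.mem_ofPred_eq, Set.mem_singleton_iff] at hq
    rcases hq with ⟨j, -, rfl⟩ | ⟨i, -, x, hx, hq⟩
    · exact (hinit j).1
    · exact instAt_bound hM hx hq
  have hQ : (⋃ q ∈ S, {q' | Relation.ReflTransGen r q q'}).Finite := hS.biUnion fun q hq =>
    finite_reachable r Prod.fst (CtrlBound M) hstep hfin q (hSb q hq)
  have hQb : ∀ q ∈ ⋃ q ∈ S, {q' | Relation.ReflTransGen r q q'}, CtrlBound M q := by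
    intro q hq
    simp only [Set.mem_iUnion, Set.mem_ofPred_eq] at hq
    obtain ⟨q0, h0, h⟩ := hq
    induction h with
    | refl => exact hSb _ h0
    | tail _ h ih => exact (hstep _ _ ih h).1
  refine ⟨hQ.toFinset, hA.toFinset, fun j hj => ⟨?_, fun x hx => ?_⟩, fun i hi q hq u hu =>
    ⟨?_, fun e he => ?_⟩, fun i hi x hx q hq => ?_⟩
  · rw [Set.Finite.mem_toFinset]
    exact Set.mem_biUnion (x := (netInit I j).1) (Or.inl (Set.mem_biUnion hj rfl)) .refl
  · rw [Set.Finite.mem_toFinset]; exact (hinit j).2 x hx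
  · rw [Set.Finite.mem_toFinset] at hq ⊢
    simp only [Set.mem_iUnion, Set.mem_ofPred_eq, exists_prop] at hq ⊢
    obtain ⟨q0, h0, h⟩ := hq
    exact ⟨q0, h0, h.tail ⟨i, hi, u.2, hu⟩⟩
  · rw [Set.Finite.mem_toFinset] at hq ⊢
    exact (tauAt_spec hM (hQb q hq) (nameOf_le hM i) hu).2.2 e he
  · rw [Set.Finite.mem_toFinset] at hx ⊢
    exact Set.mem_biUnion (x := q) (Or.inr (Set.mem_biUnion hi (Set.mem_biUnion hx hq))) .refl

theorem computablePred_net : ComputablePred fun I : Inst => (net I).Reach (netInit I) :=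
  isPrim_net.computablePred_reach prim_netInit net_finite

/-! ### Tokens of expressions and processes -/

/-- On the left operators, on the right references with their binder depth. -/
abbrev Tok := ℕ ⊕ (ℕ × Ref)

def Tok.code : Tok → ℕ
  | .inl n => 2 * n + 1
  | .inr r => 2 * Nat.pair r.1 r.2.code

def Tok.mapRef (g : ℕ → Ref → Ref) : Tok → Tok := Sum.map id fun r => (r.1, g r.1 r.2)

mutual
/-- The tokens of an expression under `k` binders. -/
def Exp.toks (k : ℕ) : Exp → List Tok
  | .fld f => [.inl (Nat.pair 0 f)]
  | .ref r => [.inr (k, r)]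
  | .new C es => Exp.toksList k es ++ [.inl (Nat.pair 1 (Nat.pair C es.length))]
/-- The same for a tuple of expressions. -/
def Exp.toksList (k : ℕ) : List Exp → List Tok
  | [] => []
  | e :: es => e.toks k ++ Exp.toksList k es
end

/-- The tokens of a process under `k` binders. -/
def Proc.toks : ℕ → Proc → List Tok
  | _, .nil => [.inl (Nat.pair 2 0)]
  | k, .upd f e P => P.toks k ++ e.toks k ++ [.inl (Nat.pair 3 f)]
  | k, .letin e P => P.toks (k + 1) ++ e.toks k ++ [.inl (Nat.pair 4 0)]
  | k, .send r m es P =>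
    P.toks k ++ Exp.toksList k es ++ [.inr (k, r), .inl (Nat.pair 5 (Nat.pair m es.length))]
  | k, .ite e e' P Q => P.toks k ++ Q.toks k ++ e.toks k ++ e'.toks k ++ [.inl (Nat.pair 6 0)]
  | k, .plus P Q => P.toks k ++ Q.toks k ++ [.inl (Nat.pair 7 0)]

mutual
theorem Exp.expToks_code (k : ℕ) : ∀ e : Exp, expToks k false e.code = ((e.toks k).map Tok.code, 1)
  | .fld f => by rw [expToks]; simp [Exp.code, Exp.toks, Tok.code]
  | .ref r => by rw [expToks]; simp [Exp.code, Exp.toks, Tok.code]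
  | .new C es => by
    rw [expToks]
    simp [Exp.code, Exp.toks, Tok.code, Exp.expToks_codeList k es]
theorem Exp.expToks_codeList (k : ℕ) :
    ∀ es : List Exp, expToks k true (Exp.codeList es) = ((Exp.toksList k es).map Tok.code, es.length)
  | [] => by rw [expToks]; simp [Exp.codeList, Exp.toksList]
  | e :: es => by
    rw [expToks]
    simp [Exp.codeList, Exp.toksList, Exp.expToks_code k e, Exp.expToks_codeList k es]
end

theorem Proc.procToks_code (P : Proc) (k : ℕ) : procToks k P.code = (P.toks k).map Tok.code := by
  induction P generalizing k <;> rw [procToks] <;>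
    simp [Proc.code, Proc.toks, Tok.code, Exp.expToks_code, Exp.expToks_codeList, *]

mutual
theorem Exp.toks_mapRef (g : ℕ → Ref → Ref) (k : ℕ) :
    ∀ e : Exp, (e.mapRef (g k)).toks k = (e.toks k).map (Tok.mapRef g)
  | .fld f => by simp [Exp.mapRef, Exp.toks, Tok.mapRef]
  | .ref r => by simp [Exp.mapRef, Exp.toks, Tok.mapRef]
  | .new C es => by
    simp [Exp.mapRef, Exp.toks, Exp.toksList_mapRef g k es, Exp.length_mapRefList (g k) es]
    simp [Tok.mapRef]
theorem Exp.toksList_mapRef (g : ℕ → Ref → Ref) (k : ℕ) :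
    ∀ es : List Exp, Exp.toksList k (Exp.mapRefList (g k) es) =
      (Exp.toksList k es).map (Tok.mapRef g)
  | [] => by simp [Exp.mapRefList, Exp.toksList]
  | e :: es => by
    simp [Exp.mapRefList, Exp.toksList, Exp.toks_mapRef g k e, Exp.toksList_mapRef g k es]
theorem Exp.length_mapRefList (g : Ref → Ref) :
    ∀ es : List Exp, (Exp.mapRefList g es).length = es.length
  | [] => by simp [Exp.mapRefList]
  | e :: es => by simp [Exp.mapRefList, Exp.length_mapRefList g es]
end

theorem Proc.toks_mapRef (g : ℕ → Ref → Ref) (P : Proc) (k : ℕ) :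
    (P.mapRef g k).toks k = (P.toks k).map (Tok.mapRef g) := by
  induction P generalizing k <;>
    simp [Proc.mapRef, Proc.toks, Exp.toks_mapRef, Exp.toksList_mapRef, Exp.length_mapRefList, *] <;>
    simp [Tok.mapRef]

/-- A token without its depth. -/
abbrev Tok.flat : Tok → ℕ ⊕ Ref := Sum.map id Prod.snd

-- Read backwards, a word of tokens is in Polish notation: the operator comes first and determines
-- the constructor and the number of arguments. The tails `s` and `s'` carry the induction through
-- the subterms. Depths play no part, as they are determined by the term.
mutual
theorem Exp.toks_flat_inj (k k' : ℕ) : ∀ (e e' : Exp) (s s' : List (ℕ ⊕ Ref)),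
    ((e.toks k).map Tok.flat).reverse ++ s = ((e'.toks k').map Tok.flat).reverse ++ s' →
      e = e' ∧ s = s'
  | .fld f, e', s, s' => by
    cases e' <;> simp [Exp.toks, Nat.pair_eq_pair]
  | .ref r, e', s, s' => by
    cases e' <;> simp [Exp.toks]
  | .new C es, e', s, s' => by
    cases e' with
    | fld f => simp [Exp.toks, Nat.pair_eq_pair]
    | ref r => simp [Exp.toks]
    | new C' es' =>
      simp only [Exp.toks, List.map_append, List.map_cons, List.map_nil, List.reverse_append,
        List.reverse_cons, List.reverse_nil, List.nil_append, List.cons_append, List.cons.injEq,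
        Sum.map_inl, id, Sum.inl.injEq, Nat.pair_eq_pair, true_and, Exp.new.injEq]
      rintro ⟨⟨rfl, hlen⟩, h⟩
      obtain ⟨rfl, rfl⟩ := Exp.toksList_flat_inj k k' es es' s s' hlen h
      simp
theorem Exp.toksList_flat_inj (k k' : ℕ) : ∀ (es es' : List Exp) (s s' : List (ℕ ⊕ Ref)),
    es.length = es'.length →
    ((Exp.toksList k es).map Tok.flat).reverse ++ s =
      ((Exp.toksList k' es').map Tok.flat).reverse ++ s' → es = es' ∧ s = s'
  | [], es', s, s' => by
    cases es' <;> simp [Exp.toksList]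
  | e :: es, es', s, s' => by
    cases es' with
    | nil => simp
    | cons e' es' =>
      simp only [Exp.toksList, List.map_append, List.reverse_append, List.append_assoc,
        List.length_cons, Nat.add_right_cancel_iff]
      intro hlen h
      obtain ⟨rfl, h1⟩ := Exp.toksList_flat_inj k k' es es' _ _ hlen h
      obtain ⟨rfl, rfl⟩ := Exp.toks_flat_inj k k' e e' _ _ h1
      simp
end

theorem Proc.toks_flat_inj_aux (P P' : Proc) (k k' : ℕ) (s s' : List (ℕ ⊕ Ref)) :
    ((P.toks k).map Tok.flat).reverse ++ s = ((P'.toks k').map Tok.flat).reverse ++ s' →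
      P = P' ∧ s = s' := by
  induction P generalizing P' k k' s s' with
  | nil => cases P' <;> simp [Proc.toks, Nat.pair_eq_pair]
  | upd f e P ih =>
    cases P' with
    | upd f' e' P' =>
      simp [Proc.toks, Nat.pair_eq_pair]
      rintro rfl h
      obtain ⟨rfl, h1⟩ := Exp.toks_flat_inj k k' e e' _ _ (by simpa using h)
      obtain ⟨rfl, rfl⟩ := ih _ _ _ _ _ h1
      simp
    | _ => simp [Proc.toks, Nat.pair_eq_pair]
  | letin e P ih =>
    cases P' with
    | letin e' P' =>
      simp [Proc.toks]
      rintro h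
      obtain ⟨rfl, h1⟩ := Exp.toks_flat_inj k k' e e' _ _ (by simpa using h)
      obtain ⟨rfl, rfl⟩ := ih _ _ _ _ _ h1
      simp
    | _ => simp [Proc.toks, Nat.pair_eq_pair]
  | send r m es P ih =>
    cases P' with
    | send r' m' es' P' =>
      simp [Proc.toks, Nat.pair_eq_pair]
      rintro rfl hlen rfl h
      obtain ⟨rfl, h1⟩ := Exp.toksList_flat_inj k k' es es' _ _ hlen (by simpa using h)
      obtain ⟨rfl, rfl⟩ := ih _ _ _ _ _ h1
      simp
    | _ => simp [Proc.toks, Nat.pair_eq_pair]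
  | ite e₁ e₂ P Q ih1 ih2 =>
    cases P' with
    | ite e₁' e₂' P' Q' =>
      simp [Proc.toks]
      rintro h
      obtain ⟨rfl, h1⟩ := Exp.toks_flat_inj k k' e₂ e₂' _ _ (by simpa using h)
      obtain ⟨rfl, h2⟩ := Exp.toks_flat_inj k k' e₁ e₁' _ _ h1
      obtain ⟨rfl, h3⟩ := ih2 _ _ _ _ _ h2
      obtain ⟨rfl, rfl⟩ := ih1 _ _ _ _ _ h3
      simp
    | _ => simp [Proc.toks, Nat.pair_eq_pair]
  | plus P Q ih1 ih2 =>
    cases P' with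
    | plus P' Q' =>
      simp [Proc.toks]
      rintro h
      obtain ⟨rfl, h1⟩ := ih2 _ _ _ _ _ (by simpa using h)
      obtain ⟨rfl, rfl⟩ := ih1 _ _ _ _ _ h1
      simp
    | _ => simp [Proc.toks, Nat.pair_eq_pair]

theorem Proc.toks_flat_inj {P P' : Proc} {k k' : ℕ}
    (h : (P.toks k).map Tok.flat = (P'.toks k').map Tok.flat) : P = P' :=
  (Proc.toks_flat_inj_aux P P' k k' [] [] (by rw [h])).1

mutual
theorem Exp.mem_refs_iff (k : ℕ) (r : Ref) :
    ∀ e : Exp, r ∈ e.refs ↔ .inr r ∈ (e.toks k).map Tok.flat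
  | .fld f => by simp [Exp.refs, Exp.toks]
  | .ref r => by simp [Exp.refs, Exp.toks]
  | .new C es => by
    rw [Exp.refs, Exp.mem_refsList_iff k r es, Exp.toks]; simp
theorem Exp.mem_refsList_iff (k : ℕ) (r : Ref) :
    ∀ es : List Exp, r ∈ Exp.refsList es ↔ .inr r ∈ (Exp.toksList k es).map Tok.flat
  | [] => by simp [Exp.refsList, Exp.toksList]
  | e :: es => by
    rw [Exp.refsList, Exp.toksList, List.map_append, List.mem_append, List.mem_append,
      Exp.mem_refs_iff k r e, Exp.mem_refsList_iff k r es]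
end

theorem Proc.mem_refs_iff (P : Proc) (k : ℕ) (r : Ref) :
    r ∈ P.refs ↔ .inr r ∈ (P.toks k).map Tok.flat := by
  induction P generalizing k with
  | nil => simp [Proc.refs, Proc.toks]
  | upd f e P ih =>
    simp only [Proc.refs, Proc.toks, List.map_append, List.mem_append, ← Exp.mem_refs_iff k, ← ih]
    simp [or_comm]
  | letin e P ih =>
    simp only [Proc.refs, Proc.toks, List.map_append, List.mem_append, ← Exp.mem_refs_iff k, ← ih]
    simp [or_comm]
  | send r' m es P ih =>
    simp only [Proc.refs, Proc.toks, List.map_append, List.mem_append, ← Exp.mem_refsList_iff k,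
      ← ih, List.mem_cons]
    simp only [List.map_cons, List.map_nil, List.mem_cons, Sum.map_inr, Sum.inr.injEq, Sum.map_inl,
      List.not_mem_nil, reduceCtorEq, or_false]
    tauto
  | ite e e' P Q ih1 ih2 =>
    simp only [Proc.refs, Proc.toks, List.map_append, List.mem_append, ← Exp.mem_refs_iff k,
      ← ih1, ← ih2]
    simp only [List.map_cons, List.map_nil, List.mem_cons, Sum.map_inl, List.not_mem_nil,
      reduceCtorEq, or_false]
    tauto
  | plus P Q ih1 ih2 =>
    simp only [Proc.refs, Proc.toks, List.map_append, List.mem_append, ← ih1, ← ih2]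
    simp

/-! ### Codes -/

theorem Actor.code_injective : Function.Injective Actor.code := by
  rintro (_ | ⟨C, i⟩) (_ | ⟨C', i'⟩) h <;> simp_all [Actor.code, Nat.pair_eq_pair]

theorem Actor.exists_code (a : ℕ) : ∃ A : Actor, A.code = a := by
  cases a with
  | zero => exact ⟨.root, rfl⟩
  | succ n => exact ⟨.mk n.unpair.1 n.unpair.2, by simp [Actor.code]⟩

theorem Value.code_injective : Function.Injective Value.code := by
  rintro (x | A) (x' | A') h <;> simp [Value.code, Nat.pair_eq_pair] at h
  · rw [h]
  · rw [Actor.code_injective h]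

theorem Ref.code_injective : Function.Injective Ref.code := by
  rintro (i | _ | v) (i' | _ | v') h <;> simp [Ref.code, Nat.pair_eq_pair] at h
  · rw [h]
  · rfl
  · rw [Value.code_injective h]

/-! ### Canonical forms -/

section Canon

variable {R : ℕ → Prop} [DecidablePred R] {cls : ℕ → ℕ}

/-- Replace the entries outside `R` by the class of the position of their first occurrence. -/
def canon (R : ℕ → Prop) [DecidablePred R] (cls : ℕ → ℕ) (l : List ℕ) : List ℕ :=
  l.map fun v => if R v then v else cls (l.idxOf v)

theorem idxOf_map_congr {ι : Type*} {f f' : ι → ℕ} (ts : List ι) (x : ι)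
    (h : ∀ t ∈ ts, f t = f x ↔ f' t = f' x) : (ts.map f).idxOf (f x) = (ts.map f').idxOf (f' x) := by
  induction ts with
  | nil => rfl
  | cons t ts ih =>
    have h1 := h t (by simp)
    simp only [List.map_cons, List.idxOf_cons]
    rw [ih fun t ht => h t (by simp [ht])]
    by_cases e : f t = f x
    · simp [e, h1.1 e]
    · have e' : f' t ≠ f' x := fun e' => e (h1.2 e')
      simp [beq_false_of_ne e, beq_false_of_ne e']

/-- The position of a first occurrence depends only on which entries are equal. -/
theorem canon_map_congr {ι : Type*} {f f' : ι → ℕ} (ts : List ι)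
    (h1 : ∀ t ∈ ts, ∀ t' ∈ ts, f t = f t' ↔ f' t = f' t')
    (h2 : ∀ t ∈ ts, R (f t) ∨ R (f' t) → f t = f' t) :
    canon R cls (ts.map f) = canon R cls (ts.map f') := by
  simp only [canon, List.map_map]
  refine List.map_congr_left fun t ht => ?_
  simp only [Function.comp_apply]
  by_cases e : R (f t)
  · rw [← h2 t ht (.inl e), if_pos e, if_pos e]
  · have e' : ¬ R (f' t) := fun e' => e (h2 t ht (.inr e') ▸ e')
    rw [if_neg e, if_neg e', idxOf_map_congr ts t fun t' ht' => h1 t' ht' t ht]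

/-- Lists with the same canonical form are the same up to a renaming of the other entries. -/
theorem exists_map_of_canon_eq (hcls : ∀ k, ¬ R (cls k)) (hinj : Function.Injective cls)
    {l l' : List ℕ} (h : canon R cls l = canon R cls l') :
    ∃ g : ℕ → ℕ, l' = l.map g ∧ (∀ t ∈ l, R t ∨ R (g t) → g t = t) ∧
      ∀ t ∈ l, ∀ t' ∈ l, g t = g t' → t = t' := by
  have hlen : l.length = l'.length := by simpa [canon] using congrArg List.length h
  have key : ∀ n (hn : n < l.length), (R l[n] ∨ R (l'[n]'(hlen ▸ hn)) → l'[n]'(hlen ▸ hn) = l[n]) ∧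
      (¬ R l[n] → ¬ R (l'[n]'(hlen ▸ hn)) ∧ l.idxOf l[n] = l'.idxOf (l'[n]'(hlen ▸ hn))) := by
    intro n hn
    have hn' : n < l'.length := hlen ▸ hn
    have e : (canon R cls l)[n]'(by simpa [canon] using hn) =
        (canon R cls l')[n]'(by simpa [canon] using hn') := by simp only [h]
    simp only [canon, List.getElem_map] at e
    by_cases e1 : R l[n] <;> by_cases e2 : R l'[n]
    · simp only [e1, e2, if_true] at e; simp [e, e2]
    · simp only [e1, e2, if_true, if_false] at e; exact absurd (e ▸ e1) (hcls _)
    · simp only [e1, e2, if_true, if_false] at e; exact absurd (e.symm ▸ e2) (hcls _)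
    · simp only [e1, e2, if_false] at e
      exact ⟨by simp [e1, e2], fun _ => ⟨e2, hinj e⟩⟩
  -- The entry of `l'` at the first position of `t` in `l`; by equality of the canonical forms any
  -- other position of `t` gives the same.
  let g : ℕ → ℕ := fun t => l'.getD (l.idxOf t) 0
  have hg : ∀ n (hn : n < l.length), g l[n] = l'[n]'(hlen ▸ hn) := by
    intro n hn
    have hm : l.idxOf l[n] < l.length := List.idxOf_lt_length_of_mem (List.getElem_mem hn)
    have hm' : l.idxOf l[n] < l'.length := hlen ▸ hm
    have e1 : g l[n] = l'[l.idxOf l[n]] := by simp [g, List.getD_eq_getElem?_getD, hm']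
    have e2 : l[l.idxOf l[n]] = l[n] := List.getElem_idxOf hm
    rw [e1]
    by_cases e : R l[n]
    · rw [(key n hn).1 (.inl e), (key _ hm).1 (.inl (by rwa [e2])), e2]
    · simp only [((key n hn).2 e).2]
      exact List.getElem_idxOf _
  have hmem : ∀ t ∈ l, ∃ n, ∃ hn : n < l.length, l[n] = t := fun t ht => List.getElem_of_mem ht
  refine ⟨g, ?_, ?_, ?_⟩
  · refine List.ext_getElem (by simp [hlen]) fun n h1 h2 => ?_
    rw [List.getElem_map, hg n (by omega)]
  · intro t ht hR
    obtain ⟨n, hn, rfl⟩ := hmem t ht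
    rw [hg n hn] at hR ⊢
    exact (key n hn).1 hR
  · intro t ht t' ht' e
    obtain ⟨n, hn, rfl⟩ := hmem t ht
    obtain ⟨m, hm, rfl⟩ := hmem t' ht'
    rw [hg n hn, hg m hm] at e
    by_cases e1 : R l[n]
    · have h1 := (key n hn).1 (.inl e1)
      have h2 := (key m hm).1 (.inr (by rw [← e, h1]; exact e1))
      rw [← h1, ← h2, e]
    · have e2 : ¬ R l[m] := fun e2 => ((key n hn).2 e1).1 (by
        rw [e, (key m hm).1 (.inl e2)]; exact e2)
      have h1 := ((key n hn).2 e1).2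
      have h2 := ((key m hm).2 e2).2
      rw [← e, ← h1] at h2
      have h3 : l.idxOf l[n] < l.length := List.idxOf_lt_length_of_mem (List.getElem_mem hn)
      have h4 : l.idxOf l[m] < l.length := List.idxOf_lt_length_of_mem (List.getElem_mem hm)
      rw [← List.getElem_idxOf h3, ← List.getElem_idxOf h4]
      simp only [h2]

end Canon

/-! ### The code of an instance -/

def Cell.toCode (c : Cell) : CellCode :=
  (c.proc.code, c.state.map fun b => (b.1, b.2.code), c.queue.map fun m => (m.1, m.2.map Value.code))

def Config.toCode (S : Config) : ConfCode := S.map fun t => (t.1.code, t.2.toCode)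

def toInst (p : Program) (S T : Config) : Inst :=
  ((p.main.code, p.fieldTable, p.methods.map fun d => (d.cls, d.name, d.params, d.body.code)),
    Config.toCode S, Config.toCode T)

theorem parse_instanceCode (p : Program) (S T : Config) :
    parse (instanceCode p S T) = toInst p S T := by
  have h : ∀ S : Config, ((Encodable.decode (α := List (ℕ × ℕ)) (Config.code S)).getD []).map
      (fun x => (x.1, (Encodable.decode (α := CellCode) x.2).getD (0, [], []))) = Config.toCode S := by
    intro S
    have h1 : Encodable.decode (α := List (ℕ × ℕ)) (Config.code S) =
      some (S.map fun t => (t.1.code, t.2.code)) := Encodable.encodek _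
    rw [h1, Option.getD_some, List.map_map, Config.toCode]
    refine List.map_congr_left fun t _ => ?_
    have h2 : Encodable.decode (α := CellCode) t.2.code = some t.2.toCode := Encodable.encodek _
    rw [Function.comp_apply]
    dsimp only
    rw [h2, Option.getD_some]
  have h1 : Encodable.decode (α := ℕ × ℕ × ℕ) (instanceCode p S T) =
    some (p.code, Config.code S, Config.code T) := Encodable.encodek _
  have h2 : Encodable.decode (α := ℕ × List (ℕ × List ℕ) × List ℕ) p.code =
    some (p.main.code, p.fieldTable, p.methods.map MethodDef.code) := Encodable.encodek _
  have h3 : (p.methods.map MethodDef.code).map (fun d =>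
      (Encodable.decode (α := ℕ × ℕ × List ℕ × ℕ) d).getD (0, 0, [], 0)) =
      p.methods.map fun d => (d.cls, d.name, d.params, d.body.code) := by
    rw [List.map_map]
    refine List.map_congr_left fun d _ => ?_
    have h4 : Encodable.decode (α := ℕ × ℕ × List ℕ × ℕ) d.code =
      some (d.cls, d.name, d.params, d.body.code) := Encodable.encodek _
    rw [Function.comp_apply, h4, Option.getD_some]
  unfold parse
  rw [h1]
  dsimp only [Option.getD_some]
  rw [h2]
  dsimp only [Option.getD_some]
  rw [h, h, h3]
  rfl

theorem lookup_map_inj {α α' β β' : Type*} [DecidableEq α] [DecidableEq α'] {f : α → α'}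
    (hf : Function.Injective f) (g : β → β') (l : List (α × β)) (a : α) :
    (l.map fun t => (f t.1, g t.2)).lookup (f a) = (l.lookup a).map g := by
  induction l with
  | nil => rfl
  | cons x l ih =>
    obtain ⟨b, c⟩ := x
    by_cases e : a = b
    · simp [e]
    · simp [List.lookup_cons, ih, beq_false_of_ne e, beq_false_of_ne (fun h => e (hf h))]

/-! ### Rigid values -/

theorem mem_values_iff (P : Proc) (v : Value) : v ∈ P.values ↔ .val v ∈ P.refs := by
  simp only [Proc.values, List.mem_filterMap]
  constructor
  · rintro ⟨r, hr, h⟩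
    cases r <;> simp_all
  · exact fun h => ⟨_, h, rfl⟩

theorem mem_varsOf (l : List Value) (x : ℕ) : x ∈ varsOf l ↔ .var x ∈ l := by
  simp only [varsOf, List.mem_filterMap]
  constructor
  · rintro ⟨r, hr, h⟩
    cases r <;> simp_all
  · exact fun h => ⟨_, h, rfl⟩

theorem mem_actsOf (l : List Value) (A : Actor) : A ∈ actsOf l ↔ .act A ∈ l := by
  simp only [actsOf, List.mem_filterMap]
  constructor
  · rintro ⟨r, hr, h⟩
    cases r <;> simp_all
  · exact fun h => ⟨_, h, rfl⟩

theorem mem_vars_iff (P : Proc) (x : ℕ) : x ∈ P.vars ↔ .val (.var x) ∈ P.refs := by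
  rw [Proc.vars, mem_varsOf, mem_values_iff]

theorem tokVal_inl (n : ℕ) : tokVal (Tok.code (.inl n)) = Nat.pair 2 0 := by
  simp [tokVal, Tok.code]

theorem tokVal_inr (k : ℕ) (r : Ref) : tokVal (Tok.code (.inr (k, r))) =
    match r with | .val v => v.code | _ => Nat.pair 2 0 := by
  cases r <;> simp [tokVal, Tok.code, Ref.code]

theorem rigidCode_iff (p : Program) (S T : Config) (v : Value) :
    RigidCode (toInst p S T) v.code ↔ v.Rigid p.main.vars := by
  cases v with
  | act A => simp [RigidCode, Value.Rigid, Value.code]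
  | var x =>
    simp only [RigidCode, Value.Rigid, Value.code, Nat.unpair_pair, zero_ne_one, false_or, true_and,
      toInst, Inst.main]
    rw [Proc.procToks_code, mem_vars_iff, Proc.mem_refs_iff _ 0]
    simp only [List.mem_map]
    constructor
    · rintro ⟨_, ⟨t, ht, rfl⟩, h⟩
      refine ⟨t, ht, ?_⟩
      rcases t with n | ⟨k, r⟩
      · rw [tokVal_inl] at h; simp [Nat.pair_eq_pair] at h
      · rw [tokVal_inr] at h
        cases r with
        | val v => simp [Value.code_injective (a₁ := v) (a₂ := .var x) h]
        | _ => simp [Nat.pair_eq_pair] at h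
    · rintro ⟨t, ht, h⟩
      refine ⟨_, ⟨t, ht, rfl⟩, ?_⟩
      rcases t with n | ⟨k, r⟩
      · simp at h
      · simp only [Sum.map_inr, Sum.inr.injEq] at h
        subst h
        rw [tokVal_inr]; rfl

theorem RigidCode.exists_value {I : Inst} {v : ℕ} (h : RigidCode I v) : ∃ V : Value, V.code = v := by
  rcases h with h | ⟨h, -⟩
  · obtain ⟨A, hA⟩ := Actor.exists_code v.unpair.2
    exact ⟨.act A, by rw [Value.code, hA, ← h, Nat.pair_unpair]⟩
  · exact ⟨.var v.unpair.2, by rw [Value.code, ← h, Nat.pair_unpair]⟩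

theorem not_rigidCode_class (I : Inst) (t k : ℕ) (h : 2 ≤ t) : ¬ RigidCode I (Nat.pair t k) := by
  simp [RigidCode]; omega

/-- An interpretation of abstract values that fixes the rigid ones. -/
structure Good (I : Inst) (θ : ℕ → Value) : Prop where
  inj : Function.Injective θ
  rigid : ∀ V : Value, RigidCode I V.code → θ V.code = V

theorem Good.rigid_iff {I : Inst} {θ : ℕ → Value} (h : Good I θ) (v : ℕ) :
    RigidCode I v ∨ RigidCode I (θ v).code → (θ v).code = v := by
  rintro (h1 | h1)
  · obtain ⟨V, rfl⟩ := h1.exists_value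
    rw [h.rigid V h1]
  · have := h.rigid _ h1
    exact h.inj this

theorem Good.code_eq_iff {I : Inst} {θ : ℕ → Value} (h : Good I θ) {v : ℕ} {V : Value}
    (hV : RigidCode I V.code) : θ v = V ↔ v = V.code :=
  ⟨fun e => h.inj (e.trans (h.rigid V hV).symm), fun e => e ▸ h.rigid V hV⟩

/-- A partial interpretation on a finite list extends: rigid codes are forced, and every remaining
abstract value gets a variable of its own, above all those in use. -/
theorem exists_good (I : Inst) (F : List ℕ) (hF : ∀ x, RigidCode I (Value.var x).code → x ∈ F)
    (L : List ℕ) (τ : ℕ → Value) (hinj : ∀ v ∈ L, ∀ v' ∈ L, τ v = τ v' → v = v')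
    (hr : ∀ v ∈ L, RigidCode I v ∨ RigidCode I (τ v).code → (τ v).code = v) :
    ∃ θ, Good I θ ∧ ∀ v ∈ L, θ v = τ v := by
  classical
  let N := (F ++ varsOf (L.map τ)).sum + 1
  have hN : ∀ x ∈ F ++ varsOf (L.map τ), x < N := fun x hx =>
    Nat.lt_succ_of_le (List.le_sum_of_mem hx)
  let θ : ℕ → Value := fun v =>
    if h : RigidCode I v then h.exists_value.choose else if v ∈ L then τ v else .var (N + v)
  have t1 : ∀ v, RigidCode I v → (θ v).code = v := fun v h => by
    simp only [θ, dif_pos h]; exact h.exists_value.choose_spec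
  have t2 : ∀ v, ¬ RigidCode I v → v ∈ L → θ v = τ v := fun v h h' => by simp [θ, h, h']
  have t3 : ∀ v, ¬ RigidCode I v → v ∉ L → θ v = .var (N + v) := fun v h h' => by simp [θ, h, h']
  have t4 : ∀ v, RigidCode I (θ v).code → RigidCode I v := by
    intro v h
    by_contra h1
    by_cases h2 : v ∈ L
    · rw [t2 v h1 h2] at h
      exact h1 (hr v h2 (.inr h) ▸ h)
    · rw [t3 v h1 h2] at h
      have := hN _ (List.mem_append_left _ (hF _ h)); omega
  refine ⟨θ, ⟨?_, ?_⟩, ?_⟩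
  · intro v v' e
    by_cases h1 : RigidCode I v
    · have h2 : RigidCode I v' := t4 v' (by rw [← e, t1 v h1]; exact h1)
      rw [← t1 v h1, ← t1 v' h2, e]
    · have h2 : ¬ RigidCode I v' := fun h2 => h1 (t4 v (by rw [e, t1 v' h2]; exact h2))
      by_cases h3 : v ∈ L <;> by_cases h4 : v' ∈ L
      · rw [t2 v h1 h3, t2 v' h2 h4] at e; exact hinj v h3 v' h4 e
      · rw [t2 v h1 h3, t3 v' h2 h4] at e
        have := hN (N + v') (List.mem_append_right _ ((mem_varsOf _ _).2
          (List.mem_map.2 ⟨v, h3, e⟩)))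
        omega
      · rw [t3 v h1 h3, t2 v' h2 h4] at e
        have := hN (N + v) (List.mem_append_right _ ((mem_varsOf _ _).2
          (List.mem_map.2 ⟨v', h4, e.symm⟩)))
        omega
      · rw [t3 v h1 h3, t3 v' h2 h4] at e
        simpa using e
  · intro V hV
    exact Value.code_injective (t1 _ hV)
  · intro v hv
    by_cases h1 : RigidCode I v
    · exact Value.code_injective ((t1 v h1).trans (hr v hv (.inl h1)).symm)
    · exact t2 v h1 hv

theorem canonVals_eq_canon (I : Inst) (l : List ℕ) :
    canonVals I l = canon (RigidCode I) (Nat.pair 2) l := rfl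

/-- A good interpretation preserves and reflects equality and fixes rigid values, so canonical forms
do not depend on it; this is why a letter of the net determines the message up to similarity. -/
theorem Good.canonVals {I : Inst} {θ : ℕ → Value} (h : Good I θ) (l : List ℕ) :
    canonVals I (l.map fun v => (θ v).code) = canonVals I l := by
  conv_rhs => rw [← List.map_id' l]
  exact canon_map_congr l (fun v _ v' _ => by rw [Value.code_injective.eq_iff, h.inj.eq_iff])
    fun v _ hv => h.rigid_iff v (hv.symm)

/-- The values of a list are images of their canonical form. -/
theorem canonVals_spec (I : Inst) (l : List ℕ) :
    ∃ g : ℕ → ℕ, canonVals I l = l.map g ∧ (∀ t ∈ l, RigidCode I t ∨ RigidCode I (g t) → g t = t) ∧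
      (∀ t ∈ l, ∀ t' ∈ l, g t = g t' → t = t') ∧
      ∀ t ∈ l, ¬ RigidCode I t → (g t).unpair.1 = 2 := by
  refine ⟨fun v => if RigidCode I v then v else Nat.pair 2 (l.idxOf v), rfl, ?_, ?_, ?_⟩
  · rintro t ht (h | h)
    · simp [h]
    · by_contra h1
      by_cases h2 : RigidCode I t
      · simp [h2] at h1
      · simp only [h2, if_false] at h
        exact not_rigidCode_class I _ _ le_rfl h
  · intro t ht t' ht' e
    by_cases h1 : RigidCode I t <;> by_cases h2 : RigidCode I t' <;>
      simp only [h1, h2, if_true, if_false] at e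
    · exact e
    · exact absurd (e ▸ h1) (not_rigidCode_class I _ _ le_rfl)
    · exact absurd (e.symm ▸ h2) (not_rigidCode_class I _ _ le_rfl)
    · rw [Nat.pair_eq_pair] at e
      exact (List.idxOf_inj ht).1 e.2
  · intro t _ h
    simp [h]

/-! ### Similarity of processes and messages -/

/-- The code of a token without its depth. -/
def flatCode : ℕ ⊕ Ref → ℕ
  | .inl n => 2 * (2 * n + 1) + 1
  | .inr (.val v) => 2 * v.code
  | .inr .this => 2 * (2 * Ref.this.code) + 1
  | .inr (.bvar i) => 2 * (2 * (Ref.bvar i).code) + 1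

theorem flatCode_injective : Function.Injective flatCode := by
  have h : ∀ {r r' : Ref}, r.code = r'.code → r = r' := fun h => Ref.code_injective h
  rintro (n | (i | _ | v)) (n' | (i' | _ | v')) e <;> simp only [flatCode] at e <;>
    first
    | omega
    | (simp only [Sum.inl.injEq]; omega)
    | (exact congrArg Sum.inr (h (by omega)))
    | (rw [Value.code_injective (a₁ := v) (a₂ := v') (by omega)])

/-- The tokens of a process, as numbers. -/
def Proc.sig (P : Proc) : List ℕ := ((P.toks 0).map Tok.flat).map flatCode

/-- The renaming of a token. -/
def renameFlat (F : List ℕ) (ρ : ℕ → Value) : ℕ ⊕ Ref → ℕ ⊕ Ref := Sum.map id fun r =>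
  match r with
  | .val (.var x) => if x ∈ F then .val (.var x) else .val (ρ x)
  | r => r

theorem flat_rename (F : List ℕ) (ρ : ℕ → Value) (P : Proc) :
    ((P.rename F ρ).toks 0).map Tok.flat = ((P.toks 0).map Tok.flat).map (renameFlat F ρ) := by
  rw [Proc.rename, Proc.toks_mapRef, List.map_map, List.map_map]
  refine List.map_congr_left fun t _ => ?_
  rcases t with n | ⟨k, r⟩ <;> rfl

theorem renameFlat_cases (F : List ℕ) (t : ℕ ⊕ Ref) :
    (∀ ρ, renameFlat F ρ t = t) ∧ (∀ V : Value, t = .inr (.val V) → V.Rigid F) ∨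
      ∃ x, x ∉ F ∧ t = .inr (.val (.var x)) ∧ ∀ ρ, renameFlat F ρ t = .inr (.val (ρ x)) := by
  rcases t with n | (i | _ | (x | A))
  · left; simp [renameFlat]
  · left; simp [renameFlat]
  · left; simp [renameFlat]
  · by_cases h : x ∈ F
    · left; simp [renameFlat, h, Value.Rigid]
    · right; exact ⟨x, h, rfl, fun ρ => by simp [renameFlat, h]⟩
  · left; simp [renameFlat, Value.Rigid]

/-- Fixed by renamings. -/
def RigidTok (I : Inst) (t : ℕ) : Prop := t % 2 = 1 ∨ RigidCode I (t / 2)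

instance (I : Inst) : DecidablePred (RigidTok I) := fun _ =>
  inferInstanceAs (Decidable (_ ∨ _))

theorem canonToks_eq_canon (I : Inst) (l : List ℕ) :
    canonToks I l = canon (RigidTok I) (fun k => 2 * Nat.pair 2 k) l := rfl

theorem not_rigidTok_class (I : Inst) (k : ℕ) : ¬ RigidTok I (2 * Nat.pair 2 k) := by
  have := not_rigidCode_class I 2 k le_rfl
  simp [RigidTok, this]

section

variable (p : Program) (S T : Config)

theorem rigidTok_val (V : Value) :
    RigidTok (toInst p S T) (flatCode (.inr (.val V))) ↔ V.Rigid p.main.vars := by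
  rw [← rigidCode_iff p S T]
  simp [RigidTok, flatCode]

theorem rigidTok_cases {t : ℕ ⊕ Ref} (h : ∀ V : Value, t = .inr (.val V) → V.Rigid p.main.vars) :
    RigidTok (toInst p S T) (flatCode t) := by
  rcases t with n | (i | _ | V)
  · left; simp only [flatCode]; omega
  · left; simp only [flatCode]; omega
  · left; simp only [flatCode]; omega
  · rw [rigidTok_val]; exact h V rfl

/-- Related renamings preserve equalities and rigid values, hence canonical forms. Conversely, the
bijection of entries from `exists_map_of_canon_eq` is read as a renaming of the variables of `P`. -/
theorem procSim_iff (P P' : Proc) : ProcSim p.main.vars P P' ↔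
    canonToks (toInst p S T) P.sig = canonToks (toInst p S T) P'.sig := by
  classical
  set I := toInst p S T with hI
  set F := p.main.vars with hF
  constructor
  · rintro ⟨P, ρ, ρ', h⟩
    rw [Proc.sig, Proc.sig, flat_rename, flat_rename, List.map_map (f := renameFlat F ρ),
      List.map_map (f := renameFlat F ρ'), canonToks_eq_canon, canonToks_eq_canon]
    refine canon_map_congr (R := RigidTok I) _ (fun t _ t' _ => ?_) fun t _ => ?_
    · simp only [Function.comp_apply, flatCode_injective.eq_iff]
      rcases renameFlat_cases F t with ⟨h1, h1'⟩ | ⟨x, hx, rfl, h1⟩ <;>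
      rcases renameFlat_cases F t' with ⟨h2, h2'⟩ | ⟨y, hy, rfl, h2⟩ <;>
      simp only [h1, h2]
      · constructor
        · intro e
          rw [e, (h y hy).2 (.inl (h1' _ e))]
        · intro e
          rw [e, (h y hy).2 (.inr (h1' _ e))]
      · constructor
        · intro e
          rw [← e, (h x hx).2 (.inl (h2' _ e.symm))]
        · intro e
          rw [← e, (h x hx).2 (.inr (h2' _ e.symm))]
      · simpa using (h x hx).1 y hy
    · simp only [Function.comp_apply]
      rcases renameFlat_cases F t with ⟨h1, h1'⟩ | ⟨x, hx, rfl, h1⟩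
      · simp [h1]
      · simp only [h1, hI, rigidTok_val]
        exact fun h' => by rw [(h x hx).2 h']
  · intro h
    rw [canonToks_eq_canon, canonToks_eq_canon] at h
    obtain ⟨g, hg1, hg2, hg3⟩ := exists_map_of_canon_eq (not_rigidTok_class I)
      (fun a b e => by simpa [Nat.pair_eq_pair] using e) h
    have hmem : ∀ x, x ∈ P.vars → flatCode (.inr (.val (.var x))) ∈ P.sig := fun x hx =>
      List.mem_map_of_mem ((Proc.mem_refs_iff P 0 _).1 ((mem_vars_iff P x).1 hx))
    have hdec : ∀ x, x ∈ P.vars → x ∉ F → ∃ V : Value, ¬ V.Rigid F ∧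
        g (flatCode (.inr (.val (.var x)))) = flatCode (.inr (.val V)) := by
      intro x hx hxF
      have h1 := hmem x hx
      have h2 : ¬ RigidTok I (g (flatCode (.inr (.val (.var x))))) := by
        intro h2
        rw [hg2 _ h1 (.inr h2), hI, rigidTok_val] at h2
        exact hxF h2
      have h3 : g (flatCode (.inr (.val (.var x)))) ∈ P'.sig := by
        rw [hg1]; exact List.mem_map_of_mem h1
      obtain ⟨t, -, ht⟩ := List.mem_map.1 h3
      rw [← ht] at h2 ⊢
      by_contra! h4
      refine h2 (rigidTok_cases p S T fun V hV => ?_)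
      by_contra h5
      exact h4 V h5 (by rw [hV])
    -- `P` itself is taken as the common pattern, so `ρ` is the identity on its variables. All
    -- variables that do not occur go to the root, a rigid value on which the two renamings must and
    -- do agree.
    let ρ : ℕ → Value := fun x => if x ∈ P.vars then .var x else .act .root
    let ρ' : ℕ → Value := fun x => if h : x ∈ P.vars ∧ x ∉ F then (hdec x h.1 h.2).choose
      else .act .root
    have hρ' : ∀ x, x ∈ P.vars → x ∉ F → ¬ (ρ' x).Rigid F ∧
        g (flatCode (.inr (.val (.var x)))) = flatCode (.inr (.val (ρ' x))) := fun x h1 h2 => by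
      simp only [ρ', dif_pos (And.intro h1 h2)]
      exact (hdec x h1 h2).choose_spec
    have hρ0 : ∀ x, x ∉ P.vars → ρ x = .act .root ∧ ρ' x = .act .root := fun x h1 => by
      simp [ρ, ρ', h1]
    have hρ1 : ∀ x, x ∈ P.vars → ρ x = .var x := fun x h1 => by simp [ρ, h1]
    have hroot : (Value.act .root).Rigid F := trivial
    have hren : RenEq F ρ ρ' := by
      intro x hx
      by_cases h1 : x ∈ P.vars
      · obtain ⟨h2, h3⟩ := hρ' x h1 hx
        refine ⟨fun y hy => ?_, ?_⟩
        · by_cases h4 : y ∈ P.vars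
          · obtain ⟨h5, h6⟩ := hρ' y h4 hy
            rw [hρ1 x h1, hρ1 y h4]
            constructor
            · intro e; simp only [Value.var.injEq] at e; rw [e]
            · intro e
              rw [e, ← h6] at h3
              have := flatCode_injective (hg3 _ (hmem x h1) _ (hmem y h4) h3)
              simpa using this
          · rw [hρ1 x h1, (hρ0 y h4).1, (hρ0 y h4).2]
            simp only [reduceCtorEq, false_iff]
            intro e; rw [e] at h2; exact h2 hroot
        · rw [hρ1 x h1]
          rintro (h4 | h4)
          exacts [absurd h4 hx, absurd h4 h2]
      · rw [(hρ0 x h1).1, (hρ0 x h1).2]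
        refine ⟨fun y hy => ?_, fun _ => rfl⟩
        by_cases h4 : y ∈ P.vars
        · rw [hρ1 y h4]
          simp only [reduceCtorEq, false_iff]
          intro e; exact (hρ' y h4 hy).1 (e ▸ hroot)
        · rw [(hρ0 y h4).1, (hρ0 y h4).2]
    have hflat : ∀ x, .inr (.val (.var x)) ∈ (P.toks 0).map Tok.flat → x ∈ P.vars := fun x hx =>
      (mem_vars_iff P x).2 ((Proc.mem_refs_iff P 0 _).2 hx)
    have e1 : P.rename F ρ = P := by
      refine Proc.toks_flat_inj (k := 0) (k' := 0) ?_
      rw [flat_rename]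
      conv_rhs => rw [← List.map_id ((P.toks 0).map Tok.flat)]
      refine List.map_congr_left fun t ht => ?_
      rcases renameFlat_cases F t with ⟨h1, -⟩ | ⟨x, hx, rfl, h1⟩
      · rw [h1]; rfl
      · rw [h1, hρ1 x (hflat x ht)]; rfl
    have e2 : P.rename F ρ' = P' := by
      refine Proc.toks_flat_inj (k := 0) (k' := 0) (flatCode_injective.list_map ?_)
      change _ = P'.sig
      rw [flat_rename, hg1, Proc.sig, List.map_map (f := renameFlat F ρ'), List.map_map (f := flatCode)]
      refine List.map_congr_left fun t ht => ?_
      simp only [Function.comp_apply]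
      rcases renameFlat_cases F t with ⟨h1, h2⟩ | ⟨x, hx, rfl, h1⟩
      · rw [h1, hg2 _ (List.mem_map_of_mem ht) (.inl (rigidTok_cases p S T h2))]
      · rw [h1, (hρ' x (hflat x ht) hx).2]
    have := ProcSim.mk P ρ ρ' hren
    rwa [e1, e2] at this

/-- As for processes, except that a pattern of variables has to be made up for the arguments, one
variable per position. -/
theorem msgSim_iff (x x' : Msg) : MsgSim p.main.vars x x' ↔
    (x.1, canonVals (toInst p S T) (x.2.map Value.code)) =
      (x'.1, canonVals (toInst p S T) (x'.2.map Value.code)) := by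
  set I := toInst p S T with hI
  set F := p.main.vars with hF
  constructor
  · rintro ⟨m, xs, hxs, ρ, ρ', h⟩
    simp only [Prod.mk.injEq, true_and, List.map_map]
    rw [canonVals_eq_canon, canonVals_eq_canon]
    refine canon_map_congr _ (fun t ht t' ht' => ?_) fun t ht => ?_
    · simpa [Value.code_injective.eq_iff] using (h t (hxs t ht)).1 t' (hxs t' ht')
    · simp only [Function.comp_apply, hI, rigidCode_iff]
      exact fun h' => by rw [(h t (hxs t ht)).2 h']
  · obtain ⟨m, us⟩ := x
    obtain ⟨m', us'⟩ := x'
    simp only [Prod.mk.injEq]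
    rintro ⟨rfl, h⟩
    rw [canonVals_eq_canon, canonVals_eq_canon] at h
    obtain ⟨g, hg1, hg2, hg3⟩ := exists_map_of_canon_eq
      (fun k => not_rigidCode_class I 2 k le_rfl)
      (fun a b e => by simpa [Nat.pair_eq_pair] using e) h
    have hlen : us'.length = us.length := by simpa using congrArg List.length hg1
    have hget : ∀ i (hi : i < us.length), (us'[i]'(hlen ▸ hi)).code = g us[i].code := by
      intro i hi
      have := List.getElem_of_eq hg1 (i := i) (by simpa [hlen] using hi)
      simpa using this
    have hm : ∀ i (hi : i < us.length), us[i].code ∈ us.map Value.code := fun i hi =>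
      List.mem_map_of_mem (List.getElem_mem hi)
    let N := F.sum + 1
    have hN : ∀ x ∈ F, x < N := fun x hx => Nat.lt_succ_of_le (List.le_sum_of_mem hx)
    -- The pattern is `N, N + 1, …`, above all of `F`. A variable below `N` is treated like `N` by
    -- both renamings, by truncated subtraction, which does no harm.
    let ρ : ℕ → Value := fun x => us.getD (x - N) (.act .root)
    let ρ' : ℕ → Value := fun x => us'.getD (x - N) (.act .root)
    have h1 : ∀ x, x - N < us.length → ∃ hi : x - N < us.length, ρ x = us[x - N] ∧
        ρ' x = us'[x - N]'(hlen ▸ hi) := fun x hx =>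
      ⟨hx, by simp [ρ, List.getD_eq_getElem?_getD, hx],
        by simp [ρ', List.getD_eq_getElem?_getD, hlen ▸ hx]⟩
    have h2 : ∀ x, ¬ x - N < us.length → ρ x = .act .root ∧ ρ' x = .act .root := fun x hx => by
      have h3 : us.length ≤ x - N := not_lt.1 hx
      have h4 : us'.length ≤ x - N := hlen ▸ h3
      simp [ρ, ρ', List.getD_eq_getElem?_getD, h3, h4]
    have hr : ∀ x, (ρ x).Rigid F ∨ (ρ' x).Rigid F → ρ x = ρ' x := by
      intro x
      by_cases hx : x - N < us.length
      · obtain ⟨hi, e1, e2⟩ := h1 x hx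
        rw [e1, e2, ← rigidCode_iff p S T, ← rigidCode_iff p S T, hget _ hi]
        intro h3
        refine Value.code_injective ?_
        rw [hget _ hi, hg2 _ (hm _ hi) h3]
      · rw [(h2 x hx).1, (h2 x hx).2]; exact fun _ => rfl
    have hroot : (Value.act .root).Rigid F := trivial
    have hren : RenEq F ρ ρ' := by
      refine fun x _ => ⟨fun y _ => ?_, hr x⟩
      by_cases hx : x - N < us.length <;> by_cases hy : y - N < us.length
      · obtain ⟨hi, e1, e2⟩ := h1 x hx
        obtain ⟨hj, e3, e4⟩ := h1 y hy
        rw [e1, e2, e3, e4, ← Value.code_injective.eq_iff, ← Value.code_injective.eq_iff (b := us'[y - N]'_),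
          hget _ hi, hget _ hj]
        exact ⟨fun e => by rw [e], fun e => hg3 _ (hm _ hi) _ (hm _ hj) e⟩
      · rw [(h2 y hy).1, (h2 y hy).2]
        constructor
        · intro e; rw [← hr x (.inl (by rw [e]; exact hroot)), e]
        · intro e; rw [hr x (.inr (by rw [e]; exact hroot)), e]
      · rw [(h2 x hx).1, (h2 x hx).2]
        constructor
        · intro e; rw [← hr y (.inl (by rw [← e]; exact hroot)), ← e]
        · intro e; rw [hr y (.inr (by rw [← e]; exact hroot)), ← e]
      · simp [(h2 x hx).1, (h2 x hx).2, (h2 y hy).1, (h2 y hy).2]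
    have := MsgSim.mk (F := F) m ((List.range us.length).map fun i => N + i)
      (by
        intro x hx hxF
        obtain ⟨i, -, rfl⟩ := List.mem_map.1 hx
        have := hN _ hxF; omega) ρ ρ' hren
    have e1 : ((List.range us.length).map fun i => N + i).map ρ = us := by
      refine List.ext_getElem (by simp) fun i h3 h4 => ?_
      simp [ρ, List.getD_eq_getElem?_getD, h4]
    have e2 : ((List.range us.length).map fun i => N + i).map ρ' = us' := by
      refine List.ext_getElem (by simp [hlen]) fun i h3 h4 => ?_
      simp [ρ', List.getD_eq_getElem?_getD, h4]
    rwa [e1, e2] at this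

end

/-! ### Closures -/

/-- The substitution described by an environment. -/
def closure (a : ℕ) (E : Env) (θ : ℕ → Value) (k : ℕ) (r : Ref) : Ref :=
  match resolve a E (Nat.pair k r.code) with
  | some v => .val (θ v)
  | none => r

theorem resolve_val (a : ℕ) (E : Env) (k : ℕ) (V : Value) :
    ∃ v, resolve a E (Nat.pair k (Ref.val V).code) = some v := by
  simp [resolve, Ref.code]

/-- The abstract word and its interpretation have the same equalities and the same rigid entries,
hence the same canonical form. So the goal test on abstract processes is independent of `θ`. -/
theorem resolveTok_code (I : Inst) {θ : ℕ → Value} (hθ : Good I θ) (a : ℕ) (E : Env) (l : List Tok) :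
    canonToks I ((l.map Tok.code).map (resolveTok a E)) =
      canonToks I (((l.map (Tok.mapRef (closure a E θ))).map Tok.flat).map flatCode) := by
  rw [canonToks_eq_canon, canonToks_eq_canon, List.map_map, List.map_map, List.map_map]
  have key : ∀ t : Tok, (∃ v, resolveTok a E t.code = 2 * v ∧
      flatCode (Tok.flat (Tok.mapRef (closure a E θ) t)) = 2 * (θ v).code) ∨
      ∃ n, resolveTok a E t.code = 2 * n + 1 ∧
        flatCode (Tok.flat (Tok.mapRef (closure a E θ) t)) = 2 * n + 1 := by
    rintro (n | ⟨k, r⟩)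
    · right
      refine ⟨2 * n + 1, ?_, rfl⟩
      simp [resolveTok, Tok.code]
    · cases h : resolve a E (Nat.pair k r.code) with
      | some v =>
        left
        exact ⟨v, by simp [resolveTok, Tok.code, h], by simp [Tok.mapRef, closure, h, flatCode]⟩
      | none =>
        right
        refine ⟨2 * r.code, by simp [resolveTok, Tok.code, h], ?_⟩
        cases r with
        | val V =>
          obtain ⟨v, hv⟩ := resolve_val a E k V
          rw [hv] at h; cases h
        | bvar i => simp [Tok.mapRef, closure, h, flatCode]
        | this => simp [Tok.mapRef, closure, h, flatCode]
  refine canon_map_congr _ (fun t _ t' _ => ?_) fun t _ => ?_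
  · simp only [Function.comp_apply]
    rcases key t with ⟨v, e1, e2⟩ | ⟨n, e1, e2⟩ <;> rcases key t' with ⟨v', e3, e4⟩ | ⟨n', e3, e4⟩ <;>
      rw [e1, e2, e3, e4]
    · simp [Value.code_injective.eq_iff, hθ.inj.eq_iff]
    · constructor <;> intro e <;> omega
    · constructor <;> intro e <;> omega
  · simp only [Function.comp_apply]
    rcases key t with ⟨v, e1, e2⟩ | ⟨n, e1, e2⟩ <;> rw [e1, e2]
    · intro h
      rw [hθ.rigid_iff v (by simpa [RigidTok] using h)]
    · simp

mutual
theorem Exp.mapRef_comp (g h : Ref → Ref) :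
    ∀ e : Exp, (e.mapRef g).mapRef h = e.mapRef fun r => h (g r)
  | .fld f => by simp [Exp.mapRef]
  | .ref r => by simp [Exp.mapRef]
  | .new C es => by simp [Exp.mapRef, Exp.mapRefList_comp g h es]
theorem Exp.mapRefList_comp (g h : Ref → Ref) :
    ∀ es : List Exp, Exp.mapRefList h (Exp.mapRefList g es) = Exp.mapRefList (fun r => h (g r)) es
  | [] => by simp [Exp.mapRefList]
  | e :: es => by simp [Exp.mapRefList, Exp.mapRef_comp g h e, Exp.mapRefList_comp g h es]
end

/-- The shift `n` accounts for the body of a `let`, which is first traversed under its binder and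
then opened at depth 0. -/
theorem Proc.mapRef_comp {g h f : ℕ → Ref → Ref} (n : ℕ) (H : ∀ k r, h k (g (k + n) r) = f k r)
    (P : Proc) (k : ℕ) : (P.mapRef g (k + n)).mapRef h k = P.mapRef f k := by
  have H' : ∀ k, (fun r => h k (g (k + n) r)) = f k := fun k => funext (H k)
  induction P generalizing k with
  | letin e P ih =>
    have := ih (k + 1)
    rw [Nat.add_right_comm] at this
    simp [Proc.mapRef, Exp.mapRef_comp, H', this]
  | _ => simp [Proc.mapRef, Exp.mapRef_comp, Exp.mapRefList_comp, *]

mutual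
theorem Exp.mapRef_congr {g h : Ref → Ref} :
    ∀ e : Exp, (∀ r ∈ e.refs, g r = h r) → e.mapRef g = e.mapRef h
  | .fld f => by simp [Exp.mapRef]
  | .ref r => by simp [Exp.mapRef, Exp.refs]
  | .new C es => by
    intro H
    rw [Exp.mapRef, Exp.mapRef, Exp.mapRefList_congr es H]
theorem Exp.mapRefList_congr {g h : Ref → Ref} :
    ∀ es : List Exp, (∀ r ∈ Exp.refsList es, g r = h r) → Exp.mapRefList g es = Exp.mapRefList h es
  | [] => by simp [Exp.mapRefList]
  | e :: es => by
    intro H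
    rw [Exp.mapRefList, Exp.mapRefList, Exp.mapRef_congr e fun r hr => H r (by simp [Exp.refsList, hr]),
      Exp.mapRefList_congr es fun r hr => H r (by simp [Exp.refsList, hr])]
end

theorem Proc.mapRef_congr {g h : ℕ → Ref → Ref} (P : Proc) (k : ℕ)
    (H : ∀ k, ∀ r ∈ P.refs, g k r = h k r) : P.mapRef g k = P.mapRef h k := by
  induction P generalizing k with
  | nil => rfl
  | upd f e P ih =>
    simp only [Proc.refs, List.mem_append, or_imp, forall_and] at H
    rw [Proc.mapRef, Proc.mapRef, Exp.mapRef_congr e (H.1 k), ih k H.2]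
  | letin e P ih =>
    simp only [Proc.refs, List.mem_append, or_imp, forall_and] at H
    rw [Proc.mapRef, Proc.mapRef, Exp.mapRef_congr e (H.1 k), ih _ H.2]
  | send r m es P ih =>
    simp only [Proc.refs, List.mem_cons, List.mem_append, or_imp, forall_and, forall_eq] at H
    rw [Proc.mapRef, Proc.mapRef, H.1 k, Exp.mapRefList_congr es (H.2.1 k), ih k H.2.2]
  | ite e e' P Q ih1 ih2 =>
    simp only [Proc.refs, List.mem_append, or_imp, forall_and] at H
    rw [Proc.mapRef, Proc.mapRef, Exp.mapRef_congr e (H.1.1.1 k), Exp.mapRef_congr e' (H.1.1.2 k),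
      ih1 k H.1.2, ih2 k H.2]
  | plus P Q ih1 ih2 =>
    simp only [Proc.refs, List.mem_append, or_imp, forall_and] at H
    rw [Proc.mapRef, Proc.mapRef, ih1 k H.1, ih2 k H.2]

theorem Proc.mem_refs_mapRef {g : ℕ → Ref → Ref} {P : Proc} {k : ℕ} {r : Ref}
    (h : r ∈ (P.mapRef g k).refs) : ∃ k', ∃ r' ∈ P.refs, g k' r' = r := by
  rw [Proc.mem_refs_iff _ k, Proc.toks_mapRef, List.map_map, List.mem_map] at h
  obtain ⟨t, ht, e⟩ := h
  rcases t with n | ⟨k', r'⟩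
  · simp [Tok.mapRef] at e
  · simp only [Function.comp_apply, Tok.mapRef, Sum.map_inr, Sum.inr.injEq] at e
    exact ⟨k', r', (Proc.mem_refs_iff P k r').2 (List.mem_map.2 ⟨_, ht, rfl⟩), e⟩

/-! ### Fresh names -/

theorem le_length_of_forall_mem {α : Type*} {f : ℕ → α} (hf : Function.Injective f) {D : List α}
    {m : ℕ} (h : ∀ j < m, f j ∈ D) : m ≤ D.length := by
  have h1 : ((List.range m).map f).Nodup := (List.nodup_range).map hf
  have h2 : ((List.range m).map f) ⊆ D := by
    intro x hx
    obtain ⟨j, hj, rfl⟩ := List.mem_map.1 hx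
    exact h j (List.mem_range.1 hj)
  simpa using (h1.subperm h2).length_le

/-- The least number that is not mapped into a list. -/
theorem exists_least {α : Type*} {f : ℕ → α} (hf : Function.Injective f) (D : List α) :
    ∃ m ≤ D.length, f m ∉ D ∧ ∀ j < m, f j ∈ D := by
  classical
  have h : ∃ m, f m ∉ D := by
    by_contra! h
    have := le_length_of_forall_mem hf (m := D.length + 1) fun j _ => h j
    omega
  have h2 : ∀ j < Nat.find h, f j ∈ D := fun j hj => not_not.1 (Nat.find_min h hj)
  exact ⟨Nat.find h, le_length_of_forall_mem hf h2, Nat.find_spec h, h2⟩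

theorem headD_filter_range {P : ℕ → Bool} {m n : ℕ} (hm : m < n) (h1 : P m = true)
    (h2 : ∀ j < m, P j = false) : ((List.range n).filter P).headD 0 = m := by
  rw [List.headD_eq_head?_getD, List.head?_filter]
  have : (List.range n).find? P = some m := by
    rw [List.find?_range_eq_some]
    simpa [hm, h1] using h2
  rw [this]; rfl

/-- `D` lists the codes of the members of `X`. -/
def Codes (D : List ℕ) (X : List Actor) : Prop := ∀ B : Actor, B.code ∈ D ↔ B ∈ X

/-- The index of `freshActor`. -/
theorem exists_freshActor (C : ℕ) (X : List Actor) :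
    ∃ m, freshActor C X = .mk C m ∧ Actor.mk C m ∉ X ∧ ∀ j < m, Actor.mk C j ∈ X := by
  set L := X.filterMap (fun A => match A with
    | .root => none
    | .mk D i => if D = C then some i else none) with hL
  have hmem : ∀ j, j ∈ L ↔ Actor.mk C j ∈ X := by
    intro j
    simp only [hL, List.mem_filterMap]
    constructor
    · rintro ⟨A, hA, h⟩
      cases A with
      | root => simp at h
      | mk D i =>
        simp only [Option.ite_none_right_eq_some, Option.some.injEq] at h
        obtain ⟨rfl, rfl⟩ := h
        exact hA
    · exact fun h => ⟨_, h, by simp⟩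
  obtain ⟨m, h1, h2, h3⟩ := exists_least (f := id) Function.injective_id L
  refine ⟨m, ?_, fun h => h2 ((hmem m).2 h), fun j hj => (hmem j).1 (h3 j hj)⟩
  have : (leastUnused 1 L).headD 0 = m := by
    rw [leastUnused, List.headD_eq_head?_getD, List.head?_take, if_neg (by simp),
      ← List.headD_eq_head?_getD]
    exact headD_filter_range (Nat.lt_succ_of_le h1) (by simpa using h2)
      fun j hj => by simpa using h3 j hj
  change Actor.mk C ((leastUnused 1 L).headD 0) = _
  rw [this]

/-- A fresh name depends only on the set of names in use. The different bounds of the two searches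
are immaterial, as the first unused index is at most the number of names in either list. -/
theorem freshCode_eq {D : List ℕ} {X : List Actor} (h : Codes D X) (C : ℕ) :
    freshCode C D = (freshActor C X).code := by
  obtain ⟨m, h1, h2, h3⟩ := exists_freshActor C X
  have hc : ∀ j, Nat.pair C j + 1 ∈ D ↔ Actor.mk C j ∈ X := fun j => h (.mk C j)
  have hle : m ≤ D.length := le_length_of_forall_mem (f := fun j => Nat.pair C j + 1)
    (fun a b e => by simpa [Nat.pair_eq_pair] using e) fun j hj => (hc j).2 (h3 j hj)
  have hf : ((List.range (D.length + 1)).filterMap fun i =>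
      if Nat.pair C i + 1 ∈ D then none else some i) =
      (List.range (D.length + 1)).filter fun i => decide (Nat.pair C i + 1 ∉ D) := by
    rw [← List.filterMap_eq_filter]
    congr 1
    funext i
    by_cases hi : Nat.pair C i + 1 ∈ D <;> simp [hi, Option.guard]
  rw [freshCode, h1, Actor.code, hf, headD_filter_range (Nat.lt_succ_of_le hle)]
  · simpa using fun h => h2 ((hc m).1 h)
  · intro j hj; simpa using (hc j).2 (h3 j hj)

theorem freshActor_notMem (C : ℕ) (X : List Actor) : freshActor C X ∉ X := by
  obtain ⟨m, h1, h2, -⟩ := exists_freshActor C X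
  rwa [h1]

theorem mem_leastUnused {n : ℕ} {L : List ℕ} {x : ℕ} (h : x ∈ leastUnused n L) : x ∉ L := by
  have := List.mem_of_mem_take h
  simpa using (List.mem_filter.1 this).2

theorem nodup_leastUnused (n : ℕ) (L : List ℕ) : (leastUnused n L).Nodup :=
  ((List.nodup_range).filter _).take

theorem length_leastUnused (n : ℕ) (L : List ℕ) : (leastUnused n L).length = n := by
  have h1 : ((List.range (L.length + n)).filter fun i => decide (i ∈ L)).length ≤ L.length := by
    refine (((List.nodup_range).filter _).subperm ?_).length_le
    intro x hx
    simpa using (List.mem_filter.1 hx).2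
  have h2 := List.length_eq_length_filter_add (l := List.range (L.length + n))
    fun i => decide (i ∈ L)
  rw [leastUnused, List.length_take, min_eq_left]
  have h3 : ((List.range (L.length + n)).filter fun i => decide (i ∉ L)) =
      (List.range (L.length + n)).filter fun i => !decide (i ∈ L) := by
    congr 1; funext i; simp
  rw [h3]
  simp only [List.length_range] at h2
  omega

/-! ### Evaluation -/

/-- The created actors occur in the target, with the same states. -/
def Compat (T N : Config) : Prop := ∀ t ∈ N, ∃ c, T.lookup t.1 = some c ∧ c.state = t.2.state

theorem compat_append {T N N' : Config} : Compat T (N ++ N') ↔ Compat T N ∧ Compat T N' := by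
  simp [Compat, or_imp, forall_and]

/-- Execute a list of tokens. -/
def run (I : Inst) (a : ℕ) (E : Env) (ts : List ℕ) (s : List ℕ × List ℕ) :
    Option (List ℕ × List ℕ) :=
  ts.foldl (fun o t => o.bind fun s => evalTok I a E s t) (some s)

theorem foldl_bind_none {α β : Type*} (f : α → β → Option α) (l : List β) :
    l.foldl (fun o t => o.bind fun s => f s t) none = none := by
  induction l with
  | nil => rfl
  | cons x l ih => exact ih

theorem run_append (I : Inst) (a : ℕ) (E : Env) (ts ts' : List ℕ) (s : List ℕ × List ℕ) :
    run I a E (ts ++ ts') s = (run I a E ts s).bind (run I a E ts') := by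
  unfold run
  rw [List.foldl_append]
  cases ts.foldl (fun o t => o.bind fun s => evalTok I a E s t) (some s) with
  | none => exact foldl_bind_none _ _
  | some s => rfl

theorem run_singleton (I : Inst) (a : ℕ) (E : Env) (t : ℕ) (s : List ℕ × List ℕ) :
    run I a E [t] s = evalTok I a E s t := rfl

/-- The two evaluations agree, up to configurations that are incompatible with the target. -/
def Agree {β : Type} (T : Config) (r : Option (β × Config)) (o : Option (List ℕ × List ℕ))
    (Q : β → Config → List ℕ × List ℕ → Prop) : Prop :=
  (o = none ∧ ∀ U N, r = some (U, N) → ¬ Compat T N) ∨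
    ∃ U N s, r = some (U, N) ∧ Compat T N ∧ o = some s ∧ Q U N s

/-- How the actors that have been created are recorded. -/
def Tracks (news : List (ℕ × ℕ)) (D : List ℕ) (X : List Actor) (N : Config) (D' : List ℕ) : Prop :=
  (Codes D X → Codes D' (X ++ Config.dom N)) ∧ (news = [] → N = [] ∧ D' = D)

structure TargetOK (p : Program) (T : Config) : Prop where
  nodup : (Config.dom T).Nodup
  rigid : ∀ A c, T.lookup A = some c → ∀ b ∈ c.state, b.2.Rigid p.main.vars
  this : ∀ A c, T.lookup A = some c → Ref.this ∉ c.proc.refs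

/-- The interpretation of the abstract values of the actor `A` with state `φ`. -/
structure Interp (p : Program) (S T : Config) (A : Actor) (φ : State) (θ : ℕ → Value) : Prop where
  target : TargetOK p T
  good : Good (toInst p S T) θ
  state : ∃ c, T.lookup A = some c ∧ c.state = φ

section

variable {p : Program} {S T : Config}

theorem stateOf_toInst (p : Program) (S T : Config) (A : Actor) :
    (toInst p S T).stateOf A.code =
      (T.lookup A).map fun c => c.state.map fun b => (b.1, b.2.code) := by
  unfold Inst.stateOf toInst Inst.tgt Config.toCode
  dsimp only
  rw [lookup_map_inj Actor.code_injective, Option.map_map]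
  rfl

theorem eq_zip_iff {α β : Type*} {l : List (α × β)} {as : List α} {bs : List β} :
    bs.length = as.length ∧ l = as.zip bs ↔ l.map Prod.fst = as ∧ l.map Prod.snd = bs := by
  constructor
  · rintro ⟨h, rfl⟩
    exact ⟨List.map_fst_zip (by omega), List.map_snd_zip (by omega)⟩
  · rintro ⟨rfl, rfl⟩
    refine ⟨by simp, ?_⟩
    induction l with
    | nil => rfl
    | cons x l ih => simp [← ih]

/-- Execution of a token that creates an actor. -/
theorem evalTok_new {A : Actor} {φ : State} {θ : ℕ → Value} (h : Interp p S T A φ θ) (E : Env)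
    {us st D : List ℕ} {X : List Actor} (hC : Codes D X) (C : ℕ) :
    ((us.map θ).length = (p.fields C).length ∧ ∃ c, T.lookup (freshActor C X) = some c ∧
        c.state = (p.fields C).zip (us.map θ)) ∧
      evalTok (toInst p S T) A.code E (us.reverse ++ st, D)
        (2 * Nat.pair 1 (Nat.pair C us.length) + 1) =
          some ((Value.act (freshActor C X)).code :: st, (freshActor C X).code :: D) ∨
    ¬ ((us.map θ).length = (p.fields C).length ∧ ∃ c, T.lookup (freshActor C X) = some c ∧
        c.state = (p.fields C).zip (us.map θ)) ∧
      evalTok (toInst p S T) A.code E (us.reverse ++ st, D)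
        (2 * Nat.pair 1 (Nat.pair C us.length) + 1) = none := by
  have e1 : (2 * Nat.pair 1 (Nat.pair C us.length) + 1) % 2 ≠ 0 := by omega
  have e2 : (2 * Nat.pair 1 (Nat.pair C us.length) + 1) / 2 =
    Nat.pair 1 (Nat.pair C us.length) := by omega
  have e3 : ((us.reverse ++ st).take us.length).reverse = us := by
    rw [List.take_left' (by simp), List.reverse_reverse]
  have e4 : (us.reverse ++ st).drop us.length = st := List.drop_left' (by simp)
  rw [evalTok, if_neg e1, e2, Nat.unpair_pair]
  dsimp only
  rw [if_neg one_ne_zero, if_pos rfl, Nat.unpair_pair]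
  dsimp only
  rw [e3, e4, freshCode_eq hC, stateOf_toInst]
  set B := freshActor C X with hB
  have key : (((T.lookup B).map fun c => c.state.map fun b => (b.1, b.2.code)).map fun φ =>
        (φ.map Prod.fst, φ.map Prod.snd)) = some ((toInst p S T).fields C, us) ↔
      (us.map θ).length = (p.fields C).length ∧
        ∃ c, T.lookup B = some c ∧ c.state = (p.fields C).zip (us.map θ) := by
    rw [Option.map_map]
    constructor
    · intro hk
      simp only [Option.map_eq_some_iff, Function.comp_apply, List.map_map, Prod.mk.injEq] at hk
      obtain ⟨c, hc, hk1, hk2⟩ := hk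
      have hk3 : c.state.map Prod.snd = us.map θ := by
        rw [← hk2, List.map_map]
        refine List.map_congr_left fun b hb => ?_
        exact (h.good.rigid b.2 ((rigidCode_iff p S T _).2 (h.target.rigid B c hc b hb))).symm
      have hk4 : c.state.map Prod.fst = p.fields C := by rw [← show _ = p.fields C from hk1]; rfl
      have := eq_zip_iff.2 ⟨hk4, hk3⟩
      exact ⟨this.1, c, hc, this.2⟩
    · rintro ⟨hl, c, hc, hs⟩
      obtain ⟨hk4, hk3⟩ := eq_zip_iff.1 ⟨hl, hs⟩
      rw [hc]
      simp only [Option.map_some, Function.comp_apply, List.map_map, Option.some.injEq,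
        Prod.mk.injEq]
      refine ⟨by rw [show (toInst p S T).fields C = p.fields C from rfl, ← hk4]; rfl, ?_⟩
      refine (h.good.inj.list_map) ?_
      rw [← hk3, List.map_map]
      refine List.map_congr_left fun b hb => ?_
      exact h.good.rigid b.2 ((rigidCode_iff p S T _).2 (h.target.rigid B c hc b hb))
  rw [← key]
  by_cases hk : (((T.lookup B).map fun c => c.state.map fun b => (b.1, b.2.code)).map fun φ =>
        (φ.map Prod.fst, φ.map Prod.snd)) = some ((toInst p S T).fields C, us)
  · exact .inl ⟨hk, if_pos hk⟩
  · exact .inr ⟨hk, if_neg hk⟩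

-- The stack machine computes the recursive evaluation. The stack `st` is arbitrary, so that runs
-- can be composed. Names in use have to be tracked only if something is created: for actors other
-- than the root the second alternative of `Codes D X ∨ e.news = []` applies.
mutual
theorem Exp.agree {A : Actor} {φ : State} {θ : ℕ → Value} (h : Interp p S T A φ θ) (E : Env) :
    ∀ (e : Exp) (st D : List ℕ) (X : List Actor), (Codes D X ∨ e.news = []) →
      Agree T ((e.mapRef (closure A.code E θ 0)).eval p φ X)
        (run (toInst p S T) A.code E ((e.toks 0).map Tok.code) (st, D))
        fun U N s => (∃ u, s.1 = u :: st ∧ θ u = U) ∧ Tracks e.news D X N s.2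
  | .fld f, st, D, X => by
    intro _
    obtain ⟨c, hc, rfl⟩ := h.state
    have e0 : run (toInst p S T) A.code E (((Exp.fld f).toks 0).map Tok.code) (st, D) =
        (c.state.lookup f).map fun V => (V.code :: st, D) := by
      simp only [Exp.toks, List.map_cons, List.map_nil, run_singleton]
      have h1 : ∀ n, (2 * n + 1) % 2 ≠ 0 := by omega
      have h2 : ∀ n, (2 * n + 1) / 2 = n := by omega
      simp only [evalTok, Tok.code, h1, h2, if_false, Nat.unpair_pair, if_true, stateOf_toInst, hc,
        Option.map_some, Option.bind_some]
      have := lookup_map_inj (f := id) Function.injective_id Value.code c.state f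
      simp only [id] at this
      rw [this, Option.map_map]
      rfl
    rw [e0]
    simp only [Exp.mapRef, Exp.eval]
    cases hl : c.state.lookup f with
    | none => exact .inl ⟨rfl, by simp⟩
    | some V =>
      have hV := h.target.rigid A c hc _ (lookup_mem hl)
      exact .inr ⟨V, [], (V.code :: st, D), rfl, by simp [Compat], rfl, ⟨_, rfl,
        h.good.rigid V ((rigidCode_iff p S T V).2 hV)⟩, by simp [Config.dom], by simp⟩
  | .ref r, st, D, X => by
    intro _
    have e0 : run (toInst p S T) A.code E (((Exp.ref r).toks 0).map Tok.code) (st, D) =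
        (resolve A.code E (Nat.pair 0 r.code)).map fun v => (v :: st, D) := by
      simp [Exp.toks, run_singleton, evalTok, Tok.code]
    rw [e0]
    simp only [Exp.mapRef, closure]
    cases hr : resolve A.code E (Nat.pair 0 r.code) with
    | none =>
      refine .inl ⟨rfl, ?_⟩
      cases r with
      | val V =>
        obtain ⟨v, hv⟩ := resolve_val A.code E 0 V
        rw [hv] at hr; cases hr
      | bvar i => simp [Exp.eval]
      | this => simp [Exp.eval]
    | some v =>
      exact .inr ⟨θ v, [], (v :: st, D), by simp [Exp.eval], by simp [Compat], rfl, ⟨_, rfl, rfl⟩,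
        by simp [Config.dom], by simp⟩
  | .new C es, st, D, X => by
    intro hD
    have hD : Codes D X := hD.resolve_right (by simp [Exp.news])
    simp only [Exp.toks, Exp.mapRef, Exp.eval, List.map_append, List.map_cons, List.map_nil,
      run_append]
    rcases Exp.agreeList h E es st D X (.inl hD) with ⟨h1, h2⟩ | ⟨Us, N, s, h1, h2, h3, ⟨us, h4, h5, h6⟩,
      h7, h8⟩
    · refine .inl ⟨by rw [h1]; rfl, ?_⟩
      intro U N hN
      split at hN
      · cases hN
      · rename_i Us N' hev
        split_ifs at hN
        cases hN
        exact fun hc => h2 _ _ hev fun t ht => hc t (List.mem_cons_of_mem _ ht)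
    · rw [h1, h3]
      simp only [Option.bind_some, run_singleton]
      have hC := h7 hD
      obtain ⟨s1, s2⟩ := s
      subst h4
      subst h5
      rw [Tok.code, ← h6]
      rcases evalTok_new h E hC C with ⟨⟨hl, c, hc, hs⟩, hk⟩ | ⟨hn, hk⟩
      · rw [hk, if_pos hl]
        refine .inr ⟨_, _, _, rfl, ?_, rfl, ⟨_, rfl, ?_⟩, ?_, by simp [Exp.news]⟩
        · intro t ht
          rcases List.mem_cons.1 ht with rfl | ht
          · exact ⟨c, hc, hs⟩
          · exact h2 t ht
        · exact h.good.rigid _ (by left; simp [Value.code])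
        · intro _ B'
          rw [List.mem_cons, hC B', Actor.code_injective.eq_iff]
          simp only [Config.dom, List.map_cons, List.mem_append, List.mem_cons]
          tauto
      · rw [hk]
        refine .inl ⟨rfl, ?_⟩
        intro U N' hN hc
        split_ifs at hN with hl
        cases hN
        exact hn ⟨hl, hc _ List.mem_cons_self⟩
theorem Exp.agreeList {A : Actor} {φ : State} {θ : ℕ → Value} (h : Interp p S T A φ θ) (E : Env) :
    ∀ (es : List Exp) (st D : List ℕ) (X : List Actor), (Codes D X ∨ Exp.newsList es = []) →
      Agree T (Exp.evalList p φ X (Exp.mapRefList (closure A.code E θ 0) es))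
        (run (toInst p S T) A.code E ((Exp.toksList 0 es).map Tok.code) (st, D))
        fun Us N s => (∃ us : List ℕ, s.1 = us.reverse ++ st ∧ us.map θ = Us ∧ us.length = es.length) ∧
          Tracks (Exp.newsList es) D X N s.2
  | [], st, D, X => by
    intro _
    exact .inr ⟨[], [], (st, D), by simp [Exp.mapRefList, Exp.evalList], by simp [Compat],
      by simp [Exp.toksList, run], ⟨[], by simp⟩, by simp [Config.dom], by simp⟩
  | e :: es, st, D, X => by
    intro hD
    simp only [Exp.toksList, Exp.mapRefList, Exp.evalList, List.map_append, run_append, Exp.newsList,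
      List.append_eq_nil_iff] at hD ⊢
    rcases Exp.agree h E e st D X (hD.imp_right And.left) with ⟨h1, h2⟩ | ⟨U, N, s, h1, h2, h3,
      ⟨u, h4, h5⟩, h6, h7⟩
    · refine .inl ⟨by rw [h1]; rfl, ?_⟩
      intro Us N hN
      split at hN
      · cases hN
      · rename_i U N' hev
        split at hN
        · cases hN
        · cases hN
          exact fun hc => h2 _ _ hev (compat_append.1 hc).1
    · rw [h1, h3]
      simp only [Option.bind_some]
      obtain ⟨s1, s2⟩ := s
      subst h4
      have hD' : Codes s2 (X ++ Config.dom N) ∨ Exp.newsList es = [] := hD.imp h6 And.right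
      rcases Exp.agreeList h E es (u :: st) s2 (X ++ Config.dom N) hD' with ⟨k1, k2⟩ |
        ⟨Us, N', s', k1, k2, k3, ⟨us, k4, k5, k6⟩, k7, k8⟩
      · refine .inl ⟨k1, ?_⟩
        intro Us N' hN
        split at hN
        · cases hN
        · rename_i Us' N'' hev
          cases hN
          exact fun hc => k2 _ _ hev (compat_append.1 hc).2
      · rw [k1]
        refine .inr ⟨U :: Us, N ++ N', s', rfl, compat_append.2 ⟨h2, k2⟩, k3,
          ⟨u :: us, by simp [k4], by simp [h5, k5], by simp [k6]⟩, fun hc => ?_, fun hn => ?_⟩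
        · have := k7 (h6 hc)
          simpa [Config.dom] using this
        · obtain ⟨rfl, hs⟩ := h7 (List.append_eq_nil_iff.1 hn).1
          obtain ⟨rfl, hs'⟩ := k8 (List.append_eq_nil_iff.1 hn).2
          exact ⟨rfl, hs'.trans hs⟩
end

end

/-! ### The actors that are created -/

/-- What is known of an actor `t` that is among the created actors `N`, the actor names in use being
those in `X`, and `K` being the names to which the evaluated expression has access. -/
structure NewCell (K : Actor → Prop) (X : List Actor) (N : Config) (t : Actor × Cell) : Prop where
  proc : t.2.proc = .nil
  queue : t.2.queue = []
  fresh : t.1 ∉ X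
  ne_root : t.1 ≠ .root
  named : ∀ B, .act B ∈ t.2.state.map Prod.snd → K B ∨ B ∈ Config.dom N

theorem NewCell.mono {K : Actor → Prop} {X X' : List Actor} {N N' : Config} {t : Actor × Cell}
    (h : NewCell K X N t) (hX : ∀ B ∈ X', B ∈ X) (hN : ∀ B ∈ Config.dom N, B ∈ Config.dom N') :
    NewCell K X' N' t :=
  ⟨h.proc, h.queue, fun hB => h.fresh (hX _ hB), h.ne_root, fun B hB => (h.named B hB).imp_right (hN B)⟩

-- Evaluation invents no actor names: those in its result are accessible beforehand or just created.
-- This keeps every name mentioned in a configuration among its actors, and shows that created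
-- actors are new, distinct and without work.
mutual
theorem Exp.eval_spec (p : Program) {φ : State} (K : Actor → Prop)
    (hK : ∀ B, .act B ∈ φ.map Prod.snd → K B) : ∀ (e : Exp) (X : List Actor),
    (∀ B, .val (.act B) ∈ e.refs → K B) → ∀ U N, e.eval p φ X = some (U, N) →
      (∀ B, U = .act B → K B ∨ B ∈ Config.dom N) ∧ (∀ t ∈ N, NewCell K X N t) ∧
        (Config.dom N).Nodup
  | .fld f, X => by
    intro _ U N h
    simp only [Exp.eval, Option.map_eq_some_iff, Prod.mk.injEq] at h
    obtain ⟨V, hV, rfl, rfl⟩ := h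
    refine ⟨?_, by simp, by simp [Config.dom]⟩
    rintro B rfl
    exact .inl (hK B (List.mem_map.2 ⟨_, lookup_mem hV, rfl⟩))
  | .ref r, X => by
    intro h2 U N h
    cases r <;> simp only [Exp.eval, Option.some.injEq, Prod.mk.injEq, reduceCtorEq] at h
    obtain ⟨rfl, rfl⟩ := h
    refine ⟨?_, by simp, by simp [Config.dom]⟩
    rintro B rfl
    exact .inl (h2 B (by simp [Exp.refs]))
  | .new C es, X => by
    intro h2 U N h
    simp only [Exp.eval] at h
    split at h
    · cases h
    · rename_i Us N' hev
      split_ifs at h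
      cases h
      obtain ⟨k1, k2, k3⟩ := Exp.evalList_spec p K hK es X h2 Us N' hev
      have hf := freshActor_notMem C (X ++ Config.dom N')
      have hsub : ∀ c, ∀ B ∈ Config.dom N', B ∈ Config.dom
          ((freshActor C (X ++ Config.dom N'), c) :: N') := by
        intro c B hB
        exact List.mem_cons_of_mem _ hB
      refine ⟨?_, ?_, List.nodup_cons.2 ⟨fun h => hf (List.mem_append_right _ h), k3⟩⟩
      · rintro B hB
        cases hB
        exact .inr List.mem_cons_self
      · intro t ht
        rcases List.mem_cons.1 ht with rfl | ht
        · refine ⟨rfl, rfl, fun h => hf (List.mem_append_left _ h), by simp [freshActor], ?_⟩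
          intro B hB
          refine (k1 B ?_).imp_right (hsub _ B)
          obtain ⟨b, hb, hb'⟩ := List.mem_map.1 hB
          rw [← hb']
          exact (List.of_mem_zip hb).2
        · exact (k2 t ht).mono (fun _ h => h) (hsub _)
theorem Exp.evalList_spec (p : Program) {φ : State} (K : Actor → Prop)
    (hK : ∀ B, .act B ∈ φ.map Prod.snd → K B) : ∀ (es : List Exp) (X : List Actor),
    (∀ B, .val (.act B) ∈ Exp.refsList es → K B) →
    ∀ Us N, Exp.evalList p φ X es = some (Us, N) →
      (∀ B, .act B ∈ Us → K B ∨ B ∈ Config.dom N) ∧ (∀ t ∈ N, NewCell K X N t) ∧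
        (Config.dom N).Nodup
  | [], X => by
    intro _ Us N h
    simp only [Exp.evalList, Option.some.injEq, Prod.mk.injEq] at h
    obtain ⟨rfl, rfl⟩ := h
    simp [Config.dom]
  | e :: es, X => by
    intro h2 Us NN h
    simp only [Exp.evalList] at h
    split at h
    · cases h
    · rename_i U N hev
      split at h
      · cases h
      · rename_i Us' N' hev'
        cases h
        obtain ⟨k1, k2, k5⟩ := Exp.eval_spec p K hK e X (fun B hB => h2 B (by simp [Exp.refsList, hB]))
          U N hev
        obtain ⟨k3, k4, k6⟩ := Exp.evalList_spec p K hK es (X ++ Config.dom N)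
          (fun B hB => h2 B (by simp [Exp.refsList, hB])) Us' N' hev'
        have e1 : Config.dom (N ++ N') = Config.dom N ++ Config.dom N' := by
          simp [Config.dom]
        rw [e1]
        have l1 : ∀ B ∈ Config.dom N, B ∈ Config.dom (N ++ N') := fun B hB => by
          rw [e1]; exact List.mem_append_left _ hB
        have l2 : ∀ B ∈ Config.dom N', B ∈ Config.dom (N ++ N') := fun B hB => by
          rw [e1]; exact List.mem_append_right _ hB
        refine ⟨?_, ?_, ?_⟩
        · intro B hB
          rcases List.mem_cons.1 hB with hB | hB
          · exact (k1 B hB.symm).imp_right (List.mem_append_left _)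
          · exact (k3 B hB).imp_right (List.mem_append_right _)
        · intro t ht
          rcases List.mem_append.1 ht with ht | ht
          · exact (k2 t ht).mono (fun _ h => h) l1
          · exact (k4 t ht).mono (fun _ h => List.mem_append_left _ h) l2
        · refine List.nodup_append.2 ⟨k5, k6, ?_⟩
          rintro B hB B' hB' rfl
          obtain ⟨t, ht, rfl⟩ := List.mem_map.1 hB'
          exact (k4 t ht).fresh (List.mem_append_right _ hB)
end

/-! ### Steps as local actions -/

/-- The message that `B` receives. -/
def emOf (em : Option (Actor × Msg)) (B : Actor) : Option Msg :=
  em.bind fun e => if e.1 = B then some e.2 else none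

def Cell.receive (c : Cell) (o : Option Msg) : Cell := ⟨c.proc, c.state, c.queue ++ o.toList⟩

/-- Replace what `A` carries, and deliver a message. -/
def Config.update (S : Config) (A : Actor) (c : Cell) (em : Option (Actor × Msg)) : Config :=
  S.map fun t => (t.1, (if t.1 = A then c else t.2).receive (emOf em t.1))

theorem Cell.receive_none (c : Cell) : c.receive none = c := by
  simp [Cell.receive]

theorem Config.set_eq_update (S : Config) (A : Actor) (c : Cell) : S.set A c = S.update A c none := by
  refine List.map_congr_left fun t _ => ?_
  rw [show emOf none t.1 = none from rfl, Cell.receive_none]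
  split_ifs with h
  · rw [h]
  · rfl

theorem Config.push_set_eq_update (S : Config) (A B : Actor) (c : Cell) (x : Msg) :
    (S.set A c).push B x = S.update A c (some (B, x)) := by
  rw [Config.set, Config.push, List.map_map]
  refine List.map_congr_left fun t _ => ?_
  have h1 : (if t.1 = A then (A, c) else t) = (t.1, if t.1 = A then c else t.2) := by
    split_ifs with h
    · rw [h]
    · rfl
  simp only [Function.comp_apply, h1]
  by_cases hB : t.1 = B
  · simp [hB, emOf, Cell.receive]
  · simp [hB, emOf, Cell.receive, Ne.symm hB]

theorem lookup_map_key {α β β' : Type*} [DecidableEq α] (f : α → β → β') (l : List (α × β)) (a : α) :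
    (l.map fun t => (t.1, f t.1 t.2)).lookup a = (l.lookup a).map (f a) := by
  induction l with
  | nil => rfl
  | cons x l ih =>
    obtain ⟨b, c⟩ := x
    by_cases h : a = b
    · subst h; simp
    · have : (a == b) = false := by simpa using h
      simp only [List.map_cons, List.lookup_cons, this, ih]

theorem lookup_of_mem {α β : Type*} [DecidableEq α] {l : List (α × β)} (h : (l.map Prod.fst).Nodup)
    {t : α × β} (ht : t ∈ l) : l.lookup t.1 = some t.2 := by
  induction l with
  | nil => cases ht
  | cons x l ih =>
    obtain ⟨b, c⟩ := x
    rw [List.map_cons, List.nodup_cons] at h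
    rcases List.mem_cons.1 ht with rfl | ht'
    · simp
    · have hb : t.1 ≠ b := by
        rintro rfl
        exact h.1 (List.mem_map.2 ⟨t, ht', rfl⟩)
      have : (t.1 == b) = false := by simpa using hb
      simp only [List.lookup_cons, this, ih h.2 ht']

theorem Config.mem_dom_iff (S : Config) (A : Actor) :
    A ∈ Config.dom S ↔ ∃ c, S.lookup A = some c := by
  constructor
  · intro h
    cases hl : S.lookup A with
    | some c => exact ⟨c, rfl⟩
    | none =>
      rw [List.lookup_eq_none_iff] at hl
      obtain ⟨t, ht, rfl⟩ := List.mem_map.1 h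
      simpa using hl t ht
  · rintro ⟨c, hc⟩
    exact List.mem_map.2 ⟨_, lookup_mem hc, rfl⟩

theorem Config.dom_append (S N : Config) : Config.dom (S ++ N) = Config.dom S ++ Config.dom N := by
  simp [Config.dom]

theorem Config.dom_update (S : Config) (A : Actor) (c : Cell) (em : Option (Actor × Msg)) :
    Config.dom (S.update A c em) = Config.dom S := by
  simp [Config.dom, Config.update]

theorem Config.lookup_update (S : Config) (A : Actor) (c : Cell) (em : Option (Actor × Msg))
    (B : Actor) : (S.update A c em).lookup B =
      (S.lookup B).map fun c' => (if B = A then c else c').receive (emOf em B) :=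
  lookup_map_key (fun B c' => (if B = A then c else c').receive (emOf em B)) S B

/-- What a process does, apart from updates. -/
inductive Act (p : Program) (X : List Actor) (φ : State) :
    Proc → Proc → Option (Actor × Msg) → Config → Prop
  | letin {e : Exp} {P : Proc} {U : Value} {N : Config} (he : e.eval p φ X = some (U, N)) :
      Act p X φ (.letin e P) (P.openWith U) none N
  | send {B : Actor} {m : ℕ} {es : List Exp} {P : Proc} {Us : List Value} {N : Config}
      (he : Exp.evalList p φ X es = some (Us, N)) :
      Act p X φ (.send (.val (.act B)) m es P) P (some (B, (m, Us))) N
  | iteTrue {e e' : Exp} {P Q : Proc} {U : Value} {N : Config}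
      (he : Exp.evalList p φ X [e, e'] = some ([U, U], N)) : Act p X φ (.ite e e' P Q) P none N
  | iteFalse {e e' : Exp} {P Q : Proc} {U V : Value} {N : Config}
      (he : Exp.evalList p φ X [e, e'] = some ([U, V], N)) (hne : U ≠ V) :
      Act p X φ (.ite e e' P Q) Q none N
  | plusLeft {P Q : Proc} : Act p X φ (.plus P Q) P none []
  | plusRight {P Q : Proc} : Act p X φ (.plus P Q) Q none []

theorem Act.step {p : Program} {S : Config} {A : Actor} {c : Cell} {P : Proc}
    {em : Option (Actor × Msg)} {N : Config} (hA : S.lookup A = some c)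
    (h : Act p (Config.dom S) c.state c.proc P em N) (hem : ∀ e, em = some e → e.1 ∈ Config.dom S) :
    Step p S (S.update A ⟨P, c.state, c.queue⟩ em ++ N) := by
  obtain ⟨P₀, φ, q⟩ := c
  dsimp only at h ⊢
  cases h with
  | letin he => rw [← Config.set_eq_update]; exact .letin hA he
  | send he => rw [← Config.push_set_eq_update]; exact .invk hA (hem _ rfl) he
  | iteTrue he => rw [← Config.set_eq_update]; exact .eqTrue hA he
  | iteFalse he hne => rw [← Config.set_eq_update]; exact .eqFalse hA he hne
  | plusLeft => rw [← Config.set_eq_update, List.append_nil]; exact .plusLeft hA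
  | plusRight => rw [← Config.set_eq_update, List.append_nil]; exact .plusRight hA

/-- A step is an action or starts a method. -/
theorem Step.cases_of_updFree {p : Program} {S S' : Config} (h : Step p S S')
    (hU : ∀ A c, S.lookup A = some c → c.proc.UpdFree) :
    (∃ A c P em N, S.lookup A = some c ∧ Act p (Config.dom S) c.state c.proc P em N ∧
      S' = S.update A ⟨P, c.state, c.queue⟩ em ++ N) ∨
    ∃ C i φ q d Us, S.lookup (.mk C i) = some ⟨.nil, φ, (d.name, Us) :: q⟩ ∧ d ∈ p.methods ∧
      d.cls = C ∧ Us.length = d.params.length ∧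
      S' = S.update (.mk C i) ⟨d.start p S (.mk C i) Us, φ, q⟩ none := by
  cases h with
  | upd hA hf he => exact (hU _ _ hA).elim
  | letin hA he =>
    exact .inl ⟨_, _, _, _, _, hA, .letin he, by rw [Config.set_eq_update]⟩
  | invk hA hB he =>
    exact .inl ⟨_, _, _, _, _, hA, .send he, by rw [Config.push_set_eq_update]⟩
  | inst hA hd hC hlen =>
    exact .inr ⟨_, _, _, _, _, _, hA, hd, hC, hlen, by rw [Config.set_eq_update]⟩
  | eqTrue hA he =>
    exact .inl ⟨_, _, _, _, _, hA, .iteTrue he, by rw [Config.set_eq_update]⟩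
  | eqFalse hA he hne =>
    exact .inl ⟨_, _, _, _, _, hA, .iteFalse he hne, by rw [Config.set_eq_update]⟩
  | plusLeft hA =>
    exact .inl ⟨_, _, _, _, _, hA, .plusLeft, by rw [Config.set_eq_update, List.append_nil]⟩
  | plusRight hA =>
    exact .inl ⟨_, _, _, _, _, hA, .plusRight, by rw [Config.set_eq_update, List.append_nil]⟩

theorem Act.spec {p : Program} {X : List Actor} {φ : State} {P P' : Proc} {em : Option (Actor × Msg)}
    {N : Config} (h : Act p X φ P P' em N) (K : Actor → Prop)
    (hφ : ∀ B, .act B ∈ φ.map Prod.snd → K B) (hP : ∀ B, .val (.act B) ∈ P.refs → K B) :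
    (∀ B, .val (.act B) ∈ P'.refs → K B ∨ B ∈ Config.dom N) ∧
    (∀ e, em = some e → K e.1 ∧ ∀ B, .act B ∈ e.2.2 → K B ∨ B ∈ Config.dom N) ∧
    (∀ t ∈ N, NewCell K X N t) ∧ (Config.dom N).Nodup := by
  cases h with
  | @letin e P U N he =>
    obtain ⟨h1, h2, h3⟩ := Exp.eval_spec p K hφ _ X (fun B hB => hP B (by simp [Proc.refs, hB])) _ _ he
    refine ⟨fun B hB => ?_, by simp, h2, h3⟩
    obtain ⟨k, r, hr, e⟩ := Proc.mem_refs_mapRef hB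
    split_ifs at e with h
    · exact h1 B (by simpa using e)
    · subst e; exact .inl (hP B (by simp [Proc.refs, hr]))
  | send he =>
    obtain ⟨h1, h2, h3⟩ := Exp.evalList_spec p K hφ _ X (fun B hB => hP B (by simp [Proc.refs, hB]))
      _ _ he
    refine ⟨fun B hB => .inl (hP B (by simp [Proc.refs, hB])), ?_, h2, h3⟩
    rintro e ⟨⟩
    exact ⟨hP _ (by simp [Proc.refs]), h1⟩
  | iteTrue he =>
    obtain ⟨h1, h2, h3⟩ := Exp.evalList_spec p K hφ _ X
      (fun B hB => hP B (by simp [Exp.refsList] at hB; simp [Proc.refs]; tauto)) _ _ he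
    exact ⟨fun B hB => .inl (hP B (by simp [Proc.refs, hB])), by simp, h2, h3⟩
  | iteFalse he =>
    obtain ⟨h1, h2, h3⟩ := Exp.evalList_spec p K hφ _ X
      (fun B hB => hP B (by simp [Exp.refsList] at hB; simp [Proc.refs]; tauto)) _ _ he
    exact ⟨fun B hB => .inl (hP B (by simp [Proc.refs, hB])), by simp, h2, h3⟩
  | plusLeft =>
    exact ⟨fun B hB => .inl (hP B (by simp [Proc.refs, hB])), by simp, by simp, by simp [Config.dom]⟩
  | plusRight =>
    exact ⟨fun B hB => .inl (hP B (by simp [Proc.refs, hB])), by simp, by simp, by simp [Config.dom]⟩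

theorem Proc.updFree_mapRef {g : ℕ → Ref → Ref} {P : Proc} {k : ℕ} :
    (P.mapRef g k).UpdFree ↔ P.UpdFree := by
  induction P generalizing k <;> simp [Proc.mapRef, Proc.UpdFree, *]

theorem Act.updFree {p : Program} {X : List Actor} {φ : State} {P P' : Proc}
    {em : Option (Actor × Msg)} {N : Config} (h : Act p X φ P P' em N) (hP : P.UpdFree) :
    P'.UpdFree := by
  cases h with
  | letin he => exact Proc.updFree_mapRef.2 hP
  | send he => exact hP
  | iteTrue he => exact hP.1
  | iteFalse he => exact hP.2
  | plusLeft => exact hP.1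
  | plusRight => exact hP.2

-- What persists along a run.

/-- Actor names do not repeat, and there are no updates. -/
structure Sane (S : Config) : Prop where
  nodup : (Config.dom S).Nodup
  updFree : ∀ A c, S.lookup A = some c → c.proc.UpdFree

theorem lookup_update_append {S N : Config} {A B : Actor} {c c' : Cell} {em : Option (Actor × Msg)}
    (h : (S.update A c em ++ N).lookup B = some c') :
    (∃ c₁, S.lookup B = some c₁ ∧ c' = (if B = A then c else c₁).receive (emOf em B)) ∨
      S.lookup B = none ∧ N.lookup B = some c' := by
  rw [List.lookup_append, Config.lookup_update] at h
  cases hl : S.lookup B with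
  | none => right; simpa [hl] using h
  | some c₁ => left; exact ⟨c₁, rfl, by simpa [hl, eq_comm] using h⟩

theorem Config.nodup_update_append {S N : Config} (hS : (Config.dom S).Nodup)
    (hN : (Config.dom N).Nodup) (h : ∀ t ∈ N, t.1 ∉ Config.dom S) (A : Actor) (c : Cell)
    (em : Option (Actor × Msg)) : (Config.dom (S.update A c em ++ N)).Nodup := by
  rw [Config.dom_append, Config.dom_update]
  refine List.nodup_append.2 ⟨hS, hN, ?_⟩
  rintro B hB B' hB' rfl
  obtain ⟨t, ht, rfl⟩ := List.mem_map.1 hB'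
  exact h t ht hB

theorem Sane.update {S N : Config} (h : Sane S) {A : Actor} {c : Cell} {em : Option (Actor × Msg)}
    (hc : c.proc.UpdFree) (hN : (Config.dom N).Nodup)
    (h' : ∀ t ∈ N, t.1 ∉ Config.dom S ∧ t.2.proc = .nil) : Sane (S.update A c em ++ N) := by
  refine ⟨Config.nodup_update_append h.nodup hN (fun t ht => (h' t ht).1) A c em, ?_⟩
  intro B c' hc'
  rcases lookup_update_append hc' with ⟨c₁, h1, rfl⟩ | ⟨-, h1⟩
  · simp only [Cell.receive]
    split_ifs
    · exact hc
    · exact h.updFree B c₁ h1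
  · rw [(h' _ (lookup_mem h1)).2]
    trivial

theorem Step.sane {p : Program} (hp : p.ReadOnly) {S S' : Config} (h : Step p S S') (hS : Sane S) :
    Sane S' := by
  rcases h.cases_of_updFree hS.updFree with ⟨A, c, P, em, N, hA, ha, rfl⟩ |
    ⟨C, i, φ, q, d, Us, hA, hd, hC, hl, rfl⟩
  · obtain ⟨-, -, h3, h4⟩ := ha.spec (fun _ => True) (fun _ _ => trivial) fun _ _ => trivial
    exact hS.update (ha.updFree (hS.updFree _ _ hA)) h4 fun t ht => ⟨(h3 t ht).fresh, (h3 t ht).proc⟩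
  · rw [← List.append_nil (S.update _ _ _)]
    exact hS.update (Proc.updFree_mapRef.2 (hp.2 d hd)) (by simp [Config.dom]) (by simp)

theorem compat_of_update {T S N : Config} (hS : (Config.dom S).Nodup) {A : Actor} {c c' : Cell}
    {em : Option (Actor × Msg)} (hA : S.lookup A = some c) (hc : c'.state = c.state)
    (h : Compat T (S.update A c' em ++ N)) : Compat T S := by
  intro t ht
  obtain ⟨c₁, h1, h2⟩ := (compat_append.1 h).1 (t.1, (if t.1 = A then c' else t.2).receive (emOf em t.1))
    (List.mem_map.2 ⟨t, ht, rfl⟩)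
  refine ⟨c₁, h1, h2.trans ?_⟩
  simp only [Cell.receive]
  split_ifs with h3
  · have := lookup_of_mem hS ht
    rw [h3, hA, Option.some.injEq] at this
    rw [hc, this]
  · rfl

/-- Actors present before the step are present afterwards with the same states, so compatibility
with the target is inherited backwards. -/
theorem Step.compat {p : Program} {T S S' : Config} (h : Step p S S') (hS : Sane S)
    (hT : Compat T S') : Compat T S := by
  rcases h.cases_of_updFree hS.updFree with ⟨A, c, P, em, N, hA, ha, rfl⟩ |
    ⟨C, i, φ, q, d, Us, hA, hd, hC, hl, rfl⟩
  · exact compat_of_update (c' := ⟨P, c.state, c.queue⟩) hS.nodup hA rfl hT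
  · rw [← List.append_nil (S.update _ _ _)] at hT
    exact compat_of_update (c' := ⟨d.start p S (.mk C i) Us, φ, q⟩) hS.nodup hA rfl hT

section

variable {p : Program} {S₀ T : Config}

/-! ### Simulation of the actions -/

def letterOf (I : Inst) (x : Msg) : Letter := (x.1, canonVals I (x.2.map Value.code))

/-- The control `q` represents the process `P'` of the actor `A`. -/
def CtrlRel (I : Inst) (A : Actor) (P' : Proc) (q : Ctrl) : Prop :=
  ∃ (P : Proc) (θ : ℕ → Value), Good I θ ∧ P.code = q.1 ∧
    P' = P.mapRef (closure A.code q.2.1 θ) 0 ∧ P.UpdFree ∧ (A ≠ .root → P.news = []) ∧ norm q = q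

theorem norm_snd_snd (q : Ctrl) : (norm q).2.2 = q.2.2 := by
  unfold norm; split_ifs <;> rfl

theorem Proc.code_eq_zero {P : Proc} (h : P.code = 0) : P = .nil := by
  have h0 : ∀ {a b : ℕ}, Nat.pair a b = 0 → a = 0 := fun {a b} h => by
    have := Nat.left_le_pair a b; omega
  cases P with
  | nil => rfl
  | _ => exact absurd (h0 h) (by norm_num)

theorem CtrlRel.mk {I : Inst} {A : Actor} {θ : ℕ → Value} (hθ : Good I θ) {P P' : Proc} {E : Env}
    (D : List ℕ) (h : P' = P.mapRef (closure A.code E θ) 0) (hU : P.UpdFree)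
    (hN : A ≠ .root → P.news = []) : CtrlRel I A P' (norm (P.code, E, D)) := by
  by_cases h0 : P.code = 0
  · obtain rfl := Proc.code_eq_zero h0
    have e : norm (Proc.nil.code, E, D) = (0, ([], ([], []), 0), D) := if_pos h0
    rw [e]
    have h' : P' = .nil := h
    exact ⟨.nil, θ, hθ, h0, h', trivial, fun _ => rfl, if_pos rfl⟩
  · have e : norm (P.code, E, D) = (P.code, E, D) := if_neg h0
    rw [e]
    exact ⟨P, θ, hθ, rfl, h, hU, hN, e⟩

theorem ctrlRel_idle {I : Inst} {θ : ℕ → Value} (hθ : Good I θ) (A : Actor) :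
    CtrlRel I A .nil (0, ([], ([], []), 0), []) :=
  ⟨.nil, θ, hθ, rfl, rfl, trivial, fun _ => rfl, rfl⟩

/-- Since `norm` drops the environment of a finished process, a finished actor with no created
actors on record is in the one idle state of the net. The root may keep a nonempty record, but it
has no methods to start. -/
theorem CtrlRel.eq_idle {I : Inst} {A : Actor} {q : Ctrl} (h : CtrlRel I A .nil q) :
    q = (0, ([], ([], []), 0), q.2.2) := by
  obtain ⟨P, θ, -, hc, hP, -, -, hn⟩ := h
  have : P = .nil := by cases P <;> simp [Proc.mapRef] at hP ⊢
  rw [this] at hc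
  rw [← hn]
  unfold norm
  rw [if_pos (show q.1 = 0 from hc.symm)]

theorem CtrlRel.eq_nil {I : Inst} {A : Actor} {P : Proc} {q : Ctrl} (h : CtrlRel I A P q)
    (hq : q.1 = 0) : P = .nil := by
  obtain ⟨P, θ, -, hc, hP, -, -, -⟩ := h
  rw [hP, Proc.code_eq_zero (hc.trans hq)]
  rfl

/-- Substituting for the variable of a `let` amounts to pushing a value onto the environment: at
depth `k`, index `k` now finds the new value, and larger indices find the old ones one place
further. -/
theorem openWith_closure (a : ℕ) (E : Env) (θ : ℕ → Value) (u : ℕ) (P : Proc) :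
    (P.mapRef (closure a E θ) 1).openWith (θ u) = P.mapRef (closure a (u :: E.1, E.2) θ) 0 := by
  refine Proc.mapRef_comp 1 (fun k r => ?_) P 0
  rcases r with i | _ | V
  · simp only [closure, resolve, Ref.code, Nat.unpair_pair, if_true]
    rcases lt_trichotomy i k with h | rfl | h
    · simp [h, h.trans (Nat.lt_succ_self k), h.ne]
    · simp
    · obtain ⟨j, rfl⟩ : ∃ j, i = k + j + 1 := ⟨i - k - 1, by omega⟩
      have h1 : k + j + 1 - k = j + 1 := by omega
      have h2 : k + j + 1 - (k + 1) = j := by omega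
      have h3 : ¬ k + j + 1 < k := by omega
      have h4 : ¬ k + j + 1 < k + 1 := by omega
      simp only [h1, h2, h3, h4, if_false, List.getElem?_cons_succ]
      cases E.1[j]? with
      | none =>
        have : k + j + 1 ≠ k := by omega
        simp [this]
      | some v => simp
  · simp [closure, resolve, Ref.code]
  · simp [closure, resolve, Ref.code]

/-- The emission of the net that corresponds to a message. -/
def EmRel (I : Inst) (T : Config) (X : List Actor) (em : Option (Actor × Msg))
    (em' : Option (ℕ × Letter)) : Prop :=
  (em = none ∧ em' = none) ∨ ∃ B x j t, em = some (B, x) ∧ B ∈ X ∧ em' = some (j, letterOf I x) ∧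
    T[j]? = some t ∧ t.1 = B

/-- The control and the emission represent the outcome of an action of `A`. -/
structure Match (I : Inst) (T : Config) (X : List Actor) (A : Actor) (q : Ctrl) (P : Proc)
    (em : Option (Actor × Msg)) (N : Config) (q' : Ctrl) (em' : Option (ℕ × Letter)) : Prop where
  compat : Compat T N
  ctrl : CtrlRel I A P q'
  em : EmRel I T X em em'
  codes : Codes q.2.2 X → Codes q'.2.2 (X ++ Config.dom N)
  other : A ≠ .root → N = [] ∧ q'.2.2 = q.2.2

theorem names_toInst (p : Program) (S₀ T : Config) :
    (toInst p S₀ T).names = (Config.dom T).map Actor.code := by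
  simp [toInst, Inst.names, Inst.tgt, Config.toCode, Config.dom]

theorem idxOf_map_inj {α β : Type*} [DecidableEq α] [DecidableEq β] {f : α → β}
    (hf : Function.Injective f) (l : List α) (a : α) : (l.map f).idxOf (f a) = l.idxOf a := by
  induction l with
  | nil => rfl
  | cons x l ih =>
    by_cases h : x = a
    · simp [h]
    · have : f x ≠ f a := hf.ne h
      rw [List.map_cons, List.idxOf_cons_ne _ this, List.idxOf_cons_ne _ h, ih]

theorem getElem?_idxOf_names {B : Actor} (hB : B ∈ Config.dom T) :
    ∃ t, T[(toInst p S₀ T).names.idxOf B.code]? = some t ∧ t.1 = B := by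
  rw [names_toInst, idxOf_map_inj Actor.code_injective]
  have h := List.getElem?_idxOf hB
  rw [Config.dom, List.getElem?_map, Option.map_eq_some_iff] at h
  exact h

theorem tauAt_letin (I : Inst) (a : ℕ) (e : Exp) (P : Proc) (E : Env) (D : List ℕ) :
    tauAt I a ((Proc.letin e P).code, E, D) =
      (run I a E ((e.toks 0).map Tok.code) ([], D)).toList.map fun r =>
        (norm (P.code, (r.1.headD 0 :: E.1, E.2), r.2), none) := by
  simp only [tauAt, Proc.code, Nat.unpair_pair, if_true, Exp.expToks_code]
  rfl

theorem tauAt_send (I : Inst) (a : ℕ) (r : Ref) (m : ℕ) (es : List Exp) (P : Proc) (E : Env)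
    (D : List ℕ) :
    tauAt I a ((Proc.send r m es P).code, E, D) =
      if ((resolve a E (Nat.pair 0 r.code)).getD 0).unpair.1 = 1 ∧
        ((resolve a E (Nat.pair 0 r.code)).getD 0).unpair.2 ∈ I.names then
      (run I a E ((Exp.toksList 0 es).map Tok.code) ([], D)).toList.map fun s =>
        (norm (P.code, E, s.2), some (I.names.idxOf
          ((resolve a E (Nat.pair 0 r.code)).getD 0).unpair.2, (m, canonVals I s.1.reverse)))
      else [] := by
  have h1 : ¬ (3 : ℕ) = 2 := by decide
  simp only [tauAt, Proc.code, Nat.unpair_pair, if_true, Exp.expToks_codeList, h1, if_false]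
  rfl

theorem tauAt_ite (I : Inst) (a : ℕ) (e e' : Exp) (P Q : Proc) (E : Env) (D : List ℕ) :
    tauAt I a ((Proc.ite e e' P Q).code, E, D) =
      (run I a E ((Exp.toksList 0 [e, e']).map Tok.code) ([], D)).toList.map fun r =>
        (norm ((if r.1[0]? = r.1[1]? then P else Q).code, E, r.2), none) := by
  have h1 : ¬ (4 : ℕ) = 2 := by decide
  have h2 : ¬ (4 : ℕ) = 3 := by decide
  simp only [tauAt, Proc.code, Nat.unpair_pair, if_true, Exp.expToks_code, h1, h2, if_false,
    Exp.toksList, List.append_nil, List.map_append, apply_ite Proc.code]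
  rfl

theorem tauAt_plus (I : Inst) (a : ℕ) (P Q : Proc) (E : Env) (D : List ℕ) :
    tauAt I a ((Proc.plus P Q).code, E, D) =
      [(norm (P.code, E, D), none), (norm (Q.code, E, D), none)] := by
  have h1 : ¬ (5 : ℕ) = 2 := by decide
  have h2 : ¬ (5 : ℕ) = 3 := by decide
  have h3 : ¬ (5 : ℕ) = 4 := by decide
  simp only [tauAt, Proc.code, Nat.unpair_pair, if_true, h1, h2, h3, if_false]

theorem tauAt_nil (I : Inst) (a : ℕ) (E : Env) (D : List ℕ) :
    tauAt I a (Proc.nil.code, E, D) = [] := by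
  simp [tauAt, Proc.code]

theorem closure_eq_val {a : ℕ} {E : Env} {θ : ℕ → Value} {r : Ref} {V : Value}
    (h : closure a E θ 0 r = .val V) : ∃ v, resolve a E (Nat.pair 0 r.code) = some v ∧ θ v = V := by
  unfold closure at h
  cases hr : resolve a E (Nat.pair 0 r.code) with
  | some v =>
    rw [hr] at h
    exact ⟨v, rfl, by simpa using h⟩
  | none =>
    rw [hr] at h
    dsimp only at h
    subst h
    obtain ⟨v, hv⟩ := resolve_val a E 0 V
    rw [hv] at hr; cases hr

theorem Good.act_iff {I : Inst} {θ : ℕ → Value} (h : Good I θ) {v : ℕ} {B : Actor} :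
    θ v = .act B ↔ v = (Value.act B).code :=
  h.code_eq_iff (by left; simp [Value.code])

/-- The constructors are treated one by one, with `Exp.agree` for the expressions. `Compat T N` is
needed in one direction only, as the net refuses incompatible creations by itself. The hypothesis
`hP` says that every actor mentioned exists; it justifies testing receivers against the target
alone. -/
theorem tau_sim {A : Actor} {φ : State} {X : List Actor} {P' : Proc} {q : Ctrl}
    (hT : TargetOK p T) (hφ : ∃ c, T.lookup A = some c ∧ c.state = φ)
    (hq : CtrlRel (toInst p S₀ T) A P' q) (hD : A = .root → Codes q.2.2 X)
    (hX : ∀ B ∈ X, B ∈ Config.dom T) (hP : ∀ B, .val (.act B) ∈ P'.refs → B ∈ X) :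
    (∀ P em N, Act p X φ P' P em N → Compat T N →
      ∃ q' em', (q', em') ∈ tauAt (toInst p S₀ T) A.code q ∧
        Match (toInst p S₀ T) T X A q P em N q' em') ∧
    (∀ q' em', (q', em') ∈ tauAt (toInst p S₀ T) A.code q →
      ∃ P em N, Act p X φ P' P em N ∧ Match (toInst p S₀ T) T X A q P em N q' em') := by
  set I := toInst p S₀ T with hI
  obtain ⟨P, θ, hθ, hc, rfl, hU, hN, hn⟩ := hq
  have hin : Interp p S₀ T A φ θ := ⟨hT, hθ, hφ⟩
  obtain ⟨c, E, D⟩ := q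
  dsimp only at hc hD hP hn ⊢
  subst hc
  have hDN : Codes D X ∨ P.news = [] := by
    by_cases hA : A = .root
    · exact .inl (hD hA)
    · exact .inr (hN hA)
  cases P with
  | nil =>
    rw [tauAt_nil]
    exact ⟨fun P em N h => (by cases h), fun q' em' h => (by simp at h)⟩
  | upd f e P => exact hU.elim
  | plus P Q =>
    simp only [Proc.news, List.append_eq_nil_iff] at hN
    rw [tauAt_plus]
    have m1 : ∀ R : Proc, R.UpdFree → (A ≠ .root → R.news = []) →
        Match I T X A ((Proc.plus P Q).code, E, D) (R.mapRef (closure A.code E θ) 0) none []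
          (norm (R.code, E, D)) none := fun R h1 h2 =>
      ⟨by simp [Compat], .mk hθ D rfl h1 h2, .inl ⟨rfl, rfl⟩,
        fun h => by simpa [norm_snd_snd, Config.dom] using h, fun _ => ⟨rfl, norm_snd_snd _⟩⟩
    have mP := m1 P hU.1 fun h => (hN h).1
    have mQ := m1 Q hU.2 fun h => (hN h).2
    constructor
    · intro R em N h _
      cases h with
      | plusLeft => exact ⟨_, _, by simp, mP⟩
      | plusRight => exact ⟨_, _, by simp, mQ⟩
    · intro q' em' h
      simp only [List.mem_cons, Prod.mk.injEq, List.not_mem_nil, or_false] at h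
      rcases h with ⟨rfl, rfl⟩ | ⟨rfl, rfl⟩
      · exact ⟨_, _, _, .plusLeft, mP⟩
      · exact ⟨_, _, _, .plusRight, mQ⟩
  | letin e P =>
    simp only [Proc.news, List.append_eq_nil_iff] at hN hDN
    rw [tauAt_letin, Proc.mapRef]
    rcases Exp.agree hin E e [] D X (hDN.imp_right And.left) with ⟨h1, h2⟩ |
      ⟨U, N, s, h1, h2, h3, ⟨u, h4, rfl⟩, h5, h6⟩
    · rw [h1]
      refine ⟨?_, fun q' em' h => by simp at h⟩
      intro R em N h hc
      cases h with
      | letin he => exact (h2 _ _ he hc).elim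
    · rw [h3]
      have m : Match I T X A ((Proc.letin e P).code, E, D)
          ((P.mapRef (closure A.code E θ) 1).openWith (θ u)) none N
          (norm (P.code, (s.1.headD 0 :: E.1, E.2), s.2)) none := by
        refine ⟨h2, .mk hθ s.2 ?_ hU fun h => (hN h).2, .inl ⟨rfl, rfl⟩, ?_, ?_⟩
        · rw [openWith_closure, h4]; rfl
        · rw [norm_snd_snd]; exact h5
        · rw [norm_snd_snd]; exact fun h => h6 (hN h).1
      constructor
      · intro R em N' h _
        cases h with
        | letin he =>
          rw [h1] at he
          cases he
          exact ⟨_, _, by simp, m⟩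
      · intro q' em' h
        simp only [Option.toList_some, List.map_cons, List.map_nil, List.mem_singleton,
          Prod.mk.injEq] at h
        obtain ⟨rfl, rfl⟩ := h
        exact ⟨_, _, _, .letin h1, m⟩
  | ite e e' P Q =>
    have hnl : Exp.newsList [e, e'] = e.news ++ e'.news := by simp [Exp.newsList]
    simp only [Proc.news, List.append_eq_nil_iff, List.append_assoc] at hN hDN
    rw [tauAt_ite, Proc.mapRef]
    have hml : Exp.mapRefList (closure A.code E θ 0) [e, e'] =
        [e.mapRef (closure A.code E θ 0), e'.mapRef (closure A.code E θ 0)] := rfl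
    have hDN' : Codes D X ∨ Exp.newsList [e, e'] = [] := by
      rw [hnl, List.append_eq_nil_iff]
      exact hDN.imp_right fun h => ⟨h.1, h.2.1⟩
    rcases Exp.agreeList hin E [e, e'] [] D X hDN' with ⟨h1, h2⟩ |
      ⟨U, N, s, h1, h2, h3, ⟨us, h4, rfl, h7⟩, h5, h6⟩
    · rw [h1]
      rw [hml] at h2
      refine ⟨?_, fun q' em' h => by simp at h⟩
      intro R em N h hc
      cases h with
      | iteTrue he => exact (h2 _ _ he hc).elim
      | iteFalse he => exact (h2 _ _ he hc).elim
    · rw [h3]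
      rw [hml] at h1
      obtain ⟨u, v, rfl⟩ := List.length_eq_two.1 h7
      have hs : s.1[0]? = s.1[1]? ↔ u = v := by
        rw [h4]; simp [eq_comm]
      have m : ∀ R : Proc, R.UpdFree → (A ≠ .root → R.news = []) →
          Match I T X A ((Proc.ite e e' P Q).code, E, D)
          (R.mapRef (closure A.code E θ) 0) none N (norm (R.code, E, s.2)) none := by
        intro R hR hR'
        refine ⟨h2, .mk hθ s.2 rfl hR hR', .inl ⟨rfl, rfl⟩, ?_, ?_⟩
        · rw [norm_snd_snd]; exact h5
        · rw [norm_snd_snd]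
          exact fun h => h6 (by rw [hnl, (hN h).1, (hN h).2.1]; rfl)
      have mP := m P hU.1 fun h => (hN h).2.2.1
      have mQ := m Q hU.2 fun h => (hN h).2.2.2
      simp only [Option.toList_some, List.map_cons, List.map_nil, List.mem_singleton, hs] at h1 ⊢
      constructor
      · intro R em N' h _
        cases h with
        | iteTrue he =>
          rw [h1] at he
          simp only [Option.some.injEq, Prod.mk.injEq, List.cons.injEq, and_true] at he
          obtain ⟨⟨e1, e2⟩, rfl⟩ := he
          have huv : u = v := hθ.inj (e1.trans e2.symm)
          rw [if_pos huv]
          exact ⟨_, _, rfl, mP⟩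
        | iteFalse he hne =>
          rw [h1] at he
          simp only [Option.some.injEq, Prod.mk.injEq, List.cons.injEq, and_true] at he
          obtain ⟨⟨rfl, rfl⟩, rfl⟩ := he
          have huv : u ≠ v := fun h => hne (by rw [h])
          rw [if_neg huv]
          exact ⟨_, _, rfl, mQ⟩
      · intro q' em' h
        simp only [Prod.mk.injEq] at h
        obtain ⟨rfl, rfl⟩ := h
        split_ifs with huv
        · subst huv
          exact ⟨_, _, _, .iteTrue h1, mP⟩
        · exact ⟨_, _, _, .iteFalse h1 (fun h => huv (hθ.inj h)), mQ⟩
  | send r m es P =>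
    simp only [Proc.news, List.append_eq_nil_iff] at hN hDN
    rw [tauAt_send]
    have hr : ∀ B, closure A.code E θ 0 r = .val (.act B) →
        B ∈ X ∧ resolve A.code E (Nat.pair 0 r.code) = some (Value.act B).code := by
      intro B hB
      obtain ⟨v, hv, hv'⟩ := closure_eq_val hB
      refine ⟨hP B ?_, by rw [hv, hθ.act_iff.1 hv']⟩
      rw [Proc.mapRef, Proc.refs, hB]
      exact List.mem_cons_self
    rw [Proc.mapRef]
    rcases Exp.agreeList hin E es [] D X (hDN.imp_right And.left) with ⟨h1, h2⟩ |
      ⟨U, N, s, h1, h2, h3, ⟨us, h4, rfl, h7⟩, h5, h6⟩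
    · rw [h1]
      refine ⟨?_, fun q' em' h => by simp at h⟩
      intro R em N h hc
      generalize closure A.code E θ 0 r = r' at h
      cases h with
      | send he => exact (h2 _ _ he hc).elim
    · rw [h3, Option.toList_some, List.map_cons, List.map_nil]
      have hus : s.1.reverse = us := by rw [h4]; simp
      have hl : canonVals I us = canonVals I ((us.map θ).map Value.code) := by
        rw [List.map_map]; exact (hθ.canonVals us).symm
      have key : ∀ B, closure A.code E θ 0 r = .val (.act B) →
          Match I T X A ((Proc.send r m es P).code, E, D) (P.mapRef (closure A.code E θ) 0)
            (some (B, (m, us.map θ))) N (norm (P.code, E, s.2))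
            (some (I.names.idxOf B.code, (m, canonVals I s.1.reverse))) := by
        intro B hB
        refine ⟨h2, .mk hθ s.2 rfl hU fun h => (hN h).2, .inr ?_, ?_, ?_⟩
        · obtain ⟨t, ht, ht'⟩ := getElem?_idxOf_names (p := p) (S₀ := S₀) (hX B (hr B hB).1)
          refine ⟨B, _, _, t, rfl, (hr B hB).1, ?_, ht, ht'⟩
          rw [hus, hl]; rfl
        · rw [norm_snd_snd]; exact h5
        · rw [norm_snd_snd]; exact fun h => h6 (hN h).1
      constructor
      · intro R em N' h _
        generalize hr' : closure A.code E θ 0 r = r' at h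
        cases h with
        | @send B _ _ _ _ _ he =>
          rw [h1] at he
          cases he
          have hB := (hr B hr').2
          rw [hB]
          have e1 : ((some (Value.act B).code).getD 0).unpair = (1, B.code) := by simp [Value.code]
          rw [e1, if_pos ⟨rfl, by rw [names_toInst]; exact List.mem_map_of_mem (hX B (hr B hr').1)⟩]
          exact ⟨_, _, List.mem_singleton.2 rfl, key B hr'⟩
      · intro q' em' h
        split_ifs at h with hcond
        · rw [List.mem_singleton] at h
          cases h
          cases hv : resolve A.code E (Nat.pair 0 r.code) with
          | none => rw [hv] at hcond; simp at hcond
          | some v =>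
            rw [hv, Option.getD_some] at hcond
            obtain ⟨B, hB⟩ := Actor.exists_code v.unpair.2
            have hvB : v = (Value.act B).code := by
              rw [Value.code, hB, ← hcond.1, Nat.pair_unpair]
            have hcl : closure A.code E θ 0 r = .val (.act B) := by
              unfold closure
              rw [hv]
              exact congrArg Ref.val (hθ.act_iff.2 hvB)
            have := key B hcl
            rw [Option.getD_some, ← hB]
            refine ⟨_, _, _, ?_, this⟩
            rw [hcl]
            exact .send h1
        · simp at h

end

section

variable {p : Program} {S₀ T : Config}

/-! ### Simulation of method instantiation -/

theorem lookup_zip {α β : Type*} [DecidableEq α] (as : List α) (bs : List β)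
    (h : as.length = bs.length) (a : α) : (as.zip bs).lookup a = bs[as.idxOf a]? := by
  induction as generalizing bs with
  | nil => cases bs <;> simp_all
  | cons x as ih =>
    cases bs with
    | nil => simp at h
    | cons b bs =>
      by_cases hx : x = a
      · subst hx; simp
      · have : (a == x) = false := by simpa using Ne.symm hx
        rw [List.zip_cons_cons, List.lookup_cons, this, List.idxOf_cons_ne _ hx,
          List.getElem?_cons_succ]
        exact ih bs (by simpa using h)

theorem good_vars (p : Program) (S₀ T : Config) (x : ℕ)
    (h : RigidCode (toInst p S₀ T) (Value.var x).code) : x ∈ p.main.vars :=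
  (rigidCode_iff p S₀ T _).1 h

/-- The values that replace the free variables of a method body. -/
def MethodDef.subst (p : Program) (S : Config) (d : MethodDef) (Us : List Value) (x : ℕ) : Value :=
  ((d.params.zip Us ++ ((d.body.vars.filter fun x => decide (x ∉ d.params)).dedup).zip
    ((freshVars p S ((d.body.vars.filter fun x => decide (x ∉ d.params)).dedup).length).map
      Value.var)).lookup x).getD (.var x)

theorem MethodDef.start_eq (p : Program) (S : Config) (d : MethodDef) (A : Actor) (Us : List Value) :
    d.start p S A Us = d.body.instantiate A (d.subst p S Us) := rfl

/-- Parameters are replaced by the arguments, other variables by distinct fresh ones. -/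
theorem MethodDef.subst_spec (p : Program) (S : Config) (d : MethodDef) {Us : List Value}
    (hl : Us.length = d.params.length) :
    (∀ x, ∀ U, Us[d.params.idxOf x]? = some U → d.subst p S Us x = U) ∧
    (∀ x ∈ d.body.vars, Us[d.params.idxOf x]? = none → ∃ y, d.subst p S Us x = .var y ∧
      y ∉ p.main.vars ∧ .var y ∉ Config.values S) ∧
    (∀ x ∈ d.body.vars, ∀ x' ∈ d.body.vars, Us[d.params.idxOf x]? = none →
      Us[d.params.idxOf x']? = none → d.subst p S Us x = d.subst p S Us x' → x = x') := by
  set ys := (d.body.vars.filter fun x => decide (x ∉ d.params)).dedup with hys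
  set ys' := freshVars p S ys.length with hys'
  have hlen : ys'.length = ys.length := length_leastUnused _ _
  have hnd : ys'.Nodup := nodup_leastUnused _ _
  have hlk : ∀ x, d.subst p S Us x =
      ((Us[d.params.idxOf x]?).or ((ys'.map Value.var)[ys.idxOf x]?)).getD (.var x) := by
    intro x
    unfold MethodDef.subst
    rw [← hys, ← hys', List.lookup_append, lookup_zip _ _ hl.symm, lookup_zip _ _ (by simp [hlen])]
  have hmem : ∀ x ∈ d.body.vars, Us[d.params.idxOf x]? = none → x ∈ ys := by
    intro x hx hn
    rw [hys, List.mem_dedup, List.mem_filter]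
    refine ⟨hx, ?_⟩
    rw [List.getElem?_eq_none_iff, hl] at hn
    have : x ∉ d.params := fun h => absurd (List.idxOf_lt_length_of_mem h) (by omega)
    simpa using this
  have hfresh : ∀ x ∈ d.body.vars, Us[d.params.idxOf x]? = none →
      ∃ h : ys.idxOf x < ys'.length, d.subst p S Us x = .var ys'[ys.idxOf x] := by
    intro x hx hn
    have h : ys.idxOf x < ys'.length := hlen ▸ List.idxOf_lt_length_of_mem (hmem x hx hn)
    refine ⟨h, ?_⟩
    rw [hlk, hn, Option.none_or, List.getElem?_map, List.getElem?_eq_getElem h]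
    rfl
  refine ⟨fun x U h => by rw [hlk, h]; rfl, fun x hx hn => ?_, fun x hx x' hx' hn hn' he => ?_⟩
  · obtain ⟨h, e⟩ := hfresh x hx hn
    refine ⟨_, e, ?_⟩
    have := mem_leastUnused (List.getElem_mem h)
    rw [List.mem_append, mem_varsOf] at this
    tauto
  · obtain ⟨h, e⟩ := hfresh x hx hn
    obtain ⟨h', e'⟩ := hfresh x' hx' hn'
    rw [e, e', Value.var.injEq, hnd.getElem_inj_iff] at he
    exact (List.idxOf_inj (hmem x hx hn)).1 he

/-- The body runs on canonical arguments, so a new interpretation is chosen: canonical arguments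
stand for the actual ones, and abstract fresh variables for those that the semantics picks. It is
injective because the latter are distinct, not in `S` and not free in the main process. -/
theorem ctrlRel_start {S : Config} {d : MethodDef} (hp : p.WellFormed) (hb : p.BoundedActors)
    (hr : p.ReadOnly) (hd : d ∈ p.methods) (A : Actor) {Us : List Value}
    (hl : Us.length = d.params.length) (hUs : ∀ U ∈ Us, U ∈ Config.values S) :
    CtrlRel (toInst p S₀ T) A (d.start p S A Us) (norm (d.body.code,
      ([], (canonVals (toInst p S₀ T) (Us.map Value.code), d.params), 3), [])) := by
  classical
  set I := toInst p S₀ T with hI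
  obtain ⟨g, hg1, hg2, hg3, hg4⟩ := canonVals_spec I (Us.map Value.code)
  obtain ⟨s1, s2, s3⟩ := d.subst_spec p S hl
  have hR : ∀ V : Value, RigidCode I V.code ↔ V.Rigid p.main.vars := rigidCode_iff p S₀ T
  -- The two kinds of abstract values are kept apart by their tags: canonical arguments are rigid or
  -- have tag 2, fresh variables have tag 3.
  let τ : ℕ → Value := fun v => if h : ∃ U ∈ Us, g U.code = v then h.choose else
    d.subst p S Us v.unpair.2
  have hm : ∀ {U}, U ∈ Us → U.code ∈ Us.map Value.code := fun hU => List.mem_map_of_mem hU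
  have hτ : ∀ U ∈ Us, τ (g U.code) = U := by
    intro U hU
    have h : ∃ U' ∈ Us, g U'.code = g U.code := ⟨U, hU, rfl⟩
    have h1 : τ (g U.code) = h.choose := dif_pos h
    rw [h1]
    exact Value.code_injective (hg3 _ (hm h.choose_spec.1) _ (hm hU) h.choose_spec.2)
  have hτ' : ∀ x, τ (Nat.pair 3 x) = d.subst p S Us x := by
    intro x
    have h : ¬ ∃ U ∈ Us, g U.code = Nat.pair 3 x := by
      rintro ⟨U, hU, hx⟩
      by_cases hrig : RigidCode I U.code
      · have h1 := hg2 _ (hm hU) (.inl hrig)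
        rw [← h1, hx] at hrig
        exact not_rigidCode_class I 3 x (by norm_num) hrig
      · have := hg4 _ (hm hU) hrig
        rw [hx] at this
        simp at this
    have h1 : τ (Nat.pair 3 x) = d.subst p S Us (Nat.pair 3 x).unpair.2 := dif_neg h
    rw [h1, Nat.unpair_pair]
  let V₀ := d.body.vars.filter fun x => decide (Us[d.params.idxOf x]? = none)
  have hV₀ : ∀ {x}, x ∈ V₀ ↔ x ∈ d.body.vars ∧ Us[d.params.idxOf x]? = none := by
    intro x; simp [V₀]
  obtain ⟨θ, hθ, hθL⟩ := exists_good I p.main.vars (good_vars p S₀ T)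
    (Us.map (fun U => g U.code) ++ V₀.map (Nat.pair 3)) τ (by
      intro v hv v' hv' he
      simp only [List.mem_append, List.mem_map] at hv hv'
      rcases hv with ⟨U, hU, rfl⟩ | ⟨x, hx, rfl⟩ <;> rcases hv' with ⟨U', hU', rfl⟩ | ⟨x', hx', rfl⟩
      · rw [hτ U hU, hτ U' hU'] at he; rw [he]
      · rw [hτ U hU, hτ'] at he
        obtain ⟨y, h1, h2, h3⟩ := s2 x' (hV₀.1 hx').1 (hV₀.1 hx').2
        exact absurd (hUs U hU) (by rw [he, h1]; exact h3)
      · rw [hτ U' hU', hτ'] at he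
        obtain ⟨y, h1, h2, h3⟩ := s2 x (hV₀.1 hx).1 (hV₀.1 hx).2
        exact absurd (hUs U' hU') (by rw [← he, h1]; exact h3)
      · rw [hτ', hτ'] at he
        rw [s3 x (hV₀.1 hx).1 x' (hV₀.1 hx').1 (hV₀.1 hx).2 (hV₀.1 hx').2 he])
    (by
      intro v hv
      simp only [List.mem_append, List.mem_map] at hv
      rcases hv with ⟨U, hU, rfl⟩ | ⟨x, hx, rfl⟩
      · rw [hτ U hU]
        exact fun h => (hg2 _ (hm hU) h.symm).symm
      · rw [hτ']
        obtain ⟨y, h1, h2, h3⟩ := s2 x (hV₀.1 hx).1 (hV₀.1 hx).2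
        rw [h1]
        rintro (h | h)
        · exact absurd h (not_rigidCode_class I 3 x (by norm_num))
        · exact absurd ((hR _).1 h) h2)
  refine .mk hθ [] ?_ (hr.2 d hd) fun _ => hb d hd
  rw [MethodDef.start_eq, Proc.instantiate]
  refine Proc.mapRef_congr _ _ fun k r hrr => ?_
  rcases r with i | _ | (x | B)
  · simp [closure, resolve, Ref.code]
  · simp only [closure, resolve, Ref.code, Nat.unpair_pair, one_ne_zero, if_false, if_true]
    exact congrArg Ref.val (hθ.act_iff.2 rfl).symm
  · have e : resolve A.code ([], (canonVals I (Us.map Value.code), d.params), 3)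
        (Nat.pair k (Ref.val (.var x)).code) =
        some (((Us[d.params.idxOf x]?).map fun U => g U.code).getD (Nat.pair 3 x)) := by
      have h1 : ¬ (2 : ℕ) = 0 := by decide
      have h2 : ¬ (2 : ℕ) = 1 := by decide
      simp only [resolve, Ref.code, Value.code, Nat.unpair_pair, if_true, h1, h2, if_false, hg1,
        List.map_map, List.getElem?_map]
      rfl
    unfold closure
    rw [e]
    dsimp only
    congr 1
    have hx : x ∈ d.body.vars := (mem_vars_iff _ _).2 hrr
    cases hU : Us[d.params.idxOf x]? with
    | none =>
      rw [Option.map_none, Option.getD_none, hθL, hτ']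
      exact List.mem_append_right _ (List.mem_map_of_mem (hV₀.2 ⟨hx, hU⟩))
    | some U =>
      have hU' : U ∈ Us := List.mem_of_getElem? hU
      rw [Option.map_some, Option.getD_some, hθL, hτ U hU', s1 x U hU]
      exact List.mem_append_left _ (List.mem_map.2 ⟨U, hU', rfl⟩)
  · exfalso
    have := hp.body_static d hd
    rw [List.eq_nil_iff_forall_not_mem] at this
    exact this B ((mem_actsOf _ _).2 ((mem_values_iff _ _).2 hrr))

theorem mem_instAt {A : Actor} {x : Letter} {q : Ctrl} :
    q ∈ instAt (toInst p S₀ T) A.code x ↔ ∃ d ∈ p.methods, ∃ i, A = .mk d.cls i ∧ d.name = x.1 ∧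
      x.2.length = d.params.length ∧ q = norm (d.body.code, ([], (x.2, d.params), 3), []) := by
  unfold instAt toInst Inst.methods
  dsimp only
  rw [List.mem_filterMap]
  have hA : ∀ C : ℕ, A.code ≠ 0 ∧ C = (A.code - 1).unpair.1 ↔ ∃ i, A = .mk C i := by
    intro C
    cases A with
    | root => simp [Actor.code]
    | mk D i => simp [Actor.code, eq_comm]
  constructor
  · rintro ⟨m, hm, h⟩
    obtain ⟨d, hd, rfl⟩ := List.mem_map.1 hm
    dsimp only at h
    split_ifs at h with hc
    obtain ⟨i, hi⟩ := (hA d.cls).1 ⟨hc.1, hc.2.1⟩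
    exact ⟨d, hd, i, hi, hc.2.2.1, hc.2.2.2, (Option.some.inj h).symm⟩
  · rintro ⟨d, hd, i, hi, h1, h2, h3⟩
    refine ⟨_, List.mem_map_of_mem hd, ?_⟩
    obtain ⟨h4, h5⟩ := (hA d.cls).2 ⟨i, hi⟩
    rw [if_pos ⟨h4, h5, h1, h2⟩, h3]

/-- Bodies contain no actor names, so names enter only through `this` and the arguments. -/
theorem acts_start (hp : p.WellFormed) {S : Config} {d : MethodDef} (hd : d ∈ p.methods)
    {A : Actor} {Us : List Value} (hl : Us.length = d.params.length) {B : Actor}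
    (h : .val (.act B) ∈ (d.start p S A Us).refs) : B = A ∨ .act B ∈ Us := by
  obtain ⟨s1, s2, -⟩ := d.subst_spec p S hl
  rw [MethodDef.start_eq, Proc.instantiate] at h
  obtain ⟨k, r, hr, e⟩ := Proc.mem_refs_mapRef h
  rcases r with i | _ | (x | C)
  · simp at e
  · left; simpa [eq_comm] using e
  · right
    have hx := (mem_vars_iff _ _).2 hr
    have e' : d.subst p S Us x = .act B := by simpa using e
    cases hU : Us[d.params.idxOf x]? with
    | none =>
      obtain ⟨y, hy, -⟩ := s2 x hx hU
      rw [hy] at e'; cases e'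
    | some U =>
      rw [s1 x U hU] at e'
      exact e' ▸ List.mem_of_getElem? hU
  · exfalso
    have := hp.body_static d hd
    rw [List.eq_nil_iff_forall_not_mem] at this
    exact this C ((mem_actsOf _ _).2 ((mem_values_iff _ _).2 hr))

/-! ### Processes without an environment -/

theorem Proc.mapRef_id (P : Proc) (k : ℕ) : P.mapRef (fun _ r => r) k = P := by
  have h : Tok.mapRef (fun _ r => r) = id := by
    funext t
    rcases t with n | ⟨k, r⟩ <;> rfl
  refine Proc.toks_flat_inj (k := k) (k' := k) ?_
  rw [Proc.toks_mapRef, h, List.map_id]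

/-- Every process is represented by its code. -/
theorem exists_good_closure (p : Program) (S₀ T : Config) (A : Actor) {P : Proc}
    (h : Ref.this ∉ P.refs) : ∃ θ, Good (toInst p S₀ T) θ ∧
      P.mapRef (closure A.code ([], ([], []), 0) θ) 0 = P := by
  classical
  have : Nonempty Value := ⟨.var 0⟩
  let τ : ℕ → Value := Function.invFun Value.code
  have hτ : ∀ V : Value, τ V.code = V := Function.leftInverse_invFun Value.code_injective
  obtain ⟨θ, hθ, hL⟩ := exists_good (toInst p S₀ T) p.main.vars (good_vars p S₀ T)
    (P.values.map Value.code) τ (by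
      intro v hv v' hv' he
      obtain ⟨V, -, rfl⟩ := List.mem_map.1 hv
      obtain ⟨V', -, rfl⟩ := List.mem_map.1 hv'
      rw [hτ, hτ] at he
      rw [he])
    (by
      intro v hv _
      obtain ⟨V, -, rfl⟩ := List.mem_map.1 hv
      rw [hτ])
  refine ⟨θ, hθ, ?_⟩
  conv_rhs => rw [← Proc.mapRef_id P 0]
  refine Proc.mapRef_congr _ _ fun k r hr => ?_
  rcases r with i | _ | V
  · simp [closure, resolve, Ref.code]
  · exact absurd hr h
  · have e : resolve A.code ([], ([], []), 0) (Nat.pair k (Ref.val V).code) = some V.code := by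
      cases V <;> simp [resolve, Ref.code, Value.code]
    unfold closure
    rw [e]
    dsimp only
    rw [hL _ (List.mem_map_of_mem ((mem_values_iff _ _).2 hr)), hτ]

theorem canonToks_closure (I : Inst) {θ : ℕ → Value} (hθ : Good I θ) (a : ℕ) (E : Env) (P : Proc) :
    canonToks I ((procToks 0 P.code).map (resolveTok a E)) =
      canonToks I (P.mapRef (closure a E θ) 0).sig := by
  rw [Proc.procToks_code, resolveTok_code I hθ, Proc.sig, Proc.toks_mapRef]

end

section

variable {p : Program} {S₀ T : Config}

/-! ### The simulation relation -/

theorem Cell.act_mem_values {c : Cell} {B : Actor} : .act B ∈ c.values ↔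
    .val (.act B) ∈ c.proc.refs ∨ .act B ∈ c.state.map Prod.snd ∨ ∃ x ∈ c.queue, .act B ∈ x.2 := by
  rw [Cell.values, List.mem_append, List.mem_append, mem_values_iff, List.mem_flatMap, or_assoc]

theorem Config.mem_values {S : Config} {A : Actor} {c : Cell} (h : S.lookup A = some c) {V : Value}
    (hV : V ∈ c.values) : V ∈ Config.values S :=
  List.mem_flatMap.2 ⟨_, lookup_mem h, hV⟩

/-- The component `s` of the net represents the cell `c` of the actor `A`, whose state in the target
is `ψ`, in a configuration with actors `X`. -/
structure CellRel (I : Inst) (X : List Actor) (A : Actor) (ψ : State) (c : Cell)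
    (s : Ctrl × List Letter) : Prop where
  state : c.state = ψ
  ctrl : CtrlRel I A c.proc s.1
  queue : c.queue.map (letterOf I) = s.2
  root : A = .root → Codes s.1.2.2 X
  other : A ≠ .root → s.1.2.2 = []
  named : ∀ B, .act B ∈ c.values → B ∈ X

theorem CellRel.receive {I : Inst} {X : List Actor} {A : Actor} {ψ : State} {c : Cell}
    {s : Ctrl × List Letter} (h : CellRel I X A ψ c s) (o : Option Msg)
    (ho : ∀ x, o = some x → ∀ B, .act B ∈ x.2 → B ∈ X) :
    CellRel I X A ψ (c.receive o) (s.1, Net.appList s.2 (o.map (letterOf I))) := by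
  refine ⟨h.state, h.ctrl, ?_, h.root, h.other, ?_⟩
  · simp only [Cell.receive, List.map_append, h.queue, Net.appList]
    cases o <;> rfl
  · intro B hB
    rw [Cell.act_mem_values] at hB
    simp only [Cell.receive, List.mem_append, Option.mem_toList] at hB
    rcases hB with hB | hB | ⟨x, hx | hx, hB⟩
    · exact h.named B (Cell.act_mem_values.2 (.inl hB))
    · exact h.named B (Cell.act_mem_values.2 (.inr (.inl hB)))
    · exact h.named B (Cell.act_mem_values.2 (.inr (.inr ⟨x, hx, hB⟩)))
    · exact ho x hx B hB

/-- The net configuration `σ` represents `S`. -/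
structure Rel (p : Program) (S₀ T S : Config) (σ : ℕ → Ctrl × List Letter) : Prop where
  nodup : (Config.dom S).Nodup
  sub : ∀ A ∈ Config.dom S, A ∈ Config.dom T
  absent : ∀ i t, T[i]? = some t → S.lookup t.1 = none → σ i = ((0, ([], ([], []), 0), []), [])
  present : ∀ i t c, T[i]? = some t → S.lookup t.1 = some c →
    CellRel (toInst p S₀ T) (Config.dom S) t.1 t.2.state c (σ i)

theorem index_inj (hT : (Config.dom T).Nodup) {i j : ℕ} {t t' : Actor × Cell} (hi : T[i]? = some t)
    (hj : T[j]? = some t') (h : t.1 = t'.1) : i = j := by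
  have hi' : (Config.dom T)[i]? = some t.1 := by rw [Config.dom, List.getElem?_map, hi]; rfl
  have hj' : (Config.dom T)[j]? = some t.1 := by rw [Config.dom, List.getElem?_map, hj, h]; rfl
  have hlt : i < (Config.dom T).length := by
    by_contra hn
    rw [List.getElem?_eq_none (by omega)] at hi'; cases hi'
  exact (List.getElem?_inj hlt hT).1 (hi'.trans hj'.symm)

theorem exists_index {T : Config} {A : Actor} (h : A ∈ Config.dom T) : ∃ (i : ℕ) (t : Actor × Cell), T[i]? = some t ∧ t.1 = A := by
  obtain ⟨t, ht, rfl⟩ := List.mem_map.1 h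
  obtain ⟨i, hi⟩ := List.mem_iff_getElem?.1 ht
  exact ⟨i, t, hi, rfl⟩

theorem emitTo_of_emRel (hT : (Config.dom T).Nodup) {X : List Actor} {em : Option (Actor × Msg)}
    {em' : Option (ℕ × Letter)} (h : EmRel (toInst p S₀ T) T X em em') {j : ℕ} {t : Actor × Cell}
    (hj : T[j]? = some t) :
    Net.emitTo em' j = (emOf em t.1).map (letterOf (toInst p S₀ T)) := by
  rcases h with ⟨rfl, rfl⟩ | ⟨B, x, k, t', rfl, hB, rfl, hk, hB'⟩
  · rfl
  · by_cases hkj : k = j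
    · subst hkj
      rw [hk, Option.some.injEq] at hj
      subst hj
      simp [Net.emitTo, emOf, hB']
    · have : B ≠ t.1 := fun e => hkj (index_inj hT hk hj (hB'.trans e))
      simp [Net.emitTo, emOf, hkj, this]

theorem emOf_eq_none {X : List Actor} {em : Option (Actor × Msg)} {em' : Option (ℕ × Letter)}
    (h : EmRel (toInst p S₀ T) T X em em') {A : Actor} (hA : A ∉ X) : emOf em A = none := by
  rcases h with ⟨rfl, rfl⟩ | ⟨B, x, k, t', rfl, hB, rfl, hk, hB'⟩
  · rfl
  · have : B ≠ A := fun e => hA (e ▸ hB)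
    simp [emOf, this]

theorem lookup_eq_none_iff_notMem {S : Config} {A : Actor} :
    S.lookup A = none ↔ A ∉ Config.dom S := by
  rw [Config.mem_dom_iff, ← Option.isSome_iff_exists, Option.not_isSome_iff_eq_none]

/-- The part common to actions and method starts: component `i` changes its control, a receiver gets
a letter, and created actors are taken over by components that have been idle so far, their states
being right by `Compat`. -/
theorem Rel.update (hT : (Config.dom T).Nodup) {S : Config} {σ : ℕ → Ctrl × List Letter}
    (h : Rel p S₀ T S σ) {i : ℕ} {t : Actor × Cell} (hi : T[i]? = some t) {c c' : Cell}
    (hA : S.lookup t.1 = some c) (hs : c'.state = c.state) {em : Option (Actor × Msg)} {N : Config}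
    {q' : Ctrl} {em' : Option (ℕ × Letter)} {w : List Letter} (hN : Compat T N)
    (hem : EmRel (toInst p S₀ T) T (Config.dom S) em em')
    (hctrl : CtrlRel (toInst p S₀ T) t.1 c'.proc q')
    (hroot : t.1 = .root → Codes q'.2.2 (Config.dom S ++ Config.dom N))
    (hother : t.1 ≠ .root → N = [] ∧ q'.2.2 = []) (hw : c'.queue.map (letterOf (toInst p S₀ T)) = w)
    (hnamed : ∀ B, .act B ∈ c'.values → B ∈ Config.dom S ++ Config.dom N)
    (hmsg : ∀ e, em = some e → ∀ B, .act B ∈ e.2.2 → B ∈ Config.dom S ++ Config.dom N)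
    (hnew : ∀ t ∈ N, NewCell (· ∈ Config.dom S) (Config.dom S) N t) (hNd : (Config.dom N).Nodup) :
    Rel p S₀ T (S.update t.1 c' em ++ N) (Net.upd σ i (q', w) em') := by
  set I := toInst p S₀ T with hI
  have hdom : Config.dom (S.update t.1 c' em ++ N) = Config.dom S ++ Config.dom N := by
    rw [Config.dom_append, Config.dom_update]
  have hupd : ∀ j t', T[j]? = some t' → Net.upd σ i (q', w) em' j =
      ((if j = i then (q', w) else σ j).1,
        Net.appList (if j = i then (q', w) else σ j).2 ((emOf em t'.1).map (letterOf I))) := by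
    intro j t' hj
    rw [← emitTo_of_emRel hT hem hj]
    rfl
  -- Messages go to existing actors only, so the component of an absent actor is still idle with an
  -- empty queue when the actor is created.
  have hidle : ∀ j t', T[j]? = some t' → S.lookup t'.1 = none →
      Net.upd σ i (q', w) em' j = ((0, ([], ([], []), 0), []), []) := by
    intro j t' hj hn
    have hji : j ≠ i := by
      rintro rfl
      rw [hi, Option.some.injEq] at hj
      rw [← hj, hA] at hn; cases hn
    rw [hupd j t' hj, emOf_eq_none hem (lookup_eq_none_iff_notMem.1 hn), if_neg hji,
      h.absent j t' hj hn]
    rfl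
  refine ⟨?_, ?_, ?_, ?_⟩
  · exact Config.nodup_update_append h.nodup hNd (fun t ht => (hnew t ht).fresh) _ _ _
  · intro B hB
    rw [hdom, List.mem_append] at hB
    rcases hB with hB | hB
    · exact h.sub B hB
    · obtain ⟨u, hu, rfl⟩ := List.mem_map.1 hB
      obtain ⟨c₁, hc₁, -⟩ := hN u hu
      exact (Config.mem_dom_iff _ _).2 ⟨c₁, hc₁⟩
  · intro j t' hj hn
    refine hidle j t' hj ?_
    rw [lookup_eq_none_iff_notMem] at hn ⊢
    exact fun hm => hn (hdom ▸ List.mem_append_left _ hm)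
  · intro j t' c'' hj hc''
    rw [hdom]
    rcases lookup_update_append hc'' with ⟨c₁, h1, rfl⟩ | ⟨hn, h1⟩
    · rw [hupd j t' hj]
      refine CellRel.receive ?_ _ ?_
      · by_cases hji : j = i
        · subst hji
          rw [hi, Option.some.injEq] at hj
          subst hj
          rw [if_pos rfl, if_pos rfl]
          exact ⟨hs.trans (h.present _ _ _ hi hA).state, hctrl, hw, hroot, fun e => (hother e).2, hnamed⟩
        · have ht : t'.1 ≠ t.1 := fun e => hji (index_inj hT hj hi e)
          rw [if_neg ht, if_neg hji]
          have hr := h.present _ _ _ hj h1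
          refine ⟨hr.state, hr.ctrl, hr.queue, ?_, hr.other, fun B hB =>
            List.mem_append_left _ (hr.named B hB)⟩
          intro e
          -- If the root is not the actor that moves, nothing is created and its record stays
          -- correct.
          rw [(hother fun e' => ht (e.trans e'.symm)).1]
          simpa [Config.dom] using hr.root e
      · intro x hx B hB
        cases hem' : em with
        | none => rw [hem'] at hx; cases hx
        | some e =>
          rw [hem'] at hx
          simp only [emOf, Option.bind_some, Option.ite_none_right_eq_some, Option.some.injEq] at hx
          exact hmsg e hem' B (hx.2 ▸ hB)
    · rw [hidle j t' hj hn]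
      have hc := hnew _ (lookup_mem h1)
      obtain ⟨c₁, hc₁, hc₂⟩ := hN _ (lookup_mem h1)
      have ht' := lookup_of_mem hT (List.mem_of_getElem? hj)
      dsimp only at hc₁ hc₂
      rw [ht', Option.some.injEq] at hc₁
      -- Any good interpretation will do for an idle process.
      obtain ⟨-, θ, hθ, -⟩ := hctrl
      obtain ⟨hq1, hq2, -, hq4, hq5⟩ := hc
      dsimp only at hq1 hq2 hq4 hq5
      refine ⟨by rw [hc₁, hc₂], ?_, by rw [hq2]; rfl, fun e => absurd e hq4, fun _ => rfl, ?_⟩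
      · rw [hq1]; exact ctrlRel_idle hθ _
      · intro B hB
        rw [Cell.act_mem_values, hq1, hq2] at hB
        rcases hB with hB | hB | ⟨x, hx, -⟩
        · simp [Proc.refs] at hB
        · exact List.mem_append.2 (hq5 B hB)
        · simp at hx

theorem nameOf_toInst {i : ℕ} {t : Actor × Cell} (hi : T[i]? = some t) :
    (toInst p S₀ T).nameOf i = t.1.code := by
  rw [Inst.nameOf, names_toInst, Config.dom, List.map_map, List.getElem?_map, hi]
  rfl

theorem size_net : (net (toInst p S₀ T)).size = T.length := by
  simp [net, toInst, Inst.tgt, Config.toCode]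

theorem lt_of_getElem?_eq_some {α : Type*} {l : List α} {i : ℕ} {x : α} (h : l[i]? = some x) :
    i < l.length := by
  by_contra hn
  rw [List.getElem?_eq_none (by omega)] at h; cases h

/-- The data of a simulation of one action. -/
theorem Rel.act (hT : TargetOK p T) {S : Config} {σ : ℕ → Ctrl × List Letter}
    (h : Rel p S₀ T S σ) {i : ℕ} {t : Actor × Cell} (hi : T[i]? = some t) {c : Cell}
    (hA : S.lookup t.1 = some c) {P : Proc} {em : Option (Actor × Msg)} {N : Config} {q' : Ctrl}
    {em' : Option (ℕ × Letter)} (ha : Act p (Config.dom S) c.state c.proc P em N)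
    (m : Match (toInst p S₀ T) T (Config.dom S) t.1 (σ i).1 P em N q' em') :
    Rel p S₀ T (S.update t.1 ⟨P, c.state, c.queue⟩ em ++ N) (Net.upd σ i (q', (σ i).2) em') := by
  have hr := h.present _ _ _ hi hA
  obtain ⟨h1, h2, h3, h4⟩ := ha.spec (· ∈ Config.dom S)
    (fun B hB => hr.named B (Cell.act_mem_values.2 (.inr (.inl hB))))
    fun B hB => hr.named B (Cell.act_mem_values.2 (.inl hB))
  refine h.update (c' := ⟨P, c.state, c.queue⟩) hT.nodup hi hA rfl m.compat m.em m.ctrl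
    (fun e => m.codes (hr.root e)) (fun e => ⟨(m.other e).1, (m.other e).2.trans (hr.other e)⟩)
    hr.queue ?_ (fun e he B hB => List.mem_append.2 ((h2 e he).2 B hB)) h3 h4
  intro B hB
  rw [Cell.act_mem_values] at hB
  rcases hB with hB | hB
  · exact List.mem_append.2 (h1 B hB)
  · exact List.mem_append_left _ (hr.named B (Cell.act_mem_values.2 (.inr hB)))

/-- The data of a simulation of the start of a method. -/
theorem Rel.start (hp : p.WellFormed) (hb : p.BoundedActors) (hr : p.ReadOnly) (hT : TargetOK p T)
    {S : Config} {σ : ℕ → Ctrl × List Letter} (h : Rel p S₀ T S σ) {i : ℕ} {t : Actor × Cell}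
    (hi : T[i]? = some t) {φ : State} {d : MethodDef} {Us : List Value} {q : List Msg}
    (hA : S.lookup t.1 = some ⟨.nil, φ, (d.name, Us) :: q⟩) (ht : t.1 ≠ .root) (hd : d ∈ p.methods)
    (hl : Us.length = d.params.length) :
    Rel p S₀ T (S.update t.1 ⟨d.start p S t.1 Us, φ, q⟩ none) (Net.upd σ i
      (norm (d.body.code, ([], (canonVals (toInst p S₀ T) (Us.map Value.code), d.params), 3), []),
        q.map (letterOf (toInst p S₀ T))) none) := by
  have hcr := h.present _ _ _ hi hA
  have hq : ∀ U ∈ Us, U ∈ Config.values S := fun U hU => Config.mem_values hA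
    (List.mem_append_right _ (List.mem_flatMap.2 ⟨_, List.mem_cons_self, hU⟩))
  rw [← List.append_nil (S.update _ _ _)]
  refine h.update (c' := ⟨d.start p S t.1 Us, φ, q⟩) hT.nodup hi hA rfl (by simp [Compat])
    (.inl ⟨rfl, rfl⟩) (ctrlRel_start hp hb hr hd t.1 hl hq) (fun e => absurd e ht)
    (fun _ => ⟨rfl, norm_snd_snd _⟩) rfl ?_ (by simp) (by simp) (by simp [Config.dom])
  intro B hB
  rw [Cell.act_mem_values] at hB
  refine List.mem_append_left _ ?_
  rcases hB with hB | hB | ⟨x, hx, hB⟩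
  · rcases acts_start hp hd hl hB with rfl | hB
    · exact (Config.mem_dom_iff _ _).2 ⟨_, hA⟩
    · exact hcr.named B (Cell.act_mem_values.2 (.inr (.inr ⟨_, List.mem_cons_self, hB⟩)))
  · exact hcr.named B (Cell.act_mem_values.2 (.inr (.inl hB)))
  · exact hcr.named B (Cell.act_mem_values.2 (.inr (.inr ⟨x, List.mem_cons_of_mem _ hx, hB⟩)))

theorem Rel.forward (hp : p.WellFormed) (hb : p.BoundedActors) (hr : p.ReadOnly) (hT : TargetOK p T)
    {S S' : Config} {σ : ℕ → Ctrl × List Letter} (h : Rel p S₀ T S σ) (hS : Sane S)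
    (hst : Step p S S') (hS' : Compat T S') :
    ∃ σ', (net (toInst p S₀ T)).Step σ σ' ∧ Rel p S₀ T S' σ' := by
  rcases hst.cases_of_updFree hS.updFree with ⟨A, c, P, em, N, hA, ha, rfl⟩ |
    ⟨C, k, φ, q, d, Us, hA, hd, hC, hl, rfl⟩
  · obtain ⟨i, t, hi, rfl⟩ := exists_index (h.sub A ((Config.mem_dom_iff _ _).2 ⟨c, hA⟩))
    have hcr := h.present _ _ _ hi hA
    obtain ⟨q', em', hq, m⟩ := (tau_sim hT ⟨t.2, lookup_of_mem hT.nodup (List.mem_of_getElem? hi),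
      hcr.state.symm⟩ hcr.ctrl hcr.root h.sub fun B hB =>
      hcr.named B (Cell.act_mem_values.2 (.inl hB))).1 P em N ha (compat_append.1 hS').2
    refine ⟨_, .tau ?_ ?_, h.act hT hi hA ha m⟩
    · rw [size_net]; exact lt_of_getElem?_eq_some hi
    · change (q', em') ∈ tauAt _ ((toInst p S₀ T).nameOf i) _
      rw [nameOf_toInst hi]; exact hq
  · obtain ⟨i, t, hi, ht⟩ := exists_index (h.sub _ ((Config.mem_dom_iff _ _).2 ⟨_, hA⟩))
    rw [← ht] at hA
    have hcr := h.present _ _ _ hi hA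
    have hne : t.1 ≠ .root := by rw [ht]; simp
    rw [← ht]
    refine ⟨_, .pop (x := letterOf (toInst p S₀ T) (d.name, Us)) ?_ ?_ hcr.queue.symm ?_,
      h.start hp hb hr hT hi hA hne hd hl⟩
    · rw [size_net]; exact lt_of_getElem?_eq_some hi
    · rw [hcr.ctrl.eq_idle, hcr.other hne]; rfl
    · change _ ∈ instAt _ ((toInst p S₀ T).nameOf i) _
      rw [nameOf_toInst hi, mem_instAt]
      exact ⟨d, hd, k, by rw [ht, hC], rfl, by simp [letterOf, canonVals_length, hl], rfl⟩

/-- No compatibility is assumed here: the net can only make compatible creations, and components of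
absent actors cannot move. -/
theorem Rel.backward (hp : p.WellFormed) (hb : p.BoundedActors) (hr : p.ReadOnly) (hT : TargetOK p T)
    {S : Config} {σ σ' : ℕ → Ctrl × List Letter} (h : Rel p S₀ T S σ)
    (hst : (net (toInst p S₀ T)).Step σ σ') : ∃ S', Step p S S' ∧ Rel p S₀ T S' σ' := by
  cases hst with
  | @tau i q' em' hi hq =>
    rw [size_net] at hi
    obtain ⟨t, hi⟩ : ∃ t, T[i]? = some t := ⟨_, List.getElem?_eq_getElem hi⟩
    change (q', em') ∈ tauAt _ ((toInst p S₀ T).nameOf i) _ at hq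
    rw [nameOf_toInst hi] at hq
    cases hA : S.lookup t.1 with
    | none =>
      rw [h.absent i t hi hA] at hq
      have : tauAt (toInst p S₀ T) t.1.code (Proc.nil.code, ([], ([], []), 0), []) = [] := tauAt_nil _ _ _ _
      change (q', em') ∈ tauAt (toInst p S₀ T) t.1.code (Proc.nil.code, ([], ([], []), 0), []) at hq
      rw [this] at hq
      cases hq
    | some c =>
      have hcr := h.present _ _ _ hi hA
      obtain ⟨P, em, N, ha, m⟩ := (tau_sim hT ⟨t.2, lookup_of_mem hT.nodup
        (List.mem_of_getElem? hi), hcr.state.symm⟩ hcr.ctrl hcr.root h.sub fun B hB =>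
        hcr.named B (Cell.act_mem_values.2 (.inl hB))).2 q' em' hq
      refine ⟨_, ha.step hA fun e he => ?_, h.act hT hi hA ha m⟩
      rcases m.em with ⟨h1, -⟩ | ⟨B, x, j, t', h1, h2, -⟩
      · rw [h1] at he; cases he
      · rw [h1, Option.some.injEq] at he
        rw [← he]; exact h2
  | @pop i x w q' hi hid hw hq =>
    rw [size_net] at hi
    obtain ⟨t, hi⟩ : ∃ t, T[i]? = some t := ⟨_, List.getElem?_eq_getElem hi⟩
    change q' ∈ instAt _ ((toInst p S₀ T).nameOf i) _ at hq
    rw [nameOf_toInst hi, mem_instAt] at hq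
    cases hA : S.lookup t.1 with
    | none => rw [h.absent i t hi hA] at hw; cases hw
    | some c =>
      have hcr := h.present _ _ _ hi hA
      obtain ⟨P, φ, Q⟩ := c
      have hP : P = .nil := hcr.ctrl.eq_nil (by rw [hid]; rfl)
      subst hP
      have hQ := hcr.queue
      rw [hw] at hQ
      cases Q with
      | nil => cases hQ
      | cons y Q =>
        dsimp only at hQ
        rw [List.map_cons, List.cons.injEq] at hQ
        obtain ⟨rfl, rfl⟩ := hQ
        obtain ⟨d, hd, k, hk, h1, h2, rfl⟩ := hq
        obtain ⟨m, Us⟩ := y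
        have h1 : d.name = m := h1
        subst h1
        have hl : Us.length = d.params.length := by
          simpa [letterOf, canonVals_length] using h2
        have hne : t.1 ≠ .root := by rw [hk]; simp
        refine ⟨_, ?_, h.start hp hb hr hT hi hA hne hd hl⟩
        rw [← Config.set_eq_update]
        rw [hk] at hA ⊢
        exact .inst hA hd rfl hl

end

section

variable {p : Program} {S₀ T : Config}

/-! ### Initial and final configurations -/

theorem Program.IsConfig.sane {S : Config} (h : p.IsConfig S) : Sane S :=
  ⟨h.nodup, fun A c hc => h.updFree A c (lookup_mem hc)⟩

theorem Program.IsConfig.targetOK (h : p.IsConfig T) : TargetOK p T := by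
  refine ⟨h.nodup, fun A c hc b hb => ?_, fun A c hc => (h.closed A c (lookup_mem hc)).2⟩
  obtain ⟨f, V⟩ := b
  cases V with
  | act B => trivial
  | var x =>
    cases A with
    | mk C i => exact (h.state C i c (lookup_mem hc)).2 f x hb
    | root =>
      obtain ⟨P, hP, -⟩ := h.root
      have := lookup_of_mem h.nodup hP
      dsimp only at this
      rw [hc, Option.some.injEq] at this
      rw [this] at hb
      cases hb

theorem letters_map (I : Inst) (q : List Msg) :
    letters I (q.map fun m => (m.1, m.2.map Value.code)) = q.map (letterOf I) := by
  rw [letters, List.map_map]; rfl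

theorem rel_init (hS : p.IsConfig S₀) (hT : (Config.dom T).Nodup) (hc : Compat T S₀) :
    Rel p S₀ T S₀ (netInit (toInst p S₀ T)) := by
  set I := toInst p S₀ T with hI
  have hlk : ∀ {i : ℕ} {t : Actor × Cell}, T[i]? = some t →
      netInit I i = ((S₀.lookup t.1).map fun c => (norm (c.proc.code, ([], ([], []), 0),
        if t.1.code = 0 then (Config.dom S₀).map Actor.code else []), c.queue.map (letterOf I))).getD
          ((0, ([], ([], []), 0), []), []) := by
    intro i t hi
    have h1 : I.source.lookup t.1.code = (S₀.lookup t.1).map Cell.toCode :=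
      lookup_map_inj Actor.code_injective Cell.toCode S₀ t.1
    have h2 : I.source.map Prod.fst = (Config.dom S₀).map Actor.code := by
      change (Config.toCode S₀).map Prod.fst = _
      rw [Config.toCode, Config.dom, List.map_map, List.map_map]; rfl
    unfold netInit
    rw [nameOf_toInst hi, h1, h2, Option.map_map]
    congr 2
    funext c
    simp only [Function.comp_apply, Cell.toCode, letters_map]
  refine ⟨hS.nodup, ?_, ?_, ?_⟩
  · intro A hA
    obtain ⟨t, ht, rfl⟩ := List.mem_map.1 hA
    obtain ⟨c, h1, -⟩ := hc t ht
    exact (Config.mem_dom_iff _ _).2 ⟨c, h1⟩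
  · intro i t hi hn
    rw [hlk hi, hn]; rfl
  · intro i t c hi hA
    rw [hlk hi, hA, Option.map_some, Option.getD_some]
    have hm := lookup_mem hA
    obtain ⟨c₁, h1, h2⟩ := hc _ hm
    rw [lookup_of_mem hT (List.mem_of_getElem? hi), Option.some.injEq] at h1
    obtain ⟨θ, hθ, hP⟩ := exists_good_closure p S₀ T t.1 (hS.closed _ _ hm).2
    refine ⟨by rw [h1, h2], .mk hθ _ hP.symm (hS.updFree _ _ hm) fun hne => ?_, rfl, ?_, ?_, ?_⟩
    · obtain ⟨A, cT⟩ := t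
      cases A with
      | root => exact absurd rfl hne
      | mk C k => exact hS.newFree C k c hm
    · intro e B
      rw [norm_snd_snd, e]
      dsimp only
      rw [if_pos (show Actor.root.code = 0 from rfl),
        List.mem_map_of_injective Actor.code_injective]
    · intro e
      rw [norm_snd_snd]
      exact if_neg fun h => e (Actor.code_injective (h.trans rfl))
    · exact fun B hB => (hS.names B ((mem_actsOf _ _).2 (Config.mem_values hA hB))).1

theorem sublistForall₂_of_iff_map {α β : Type*} {R : α → α → Prop} {f : α → β}
    (h : ∀ x y, R x y ↔ f x = f y) (l l' : List α) :
    List.SublistForall₂ R l l' ↔ (l.map f).Sublist (l'.map f) := by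
  rw [List.sublistForall₂_iff, List.sublist_map_iff]
  refine exists_congr fun m => ?_
  rw [and_comm, and_congr_right_iff]
  intro _
  rw [← List.forall₂_eq_eq_eq, List.forall₂_map_left_iff, List.forall₂_map_right_iff]
  have : R = fun x y => f x = f y := by funext x y; exact propext (h x y)
  rw [this]

theorem goal_iff_procSim {i : ℕ} {t : Actor × Cell} (hT : TargetOK p T) (hi : T[i]? = some t)
    {P : Proc} {q : Ctrl} (h : CtrlRel (toInst p S₀ T) t.1 P q) :
    canonToks (toInst p S₀ T) (targetToks (toInst p S₀ T) i) = canonToks (toInst p S₀ T)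
      ((procToks 0 q.1).map (resolveTok ((toInst p S₀ T).nameOf i) q.2.1)) ↔
      ProcSim p.main.vars t.2.proc P := by
  obtain ⟨P₀, θ, hθ, hc, rfl, -, -, -⟩ := h
  obtain ⟨θ', hθ', hP'⟩ := exists_good_closure p S₀ T t.1 (hT.this t.1 t.2
    (lookup_of_mem hT.nodup (List.mem_of_getElem? hi)))
  have h1 : targetToks (toInst p S₀ T) i =
      (procToks 0 t.2.proc.code).map (resolveTok t.1.code ([], ([], []), 0)) := by
    have h2 : (toInst p S₀ T).tgt[i]? = some (t.1.code, t.2.toCode) := by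
      change (Config.toCode T)[i]? = _
      rw [Config.toCode, List.getElem?_map, hi]; rfl
    rw [targetToks, nameOf_toInst hi, h2]; rfl
  rw [procSim_iff p S₀ T, h1, canonToks_closure _ hθ', hP', nameOf_toInst hi, ← hc,
    canonToks_closure _ hθ]

theorem compat_source_iff :
    (∀ t ∈ (toInst p S₀ T).source, (toInst p S₀ T).stateOf t.1 = some t.2.2.1) ↔ Compat T S₀ := by
  have hinj : Function.Injective fun φ : State => φ.map fun b => (b.1, b.2.code) := by
    refine List.map_injective_iff.2 fun b b' h => ?_
    simp only [Prod.mk.injEq] at h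
    exact Prod.ext h.1 (Value.code_injective h.2)
  change (∀ t ∈ Config.toCode S₀, _) ↔ _
  unfold Config.toCode
  rw [List.forall_mem_map]
  refine forall₂_congr fun t _ => ?_
  rw [stateOf_toInst]
  cases T.lookup t.1 with
  | none => simp
  | some c =>
    simp only [Option.map_some, Option.some.injEq, exists_eq_left']
    exact hinj.eq_iff (a := c.state) (b := t.2.state)

/-- Similarity of processes and embedding of queues are equalities and subwords of canonical forms.
The record of the root, compared with the names of the target, forces all actors of `T` to exist in
`S`; the opposite inclusion is part of `Rel`. -/
theorem final_iff (hT : p.IsConfig T) {S : Config} {σ : ℕ → Ctrl × List Letter}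
    (h : Rel p S₀ T S σ) :
    (net (toInst p S₀ T)).Final σ ↔ Compat T S₀ ∧ ConfigLE p T S := by
  set I := toInst p S₀ T with hI
  have htok := hT.targetOK
  have hgoal : ∀ i, (net I).goal i (σ i).1 = true ↔ goalAt I i (σ i).1 := fun i => decide_eq_true_iff
  have htgt : ∀ i t, T[i]? = some t → (net I).target i = t.2.queue.map (letterOf I) := by
    intro i t hi
    have h2 : I.tgt[i]? = some (t.1.code, t.2.toCode) := by
      change (Config.toCode T)[i]? = _
      rw [Config.toCode, List.getElem?_map, hi]; rfl
    change letters I (((I.tgt[i]?).map fun t => t.2.2.2).getD []) = _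
    rw [h2, ← letters_map]; rfl
  have hq : ∀ l l' : List Msg, List.SublistForall₂ (MsgSim p.main.vars) l l' ↔
      (l.map (letterOf I)).Sublist (l'.map (letterOf I)) :=
    sublistForall₂_of_iff_map (msgSim_iff p S₀ T)
  obtain ⟨P, hP, -⟩ := hT.root
  obtain ⟨r, tr, hr, hr'⟩ := exists_index (List.mem_map.2 ⟨_, hP, rfl⟩)
  have hr' : tr.1 = .root := hr'
  have hnames : (∀ a ∈ I.names, a ∈ (σ r).1.2.2) ↔ ∀ A ∈ Config.dom T, A.code ∈ (σ r).1.2.2 := by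
    rw [hI, names_toInst, List.forall_mem_map]
  constructor
  · intro hf
    have hf' : ∀ i t, T[i]? = some t → goalAt I i (σ i).1 ∧
        (t.2.queue.map (letterOf I)).Sublist (σ i).2 := by
      intro i t hi
      obtain ⟨h1, h2⟩ := hf i (by rw [size_net]; exact lt_of_getElem?_eq_some hi)
      exact ⟨(hgoal i).1 h1, htgt i t hi ▸ h2⟩
    obtain ⟨g1, g2, g3⟩ := (hf' r tr hr).1
    rw [nameOf_toInst hr, hnames] at g3
    have g3 := g3 (by rw [hr']; rfl)
    refine ⟨compat_source_iff.1 g1, fun A => ?_⟩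
    by_cases hA : A ∈ Config.dom T
    · obtain ⟨i, t, hi, rfl⟩ := exists_index hA
      have hmem : t.1 ∈ Config.dom S := by
        cases hroot : S.lookup tr.1 with
        | none => rw [h.absent r tr hr hroot] at g3; cases g3 _ hA
        | some c => exact ((h.present r tr c hr hroot).root hr' _).1 (g3 _ hA)
      obtain ⟨c, hc⟩ := (Config.mem_dom_iff _ _).1 hmem
      rw [hc, lookup_of_mem htok.nodup (List.mem_of_getElem? hi)]
      have hcr := h.present i t c hi hc
      obtain ⟨⟨-, k1, -⟩, k2⟩ := hf' i t hi
      exact .some ⟨(goal_iff_procSim htok hi hcr.ctrl).1 k1, hcr.state.symm,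
        (hq _ _).2 (hcr.queue ▸ k2)⟩
    · have hS : A ∉ Config.dom S := fun hm => hA (h.sub A hm)
      rw [lookup_eq_none_iff_notMem.2 hA, lookup_eq_none_iff_notMem.2 hS]
      exact .none
  · rintro ⟨hc, hle⟩ i hi
    rw [size_net] at hi
    obtain ⟨t, hi⟩ : ∃ t, T[i]? = some t := ⟨_, List.getElem?_eq_getElem hi⟩
    have hl := hle t.1
    rw [lookup_of_mem htok.nodup (List.mem_of_getElem? hi)] at hl
    generalize hSl : S.lookup t.1 = o at hl
    cases hl with
    | @some _ c hl =>
      have hcr := h.present i t c hi hSl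
      rw [hgoal, htgt i t hi, ← hcr.queue]
      refine ⟨⟨compat_source_iff.2 hc, (goal_iff_procSim htok hi hcr.ctrl).2 hl.1, ?_⟩,
        (hq _ _).1 hl.2.2⟩
      rw [nameOf_toInst hi]
      intro e a ha
      have e : t.1 = .root := Actor.code_injective (e.trans rfl)
      rw [hI, names_toInst, List.mem_map] at ha
      obtain ⟨A, hA, rfl⟩ := ha
      rw [hcr.root e A]
      obtain ⟨cA, hcA⟩ := (Config.mem_dom_iff _ _).1 hA
      have hlA := hle A
      rw [hcA] at hlA
      generalize hSA : S.lookup A = o at hlA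
      cases hlA with
      | some _ => exact (Config.mem_dom_iff _ _).2 ⟨_, hSA⟩

/-! ### Decidability -/

/-- `Compat` is pulled back from the end of the run, so that the net can follow each creation,
whereas `Sane` is carried forward from its start; hence the implication in `hT'`. -/
theorem exists_run_of_reach (hp : p.WellFormed) (hb : p.BoundedActors) (hr : p.ReadOnly)
    (hT : TargetOK p T) {S T' : Config} (hst : Relation.ReflTransGen (Step p) S T')
    (hT' : Sane T' → Compat T T') (hS : Sane S) : Compat T S ∧ ∀ σ, Rel p S₀ T S σ →
      ∃ σ', Relation.ReflTransGen (net (toInst p S₀ T)).Step σ σ' ∧ Rel p S₀ T T' σ' := by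
  induction hst using Relation.ReflTransGen.head_induction_on with
  | refl => exact ⟨hT' hS, fun σ h => ⟨σ, .refl, h⟩⟩
  | head hst _ ih =>
    obtain ⟨h1, h2⟩ := ih (hst.sane hr hS)
    refine ⟨hst.compat hS h1, fun σ h => ?_⟩
    obtain ⟨σ₁, h3, h4⟩ := h.forward hp hb hr hT hS hst h1
    obtain ⟨σ', h5, h6⟩ := h2 σ₁ h4
    exact ⟨σ', .head h3 h5, h6⟩

theorem exists_reach_of_run (hp : p.WellFormed) (hb : p.BoundedActors) (hr : p.ReadOnly)
    (hT : TargetOK p T) {S : Config} {σ σ' : ℕ → Ctrl × List Letter}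
    (hst : Relation.ReflTransGen (net (toInst p S₀ T)).Step σ σ') (h : Rel p S₀ T S σ) :
    ∃ T', Relation.ReflTransGen (Step p) S T' ∧ Rel p S₀ T T' σ' := by
  induction hst with
  | refl => exact ⟨S, .refl, h⟩
  | tail _ hst ih =>
    obtain ⟨S₁, h1, h2⟩ := ih
    obtain ⟨S₂, h3, h4⟩ := h2.backward hp hb hr hT hst
    exact ⟨S₂, h1.tail h3, h4⟩

theorem compat_of_configLE {T' : Config} (h : ConfigLE p T T') (hT' : Sane T') : Compat T T' := by
  intro t ht
  have := h t.1
  rw [lookup_of_mem hT'.nodup ht] at this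
  generalize hl : T.lookup t.1 = o at this
  cases this with
  | some h => exact ⟨_, rfl, h.2.1⟩

/-- The net of an instance decides control-state reachability. -/
theorem reach_net_iff (hp : p.WellFormed) (hb : p.BoundedActors) (hr : p.ReadOnly)
    (hS : p.IsConfig S₀) (hT : p.IsConfig T) :
    (net (toInst p S₀ T)).Reach (netInit (toInst p S₀ T)) ↔ ControlStateReachable p S₀ T := by
  constructor
  · rintro ⟨σ, h1, h2⟩
    -- Every component tests the compatibility of the source; the root guarantees that there is a
    -- component.
    have hc : Compat T S₀ := by
      obtain ⟨P, hP, -⟩ := hT.root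
      obtain ⟨r, tr, hr, -⟩ := exists_index (List.mem_map.2 ⟨_, hP, rfl⟩)
      have := (h2 r (by rw [size_net]; exact lt_of_getElem?_eq_some hr)).1
      exact compat_source_iff.1 (of_decide_eq_true this).1
    obtain ⟨T', h3, h4⟩ := exists_reach_of_run hp hb hr hT.targetOK h1 (rel_init hS hT.nodup hc)
    exact ⟨T', h3, ((final_iff hT h4).1 h2).2⟩
  · rintro ⟨T', h1, h2⟩
    obtain ⟨hc, h3⟩ := exists_run_of_reach (S₀ := S₀) hp hb hr hT.targetOK h1
      (compat_of_configLE h2) hS.sane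
    obtain ⟨σ, h4, h5⟩ := h3 _ (rel_init hS hT.nodup hc)
    exact ⟨σ, h4, (final_iff hT h5).2 ⟨hc, h2⟩⟩

end

end ActorLang

theorem mainTheorem5 :
    ∃ f : ℕ → Bool, Computable f ∧
      ∀ (p : ActorLang.Program) (S T : ActorLang.Config),
        p.WellFormed → p.BoundedActors → p.ReadOnly → p.IsConfig S → p.IsConfig T →
          (f (ActorLang.instanceCode p S T) = true ↔
            ActorLang.ControlStateReachable p S T) := by
  obtain ⟨hdec, hcomp⟩ := ActorLang.computablePred_net
  -- `f` decodes its argument by `parse` and decides the resulting net. It is total, and its values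
  -- on other numbers do not matter.
  refine ⟨_, hcomp.comp ActorLang.prim_parse.to_comp, fun p S T hp hb hr hS hT => ?_⟩
  rw [decide_eq_true_iff, ActorLang.parse_instanceCode]
  exact ActorLang.reach_net_iff hp hb hr hS hT
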